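/- All graphs are finite and simple. A path or cycle of a graph is *chordless* if no edge of the graph joins two of its vertices that are not consecutive on it; the *length* of a path or cycle is its number of edges. A *hole* is a chordless cycle with at least four vertices, and an *antihole* of length $n$ of $G$ is a hole of length $n$ of the complement $\overline{G}$. A *prism* is a graph consisting of two vertex-disjoint triangles, $a_1a_2a_3$ and $b_1b_2b_3$, and three pairwise vertex-disjoint paths $P_i$ from $a_i$ to $b_i$ ($i=1,2,3$), with no edge other than those of the two triangles and of the three paths. An *$(a,b)$-snake* is a graph consisting of four pairwise vertex-disjoint chordless paths $S_1=a\cdots a'$, $S_2=b\cdots b'$, $S_3=c\cdots c'$, $S_4=d\cdots d'$, where $S_1,S_2$ may have length $0$ but $S_3,S_4$ have length at least $1$, and whose edge set is $E(S_1)\cup E(S_2)\cup E(S_3)\cup E(S_4)\cup\{a'c,a'd,cd,b'c',b'd',c'd'\}$; it is *proper* if at least one of $S_1,S_2$ has length at least $1$. A graph *contains* a prism or a snake if it has it as an induced subgraph. An *even pair* of $G$ is a pair $\{a,b\}$ of distinct non-adjacent vertices such that every chordless path of $G$ between $a$ and $b$ has even length. It is *special* if $G$ contains no proper $(a,b)$-snake.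 For $T\subseteq V(G)$, let $C(T)$ be the set of vertices of $V(G)\setminus T$ that are adjacent to all vertices of $T$. A non-empty set $T\subseteq V(G)$ is *interesting* if $\overline{G}[T]$ is connected and $C(T)$ is not a clique of $G$ (the empty set being a clique). **Theorem.** Let $G$ be a graph that contains no odd hole, no antihole of length at least $5$ and no prism, and that is not a disjoint union of cliques. Let $T$ be any interesting set of $G$. Then $C(T)$ contains a special even pair of $G$, that is, there are $a,b\in C(T)$ such that $\{a,b\}$ is a special even pair of $G$. -/

import Mathlib

namespace SimpleGraph

variable {V : Type*}

/-- `G` contains a hole of length `n`: a chordless cycle with `n ≥ 4` vertices. -/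
def HasHole (G : SimpleGraph V) (n : ℕ) : Prop :=
  4 ≤ n ∧ ∃ (v : V) (p : G.Walk v v), p.IsCycle ∧ p.IsChordless ∧ p.length = n

/-- `G` contains an antihole of length `n`: the complement of `G` contains a hole of length `n`. -/
def HasAntihole (G : SimpleGraph V) (n : ℕ) : Prop :=
  Gᶜ.HasHole n

/-- An induced prism of `G`: two vertex-disjoint triangles `a 0, a 1, a 2` and `b 0, b 1, b 2`,
with three pairwise vertex-disjoint paths `P i` from `a i` to `b i`, such that the edges of `G`
between vertices of these paths are exactly the edges of the paths and of the two triangles. -/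
structure Prism (G : SimpleGraph V) where
  a : Fin 3 → V
  b : Fin 3 → V
  P : ∀ i, G.Walk (a i) (b i)
  isPath : ∀ i, (P i).IsPath
  ne : ∀ i, a i ≠ b i
  disjoint : ∀ i j, i ≠ j → (P i).support.Disjoint (P j).support
  adj_iff : ∀ x y, (∃ i, x ∈ (P i).support) → (∃ j, y ∈ (P j).support) →
    (G.Adj x y ↔
      (∃ i, s(x, y) ∈ (P i).edges) ∨
      ∃ i j, i ≠ j ∧ (s(x, y) = s(a i, a j) ∨ s(x, y) = s(b i, b j)))

/-- An induced `(a, b)`-snake of `G`: four pairwise vertex-disjoint paths `S₁ = a ⋯ a'`,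
`S₂ = b ⋯ b'`, `S₃ = c ⋯ c'`, `S₄ = d ⋯ d'`, the last two of length at least `1`, such that the
edges of `G` between vertices of these paths are exactly the edges of the paths and the edges of
the triangles `a'cd` and `b'c'd'`. (So the four paths are chordless.) -/
structure Snake (G : SimpleGraph V) (a b : V) where
  a' : V
  b' : V
  c : V
  c' : V
  d : V
  d' : V
  S₁ : G.Walk a a'
  S₂ : G.Walk b b'
  S₃ : G.Walk c c'
  S₄ : G.Walk d d'
  isPath₁ : S₁.IsPath
  isPath₂ : S₂.IsPath
  isPath₃ : S₃.IsPath
  isPath₄ : S₄.IsPath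
  one_le₃ : 1 ≤ S₃.length
  one_le₄ : 1 ≤ S₄.length
  disjoint₁₂ : S₁.support.Disjoint S₂.support
  disjoint₁₃ : S₁.support.Disjoint S₃.support
  disjoint₁₄ : S₁.support.Disjoint S₄.support
  disjoint₂₃ : S₂.support.Disjoint S₃.support
  disjoint₂₄ : S₂.support.Disjoint S₄.support
  disjoint₃₄ : S₃.support.Disjoint S₄.support
  adj_iff : ∀ x y,
    x ∈ S₁.support ++ S₂.support ++ S₃.support ++ S₄.support →
    y ∈ S₁.support ++ S₂.support ++ S₃.support ++ S₄.support →
    (G.Adj x y ↔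
      s(x, y) ∈ S₁.edges ++ S₂.edges ++ S₃.edges ++ S₄.edges ++
        [s(a', c), s(a', d), s(c, d), s(b', c'), s(b', d'), s(c', d')])

/-- A snake is proper if at least one of `S₁`, `S₂` has length at least `1`. -/
def Snake.IsProper {G : SimpleGraph V} {a b : V} (S : G.Snake a b) : Prop :=
  1 ≤ S.S₁.length ∨ 1 ≤ S.S₂.length

/-- Two distinct non-adjacent vertices such that every chordless path between them has even
length. -/
def IsEvenPair (G : SimpleGraph V) (a b : V) : Prop :=
  a ≠ b ∧ ¬ G.Adj a b ∧ ∀ p : G.Walk a b, p.IsPath → p.IsChordless → Even p.length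

/-- A special even pair: an even pair `{a, b}` such that `G` contains no proper `(a, b)`-snake. -/
def IsSpecialEvenPair (G : SimpleGraph V) (a b : V) : Prop :=
  G.IsEvenPair a b ∧ ¬ ∃ S : G.Snake a b, S.IsProper

/-- `C(T)`: the set of vertices outside `T` that are adjacent to all vertices of `T`. -/
def completeVerts (G : SimpleGraph V) (T : Set V) : Set V :=
  {v | v ∉ T ∧ ∀ t ∈ T, G.Adj v t}

/-- A non-empty set `T` is interesting if the complement of `G` induces a connected graph on `T`
and `C(T)` is not a clique of `G`. -/
def IsInteresting (G : SimpleGraph V) (T : Set V) : Prop :=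
  T.Nonempty ∧ (Gᶜ.induce T).Connected ∧ ¬ G.IsClique (G.completeVerts T)

/-- Every connected component of `G` is a clique. -/
def IsDisjointUnionOfCliques (G : SimpleGraph V) : Prop :=
  ∀ K : G.ConnectedComponent, G.IsClique K.supp

/-- The class of graphs with no odd hole, no antihole of length at least `5` and no prism. -/
def InClassA (G : SimpleGraph V) : Prop :=
  (∀ n, Odd n → ¬ G.HasHole n) ∧ (∀ n, 5 ≤ n → ¬ G.HasAntihole n) ∧ IsEmpty G.Prism

end SimpleGraph

/-! Enlarging `T` only shrinks `C(T)`, so `T` may be taken maximal among the interesting sets. Call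
a vertex outer if it is neither in `T` nor complete to `T`. Maximality forces the neighbours in
`C(T)` of an outer vertex to form a clique (`adj_of_maximal`), for otherwise this vertex could be
added to `T`.

Call an induced path of length at least 2 an outer path if its ends are in `C(T)` and its other
vertices are outer. If there is none, every induced path between non-adjacent vertices of `C(T)`
that has length other than 2 stays in `C(T)`. Parities of paths and snakes are then decided in the
smaller graph induced on `C(T)`, and induction on the number of vertices applies. When this induced
graph is a disjoint union of cliques, two non-adjacent vertices of it are joined by no path at all.

Otherwise take a shortest outer path `z 0, …, z n` (`IsFrame`). Its length is even by the
Roussel–Rubio lemma (`InClassA.evenOuter`), hence at least 4. Let `A` and `B` be the sets of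
`T`-complete vertices whose only neighbour in its interior is `z 1`, respectively `z (n - 1)`. They
are cliques without edges between them, and any other `T`-complete vertex attached to the interior
is complete to both. An odd induced path from `A` to `B` has its second vertex in `A` or its
penultimate vertex in `B` (`IsFrame.second_or_penultimate`). Choosing `a` in `A`, and symmetrically
`b` in `B`, with a smallest far component excludes both (`IsFrame.exists_ends`), so `{a, b}` is an
even pair. `IsFrame.false_of_isSnake` excludes proper snakes.

Three obstructions carry the work: a triangle on an edge of a hole and linked to the rest of it
(`InClassA.false_of_linked_triangle`: a prism or an odd hole), an edge covering `T` and missed by a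
`T`-complete vertex (`InClassA.false_of_cover`: a long antihole), and a hole with exactly two
`T`-complete vertices, consecutive and linked to a third (`InClassA.false_of_linked_edge`). The
parity lemma `InClassA.even_of_attached` combines them. It is used with `L` a vertex removed from
`T` (Roussel–Rubio), the interior of the frame (even pair), the vertex `z 1` (choice of ends), and
the vertex `d` of a snake. -/

namespace SimpleGraph

variable {V : Type*} {G : SimpleGraph V}

/-! ### Induced paths and cycles as sequences of vertices -/

/-- `p 0, …, p n` is an induced path of `G`. -/
def IndPath (G : SimpleGraph V) (p : ℕ → V) (n : ℕ) : Prop :=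
  ∀ i j, i < j → j ≤ n → p i ≠ p j ∧ (G.Adj (p i) (p j) ↔ j = i + 1)

/-- `p 0, …, p m` is an induced cycle of `G` (through the edge `p m, p 0`). -/
def IndCycle (G : SimpleGraph V) (p : ℕ → V) (m : ℕ) : Prop :=
  ∀ i j, i < j → j ≤ m → p i ≠ p j ∧ (G.Adj (p i) (p j) ↔ j = i + 1 ∨ (i = 0 ∧ j = m))

/-- `S` is the vertex set of an induced path of length `n` from `x` to `y`. -/
def IP (G : SimpleGraph V) (S : Set V) (x y : V) (n : ℕ) : Prop :=
  ∃ p : ℕ → V, p 0 = x ∧ p n = y ∧ S = p '' Set.Iic n ∧ G.IndPath p n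

/-- `S` is the vertex set of an induced cycle with `m + 1` vertices through the edge `xy`. -/
def Cyc (G : SimpleGraph V) (S : Set V) (x y : V) (m : ℕ) : Prop :=
  ∃ p : ℕ → V, p 0 = x ∧ p m = y ∧ S = p '' Set.Iic m ∧ G.IndCycle p m

/-- Any two vertices of `S` are joined by a walk inside `S`. -/
def Conn (G : SimpleGraph V) (S : Set V) : Prop :=
  ∀ x ∈ S, ∀ y ∈ S, Relation.ReflTransGen (fun a b => G.Adj a b ∧ a ∈ S ∧ b ∈ S) x y

/-- `v` is in `S` or has a neighbour in `S`. -/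
def Touches (G : SimpleGraph V) (v : V) (S : Set V) : Prop :=
  v ∈ S ∨ ∃ s ∈ S, G.Adj v s

theorem exists_walk_of_seq (p : ℕ → V) (n : ℕ) (h : ∀ i < n, G.Adj (p i) (p (i + 1))) :
    ∃ w : G.Walk (p 0) (p n), w.support = (List.range (n + 1)).map p ∧
      w.edges = (List.range n).map (fun i => s(p i, p (i + 1))) := by
  induction n with
  | zero => exact ⟨.nil, by simp, by simp⟩
  | succ n ih =>
    obtain ⟨w, hs, he⟩ := ih (fun i hi => h i (by omega))
    refine ⟨w.concat (h n (by omega)), ?_, ?_⟩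
    · rw [Walk.support_concat, hs, List.range_succ (n := n + 1)]; simp
    · rw [Walk.edges_concat, he, List.range_succ (n := n)]; simp

theorem IndPath.adj_succ {p : ℕ → V} {n : ℕ} (h : G.IndPath p n) {i : ℕ} (hi : i < n) :
    G.Adj (p i) (p (i + 1)) := (h i (i + 1) (by omega) (by omega)).2.2 rfl

theorem IndPath.inj {p : ℕ → V} {n : ℕ} (h : G.IndPath p n) {i j : ℕ} (hi : i ≤ n) (hj : j ≤ n)
    (e : p i = p j) : i = j := by
  rcases lt_trichotomy i j with hl | hl | hl
  · exact absurd e (h i j hl hj).1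
  · exact hl
  · exact absurd e.symm (h j i hl hi).1

theorem IndPath.adj_iff {p : ℕ → V} {n : ℕ} (h : G.IndPath p n) {i j : ℕ} (hi : i ≤ n)
    (hj : j ≤ n) : G.Adj (p i) (p j) ↔ j = i + 1 ∨ i = j + 1 := by
  rcases lt_trichotomy i j with hl | hl | hl
  · rw [(h i j hl hj).2]; omega
  · subst hl; simp
  · rw [G.adj_comm, (h j i hl hi).2]; omega

theorem IndPath.mono {p : ℕ → V} {n m : ℕ} (h : G.IndPath p n) (hm : m ≤ n) : G.IndPath p m :=
  fun i j hij hj => h i j hij (hj.trans hm)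

theorem IndCycle.inj {p : ℕ → V} {n : ℕ} (h : G.IndCycle p n) {i j : ℕ} (hi : i ≤ n) (hj : j ≤ n)
    (e : p i = p j) : i = j := by
  rcases lt_trichotomy i j with hl | hl | hl
  · exact absurd e (h i j hl hj).1
  · exact hl
  · exact absurd e.symm (h j i hl hi).1

theorem IP.exists_walk {S : Set V} {x y : V} {n : ℕ} (h : G.IP S x y n) :
    ∃ w : G.Walk x y, w.IsPath ∧ w.IsChordless ∧ w.length = n ∧ ∀ v, v ∈ w.support ↔ v ∈ S := by
  obtain ⟨p, rfl, rfl, rfl, hp⟩ := h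
  obtain ⟨w, hs, he⟩ := exists_walk_of_seq (G := G) p n (fun i hi => hp.adj_succ hi)
  refine ⟨w, ?_, ?_, ?_, ?_⟩
  · refine Walk.IsPath.mk' ?_
    rw [hs]
    refine List.Nodup.map_on ?_ List.nodup_range
    intro i hi j hj e
    simp only [List.mem_range] at hi hj
    exact hp.inj (by omega) (by omega) e
  · rw [Walk.isChordless_iff_forall_mem_edges]
    intro u v hu hv ha
    rw [hs, List.mem_map] at hu hv
    obtain ⟨i, hi, rfl⟩ := hu
    obtain ⟨j, hj, rfl⟩ := hv
    simp only [List.mem_range] at hi hj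
    rw [he, List.mem_map]
    rcases (hp.adj_iff (by omega) (by omega)).1 ha with rfl | rfl
    · exact ⟨i, by simp; omega, rfl⟩
    · exact ⟨j, by simp; omega, Sym2.eq_swap⟩
  · have := congrArg List.length hs
    simpa using this
  · intro v
    rw [hs]
    simp

theorem Walk.IsPath.indPath {x y : V} {w : G.Walk x y} (hp : w.IsPath) (hc : w.IsChordless) :
    G.IndPath w.getVert w.length := by
  intro i j hij hj
  have inj := hp.getVert_injOn
  refine ⟨fun e => ?_, ?_, ?_⟩
  · have := inj (show i ≤ _ by omega) (show j ≤ _ from hj) e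
    omega
  · intro ha
    have he := hc.mem_edges (w.getVert_mem_support i) (w.getVert_mem_support j) ha
    obtain ⟨k, hk, hk'⟩ := List.mem_iff_getElem.1 he
    rw [Walk.length_edges] at hk
    rw [Walk.getElem_edges] at hk'
    rw [Sym2.eq_iff] at hk'
    rcases hk' with ⟨h1, h2⟩ | ⟨h1, h2⟩
    · have := inj (show k ≤ _ by omega) (show i ≤ _ by omega) h1
      have := inj (show k + 1 ≤ _ by omega) (show j ≤ _ by omega) h2
      omega
    · have := inj (show k ≤ _ by omega) (show j ≤ _ by omega) h1
      have := inj (show k + 1 ≤ _ by omega) (show i ≤ _ by omega) h2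
      omega
  · rintro rfl
    exact w.adj_getVert_succ (by omega)

theorem Walk.IsPath.ip {x y : V} {w : G.Walk x y} (hp : w.IsPath) (hc : w.IsChordless) :
    G.IP {v | v ∈ w.support} x y w.length := by
  refine ⟨w.getVert, by simp, by simp, ?_, hp.indPath hc⟩
  ext v
  simp only [Set.mem_ofPred_eq, Set.mem_image, Set.mem_Iic, Walk.mem_support_iff_exists_getVert]
  exact ⟨fun ⟨n, a, b⟩ => ⟨n, b, a⟩, fun ⟨n, a, b⟩ => ⟨n, b, a⟩⟩

theorem Cyc.hasHole {S : Set V} {x y : V} {m : ℕ} (h : G.Cyc S x y m) (hm : 3 ≤ m) :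
    G.HasHole (m + 1) := by
  obtain ⟨p, -, -, -, hp⟩ := h
  obtain ⟨w, hs, he⟩ := exists_walk_of_seq (G := G) p m
    (fun i hi => (hp i (i + 1) (by omega) (by omega)).2.2 (Or.inl rfl))
  have hadj : G.Adj (p m) (p 0) := ((hp 0 m (by omega) le_rfl).2.2 (Or.inr ⟨rfl, rfl⟩)).symm
  refine ⟨by omega, p m, Walk.cons hadj w, ?_, ?_, ?_⟩
  · rw [Walk.cons_isCycle_iff]
    constructor
    · refine Walk.IsPath.mk' ?_
      rw [hs]
      refine List.Nodup.map_on ?_ List.nodup_range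
      intro i hi j hj e
      simp only [List.mem_range] at hi hj
      exact hp.inj (by omega) (by omega) e
    · rw [he, List.mem_map]
      rintro ⟨i, hi, e⟩
      simp only [List.mem_range] at hi
      rw [Sym2.eq_iff] at e
      rcases e with ⟨h1, h2⟩ | ⟨h1, h2⟩
      · have := hp.inj (by omega) (by omega) h1; omega
      · have := hp.inj (by omega) (by omega) h1
        have := hp.inj (by omega) (by omega) h2; omega
  · rw [Walk.isChordless_iff_forall_mem_edges]
    have key : ∀ i j, i < j → j ≤ m → G.Adj (p i) (p j) →
        s(p i, p j) ∈ (Walk.cons hadj w).edges := by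
      intro i j hij hj ha
      rw [Walk.edges_cons, he]
      rcases (hp i j hij hj).2.1 ha with rfl | ⟨rfl, rfl⟩
      · refine List.mem_cons_of_mem _ (List.mem_map.2 ⟨i, by simp; omega, rfl⟩)
      · rw [Sym2.eq_swap]; exact List.mem_cons_self
    intro u v hu hv ha
    have hsup : ∀ u, u ∈ (Walk.cons hadj w).support → ∃ i ≤ m, p i = u := by
      intro u hu
      rw [Walk.support_cons, hs] at hu
      rcases List.mem_cons.1 hu with rfl | hu
      · exact ⟨m, le_rfl, rfl⟩
      · obtain ⟨i, hi, rfl⟩ := List.mem_map.1 hu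
        simp only [List.mem_range] at hi
        exact ⟨i, by omega, rfl⟩
    obtain ⟨i, hi, rfl⟩ := hsup u hu
    obtain ⟨j, hj, rfl⟩ := hsup v hv
    rcases lt_trichotomy i j with hl | hl | hl
    · exact key i j hl hj ha
    · subst hl; exact absurd ha (G.loopless.irrefl _)
    · rw [Sym2.eq_swap]; exact key j i hl hi ha.symm
  · have := congrArg List.length hs
    simp at this
    simp [this]

/-! ### Operations on induced paths and cycles -/

/-- Only the window from `i` to `j` has to be induced, so this serves for arcs of a cycle as well as
for pieces of a path. -/
theorem IP.of_seg {p : ℕ → V} {i j : ℕ} (hij : i ≤ j)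
    (h : ∀ a b, i ≤ a → a < b → b ≤ j → p a ≠ p b ∧ (G.Adj (p a) (p b) ↔ b = a + 1)) :
    G.IP (p '' Set.Icc i j) (p i) (p j) (j - i) := by
  refine ⟨fun k => p (i + k), by simp, by simp; congr 1; omega, ?_, ?_⟩
  · ext v
    simp only [Set.mem_image, Set.mem_Icc, Set.mem_Iic]
    constructor
    · rintro ⟨k, hk, rfl⟩
      exact ⟨k - i, by omega, by congr 1; omega⟩
    · rintro ⟨k, hk, rfl⟩
      exact ⟨i + k, by omega, rfl⟩
  · intro a b hab hb
    obtain ⟨h1, h2⟩ := h (i + a) (i + b) (by omega) (by omega) (by omega)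
    refine ⟨h1, h2.trans (by omega)⟩

theorem IndPath.seg {p : ℕ → V} {n i j : ℕ} (h : G.IndPath p n) (hij : i ≤ j) (hj : j ≤ n) :
    G.IP (p '' Set.Icc i j) (p i) (p j) (j - i) :=
  IP.of_seg hij (fun a b _ hab hb => h a b hab (by omega))

theorem IndPath.ip {p : ℕ → V} {n : ℕ} (h : G.IndPath p n) :
    G.IP (p '' Set.Iic n) (p 0) (p n) n := ⟨p, rfl, rfl, rfl, h⟩

theorem IP.single (x : V) : G.IP {x} x x 0 :=
  ⟨fun _ => x, rfl, rfl, by ext; simp, fun i j h1 h2 => by omega⟩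

theorem IP.symm {S : Set V} {x y : V} {n : ℕ} (h : G.IP S x y n) : G.IP S y x n := by
  obtain ⟨p, rfl, rfl, rfl, hp⟩ := h
  refine ⟨fun k => p (n - k), by simp, by simp, ?_, ?_⟩
  · ext v
    simp only [Set.mem_image, Set.mem_Iic]
    constructor
    · rintro ⟨k, hk, rfl⟩
      exact ⟨n - k, by omega, by congr 1; omega⟩
    · rintro ⟨k, hk, rfl⟩
      exact ⟨n - k, by omega, rfl⟩
  · intro a b hab hb
    obtain ⟨h1, h2⟩ := hp (n - b) (n - a) (by omega) (by omega)
    refine ⟨h1.symm, ?_⟩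
    rw [G.adj_comm, h2]; omega

theorem IP.left_mem {S : Set V} {x y : V} {n : ℕ} (h : G.IP S x y n) : x ∈ S := by
  obtain ⟨p, rfl, rfl, rfl, hp⟩ := h
  exact ⟨0, by simp, rfl⟩

theorem IP.right_mem {S : Set V} {x y : V} {n : ℕ} (h : G.IP S x y n) : y ∈ S := h.symm.left_mem

theorem IP.join {S S' : Set V} {x u v y : V} {m n : ℕ} (h : G.IP S x u m) (h' : G.IP S' v y n)
    (huv : G.Adj u v) (hc : ∀ s ∈ S, ∀ s' ∈ S', s ≠ s' ∧ (G.Adj s s' → s = u ∧ s' = v)) :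
    G.IP (S ∪ S') x y (m + 1 + n) := by
  obtain ⟨p, rfl, rfl, rfl, hp⟩ := h
  obtain ⟨q, rfl, rfl, rfl, hq⟩ := h'
  refine ⟨fun k => if k ≤ m then p k else q (k - (m + 1)), by simp, ?_, ?_, ?_⟩
  · simp only
    rw [if_neg (by omega)]
    congr 1; omega
  · ext v
    simp only [Set.mem_union, Set.mem_image, Set.mem_Iic]
    constructor
    · rintro (⟨k, hk, rfl⟩ | ⟨k, hk, rfl⟩)
      · exact ⟨k, by omega, if_pos hk⟩
      · refine ⟨m + 1 + k, by omega, ?_⟩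
        rw [if_neg (by omega)]
        congr 1; omega
    · rintro ⟨k, hk, rfl⟩
      split_ifs with hkm
      · exact Or.inl ⟨k, hkm, rfl⟩
      · exact Or.inr ⟨k - (m + 1), by omega, rfl⟩
  · intro a b hab hb
    simp only
    by_cases hbm : b ≤ m
    · rw [if_pos hbm, if_pos (by omega)]
      exact hp a b hab hbm
    · rw [if_neg hbm]
      by_cases ham : a ≤ m
      · rw [if_pos ham]
        obtain ⟨h1, h2⟩ := hc (p a) ⟨a, ham, rfl⟩ (q (b - (m + 1))) ⟨_, by simp; omega, rfl⟩
        refine ⟨h1, fun hadj => ?_, fun e => ?_⟩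
        · obtain ⟨e1, e2⟩ := h2 hadj
          have := hp.inj ham le_rfl e1
          have := hq.inj (by omega) (by omega) e2
          omega
        · have e1 : a = m := by omega
          have e2 : b - (m + 1) = 0 := by omega
          rw [e1, e2]; exact huv
      · rw [if_neg ham]
        obtain ⟨h1, h2⟩ := hq (a - (m + 1)) (b - (m + 1)) (by omega) (by omega)
        exact ⟨h1, h2.trans (by omega)⟩

/-- Two disjoint induced paths joined by two edges at their ends form an induced cycle. -/
theorem IP.join_cyc {S S' : Set V} {x u v y : V} {m n : ℕ} (h : G.IP S x u m) (h' : G.IP S' v y n)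
    (huv : G.Adj u v) (hxy : G.Adj x y)
    (hc : ∀ s ∈ S, ∀ s' ∈ S', s ≠ s' ∧ (G.Adj s s' → (s = u ∧ s' = v) ∨ (s = x ∧ s' = y))) :
    G.Cyc (S ∪ S') x y (m + 1 + n) := by
  obtain ⟨p, rfl, rfl, rfl, hp⟩ := h
  obtain ⟨q, rfl, rfl, rfl, hq⟩ := h'
  refine ⟨fun k => if k ≤ m then p k else q (k - (m + 1)), by simp, ?_, ?_, ?_⟩
  · simp only
    rw [if_neg (by omega)]
    congr 1; omega
  · ext v
    simp only [Set.mem_union, Set.mem_image, Set.mem_Iic]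
    constructor
    · rintro (⟨k, hk, rfl⟩ | ⟨k, hk, rfl⟩)
      · exact ⟨k, by omega, if_pos hk⟩
      · refine ⟨m + 1 + k, by omega, ?_⟩
        rw [if_neg (by omega)]
        congr 1; omega
    · rintro ⟨k, hk, rfl⟩
      split_ifs with hkm
      · exact Or.inl ⟨k, hkm, rfl⟩
      · exact Or.inr ⟨k - (m + 1), by omega, rfl⟩
  · intro a b hab hb
    simp only
    by_cases hbm : b ≤ m
    · rw [if_pos hbm, if_pos (by omega)]
      obtain ⟨h1, h2⟩ := hp a b hab hbm
      exact ⟨h1, h2.trans (by omega)⟩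
    · rw [if_neg hbm]
      by_cases ham : a ≤ m
      · rw [if_pos ham]
        obtain ⟨h1, h2⟩ := hc (p a) ⟨a, ham, rfl⟩ (q (b - (m + 1))) ⟨_, by simp; omega, rfl⟩
        refine ⟨h1, fun hadj => ?_, fun e => ?_⟩
        · obtain ⟨e1, e2⟩ | ⟨e1, e2⟩ := h2 hadj
          · have := hp.inj ham le_rfl e1
            have := hq.inj (by omega) (by omega) e2
            omega
          · have := hp.inj ham (by omega) e1
            have := hq.inj (by omega) (by omega) e2
            omega
        · rcases e with e | ⟨e, e'⟩
          · have e1 : a = m := by omega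
            have e2 : b - (m + 1) = 0 := by omega
            rw [e1, e2]; exact huv
          · have e2 : b - (m + 1) = n := by omega
            rw [e, e2]; exact hxy
      · rw [if_neg ham]
        obtain ⟨h1, h2⟩ := hq (a - (m + 1)) (b - (m + 1)) (by omega) (by omega)
        exact ⟨h1, h2.trans (by omega)⟩

/-- An induced path together with a vertex adjacent to exactly its ends. -/
theorem IP.close {S : Set V} {x y w : V} {n : ℕ} (h : G.IP S x y n) (hw : w ∉ S)
    (hx : G.Adj x w) (hy : G.Adj y w) (hc : ∀ s ∈ S, G.Adj s w → s = x ∨ s = y) :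
    G.Cyc (S ∪ {w}) x w (n + 1) := by
  refine h.join_cyc (IP.single w) hy hx ?_
  rintro s hs s' rfl
  refine ⟨fun e => hw (e ▸ hs), fun ha => ?_⟩
  rcases hc s hs ha with rfl | rfl
  · exact Or.inr ⟨rfl, rfl⟩
  · exact Or.inl ⟨rfl, rfl⟩

theorem IndCycle.adj_iff {p : ℕ → V} {m : ℕ} (h : G.IndCycle p m) {i j : ℕ} (hi : i ≤ m)
    (hj : j ≤ m) (hm : 2 ≤ m) : G.Adj (p i) (p j) ↔
      j = i + 1 ∨ i = j + 1 ∨ (i = 0 ∧ j = m) ∨ (j = 0 ∧ i = m) := by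
  rcases lt_trichotomy i j with hl | hl | hl
  · rw [(h i j hl hj).2]; omega
  · subst hl; simp; omega
  · rw [G.adj_comm, (h j i hl hi).2]; omega

theorem IndCycle.cyc {p : ℕ → V} {m : ℕ} (h : G.IndCycle p m) :
    G.Cyc (p '' Set.Iic m) (p 0) (p m) m := ⟨p, rfl, rfl, rfl, h⟩

/-- Any edge can be made the closing edge: read from `p j` down to `p 0`, cross to `p m`, and go
down to `p (j + 1)`. -/
theorem IndCycle.rotate {p : ℕ → V} {m j : ℕ} (h : G.IndCycle p m) (hj : j < m) :
    G.Cyc (p '' Set.Iic m) (p j) (p (j + 1)) m := by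
  refine ⟨fun i => if i ≤ j then p (j - i) else p (m - (i - j - 1)), by simp, ?_, ?_, ?_⟩
  · simp only
    rw [if_neg (by omega)]; congr 1; omega
  · ext v
    simp only [Set.mem_image, Set.mem_Iic]
    constructor
    · rintro ⟨k, hk, rfl⟩
      by_cases hkj : k ≤ j
      · exact ⟨j - k, by omega, by rw [if_pos (by omega)]; congr 1; omega⟩
      · exact ⟨m - k + j + 1, by omega, by rw [if_neg (by omega)]; congr 1; omega⟩
    · rintro ⟨k, hk, rfl⟩
      split_ifs
      · exact ⟨_, by omega, rfl⟩
      · exact ⟨_, by omega, rfl⟩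
  · intro a b hab hb
    simp only
    by_cases h1 : a ≤ j <;> by_cases h2 : b ≤ j
    · rw [if_pos h1, if_pos h2]
      refine ⟨fun e => ?_, ?_⟩
      · have := h.inj (by omega) (by omega) e; omega
      · rw [h.adj_iff (by omega) (by omega) (by omega)]; omega
    · rw [if_pos h1, if_neg h2]
      refine ⟨fun e => ?_, ?_⟩
      · have := h.inj (by omega) (by omega) e; omega
      -- `IndCycle.adj_iff` needs three vertices; the remaining case `m = 1` is a single edge.
      · by_cases hm : 2 ≤ m
        · rw [h.adj_iff (by omega) (by omega) (by omega)]; omega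
        · have e1 : m = 1 := by omega
          have e2 : j = 0 := by omega
          have e3 : a = 0 := by omega
          have e4 : b = 1 := by omega
          subst e1 e2 e3 e4
          simp [(h 0 1 (by omega) (by omega)).2]
    · omega
    · rw [if_neg h1, if_neg h2]
      refine ⟨fun e => ?_, ?_⟩
      · have := h.inj (by omega) (by omega) e; omega
      · rw [h.adj_iff (by omega) (by omega) (by omega)]; omega

theorem Cyc.symm {S : Set V} {x y : V} {m : ℕ} (h : G.Cyc S x y m) : G.Cyc S y x m := by
  obtain ⟨p, rfl, rfl, rfl, hp⟩ := h
  refine ⟨fun k => p (m - k), by simp, by simp, ?_, ?_⟩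
  · ext v
    simp only [Set.mem_image, Set.mem_Iic]
    constructor
    · rintro ⟨k, hk, rfl⟩
      exact ⟨m - k, by omega, by congr 1; omega⟩
    · rintro ⟨k, hk, rfl⟩
      exact ⟨m - k, by omega, rfl⟩
  · intro a b hab hb
    obtain ⟨h1, h2⟩ := hp (m - b) (m - a) (by omega) (by omega)
    refine ⟨h1.symm, ?_⟩
    rw [G.adj_comm, h2]; omega

/-! ### Connected sets -/

theorem Conn.single (x : V) : G.Conn {x} := by
  rintro a rfl b rfl
  exact .refl

theorem reach_mono {S S' : Set V} (h : S ⊆ S') {x y : V}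
    (hr : Relation.ReflTransGen (fun a b => G.Adj a b ∧ a ∈ S ∧ b ∈ S) x y) :
    Relation.ReflTransGen (fun a b => G.Adj a b ∧ a ∈ S' ∧ b ∈ S') x y :=
  hr.lift id (fun _ _ ⟨h1, h2, h3⟩ => ⟨h1, h h2, h h3⟩)

theorem reach_symm {S : Set V} {x y : V}
    (hr : Relation.ReflTransGen (fun a b => G.Adj a b ∧ a ∈ S ∧ b ∈ S) x y) :
    Relation.ReflTransGen (fun a b => G.Adj a b ∧ a ∈ S ∧ b ∈ S) y x := by
  induction hr with
  | refl => exact .refl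
  | tail _ h ih => exact ih.head ⟨h.1.symm, h.2.2, h.2.1⟩

theorem Conn.of_hub {S : Set V} (x : V)
    (h : ∀ y ∈ S, Relation.ReflTransGen (fun a b => G.Adj a b ∧ a ∈ S ∧ b ∈ S) x y) :
    G.Conn S := fun a ha b hb => (reach_symm (h a ha)).trans (h b hb)

theorem Conn.union {S S' : Set V} (h : G.Conn S) (h' : G.Conn S') {s : V} (hs : s ∈ S)
    (ht : G.Touches s S') : G.Conn (S ∪ S') := by
  refine Conn.of_hub s ?_
  obtain ⟨s', hs', hr⟩ : ∃ s' ∈ S',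
      Relation.ReflTransGen (fun a b => G.Adj a b ∧ a ∈ S ∪ S' ∧ b ∈ S ∪ S') s s' := by
    rcases ht with ht | ⟨s', hs', ha⟩
    · exact ⟨s, ht, .refl⟩
    · exact ⟨s', hs', .single ⟨ha, Or.inl hs, Or.inr hs'⟩⟩
  rintro y (hy | hy)
  · exact reach_mono Set.subset_union_left (h s hs y hy)
  · exact hr.trans (reach_mono Set.subset_union_right (h' s' hs' y hy))

theorem Conn.of_seg {p : ℕ → V} {i j : ℕ} (h : ∀ k, i ≤ k → k < j → G.Adj (p k) (p (k + 1))) :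
    G.Conn (p '' Set.Icc i j) := by
  refine Conn.of_hub (p i) ?_
  rintro _ ⟨k, ⟨hk1, hk2⟩, rfl⟩
  induction k, hk1 using Nat.le_induction with
  | base => exact .refl
  | succ k hk ih =>
    exact (ih (by omega)).tail ⟨h k hk (by omega), ⟨k, ⟨hk, by omega⟩, rfl⟩,
      ⟨k + 1, ⟨by omega, hk2⟩, rfl⟩⟩

theorem IP.conn {S : Set V} {x y : V} {n : ℕ} (h : G.IP S x y n) : G.Conn S := by
  obtain ⟨p, rfl, rfl, rfl, hp⟩ := h
  have : Set.Iic n = Set.Icc 0 n := by ext; simp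
  rw [this]
  exact Conn.of_seg (fun k _ hk => hp.adj_succ hk)

/-- When the walk gains a vertex, the path is cut at its first vertex equal or adjacent to the new
one, so that appending it creates no chord. -/
theorem exists_ip_of_reach {S : Set V} {x y : V} (hx : x ∈ S)
    (hr : Relation.ReflTransGen (fun a b => G.Adj a b ∧ a ∈ S ∧ b ∈ S) x y) :
    ∃ p n, p 0 = x ∧ p n = y ∧ G.IndPath p n ∧ ∀ i ≤ n, p i ∈ S := by
  classical
  induction hr with
  | refl => exact ⟨fun _ => x, 0, rfl, rfl, fun i j h1 h2 => by omega, fun _ _ => hx⟩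
  | @tail b c _ hbc ih =>
    obtain ⟨p, n, rfl, rfl, hp, hS⟩ := ih
    have hex : ∃ i, i ≤ n ∧ (p i = c ∨ G.Adj (p i) c) := ⟨n, le_rfl, Or.inr hbc.1⟩
    obtain ⟨hin, hic⟩ := Nat.find_spec hex
    have hmin : ∀ k < Nat.find hex, ¬ (k ≤ n ∧ (p k = c ∨ G.Adj (p k) c)) :=
      fun k hk => Nat.find_min hex hk
    generalize Nat.find hex = i at *
    rcases hic with hic | hic
    · exact ⟨p, i, rfl, hic, hp.mono hin, fun k hk => hS k (by omega)⟩
    · refine ⟨fun k => if k ≤ i then p k else c, i + 1, by simp, by simp, ?_, ?_⟩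
      · intro a b hab hb
        simp only
        by_cases hbi : b ≤ i
        · rw [if_pos hbi, if_pos (by omega)]
          exact hp a b hab (by omega)
        · rw [if_neg hbi, if_pos (by omega)]
          by_cases hai : a = i
          · subst hai
            exact ⟨hic.ne, iff_of_true hic (by omega)⟩
          · have := hmin a (by omega)
            have h2 : a ≤ n := by omega
            refine ⟨fun e => this ⟨h2, Or.inl e⟩, iff_of_false (fun e => this ⟨h2, Or.inr e⟩) ?_⟩
            omega
      · intro k hk
        simp only
        split_ifs with h
        · exact hS k (by omega)
        · exact hbc.2.2

/-- In a connected set, there is an induced path joining two given kinds of vertices all of whose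
internal vertices are of neither kind. -/
theorem Conn.exists_ip {L : Set V} (hL : G.Conn L) (Q R : V → Prop) (hQ : ∃ q ∈ L, Q q)
    (hR : ∃ r ∈ L, R r) : ∃ F q r e, G.IP F q r e ∧ F ⊆ L ∧ Q q ∧ R r ∧
      (∀ f ∈ F, Q f → f = q) ∧ (∀ f ∈ F, R f → f = r) := by
  classical
  obtain ⟨q, hqL, hQq⟩ := hQ
  obtain ⟨r, hrL, hRr⟩ := hR
  obtain ⟨p, n, rfl, rfl, hp, hS⟩ := exists_ip_of_reach hqL (hL q hqL r hrL)
  -- Stopping at the first vertex satisfying `R`, and then starting at the last vertex before it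
  -- satisfying `Q`, leaves neither kind strictly in between.
  have hex : ∃ i, i ≤ n ∧ R (p i) := ⟨n, le_rfl, hRr⟩
  obtain ⟨hjn, hRj⟩ := Nat.find_spec hex
  have hmin : ∀ k < Nat.find hex, ¬ (k ≤ n ∧ R (p k)) := fun k hk => Nat.find_min hex hk
  generalize Nat.find hex = j at *
  have hi := Nat.findGreatest_spec (P := fun i => Q (p i)) (Nat.zero_le j) hQq
  have hij := Nat.findGreatest_le (P := fun i => Q (p i)) j
  have hmax : ∀ k, Nat.findGreatest (fun i => Q (p i)) j < k → k ≤ j → ¬ Q (p k) :=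
    fun k h1 h2 => Nat.findGreatest_is_greatest h1 h2
  generalize Nat.findGreatest (fun i => Q (p i)) j = i at *
  refine ⟨_, _, _, _, hp.seg hij hjn, ?_, hi, hRj, ?_, ?_⟩
  · rintro _ ⟨k, ⟨h1, h2⟩, rfl⟩
    exact hS k (by omega)
  · rintro _ ⟨k, ⟨h1, h2⟩, rfl⟩ hk
    rcases h1.eq_or_lt with rfl | h1
    · rfl
    · exact absurd hk (hmax k h1 h2)
  · rintro _ ⟨k, ⟨h1, h2⟩, rfl⟩ hk
    rcases h2.eq_or_lt with rfl | h2
    · rfl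
    · exact absurd ⟨by omega, hk⟩ (hmin k h2)

end SimpleGraph

namespace SimpleGraph

variable {V : Type*} {G : SimpleGraph V}

/-! ### Prisms and holes linked to a triangle -/

theorem nonempty_prism {a b : Fin 3 → V} {S : Fin 3 → Set V} {n : Fin 3 → ℕ}
    (h : ∀ i, G.IP (S i) (a i) (b i) (n i)) (hn : ∀ i, a i ≠ b i)
    (hc : ∀ i j, i ≠ j → ∀ x ∈ S i, ∀ y ∈ S j,
      x ≠ y ∧ (G.Adj x y ↔ (x = a i ∧ y = a j) ∨ (x = b i ∧ y = b j))) :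
    Nonempty G.Prism := by
  have hw := fun i => (h i).exists_walk
  choose w hpath hchord _ hsupp using hw
  refine ⟨⟨a, b, w, hpath, hn, ?_, ?_⟩⟩
  · intro i j hij x hx hy
    exact (hc i j hij x ((hsupp i x).1 hx) x ((hsupp j x).1 hy)).1 rfl
  · rintro x y ⟨i, hx⟩ ⟨j, hy⟩
    constructor
    · intro hadj
      by_cases hij : i = j
      · subst hij
        exact Or.inl ⟨i, (hchord i).mem_edges hx hy hadj⟩
      · right
        rcases (hc i j hij x ((hsupp i x).1 hx) y ((hsupp j y).1 hy)).2.1 hadj with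
          ⟨rfl, rfl⟩ | ⟨rfl, rfl⟩
        · exact ⟨i, j, hij, Or.inl rfl⟩
        · exact ⟨i, j, hij, Or.inr rfl⟩
    · rintro (⟨k, hk⟩ | ⟨k, l, hkl, hk⟩)
      · exact (w k).adj_of_mem_edges hk
      · have ha : G.Adj (a k) (a l) :=
          (hc k l hkl _ (h k).left_mem _ (h l).left_mem).2.2 (Or.inl ⟨rfl, rfl⟩)
        have hb : G.Adj (b k) (b l) :=
          (hc k l hkl _ (h k).right_mem _ (h l).right_mem).2.2 (Or.inr ⟨rfl, rfl⟩)
        rcases hk with hk | hk <;> rw [Sym2.eq_iff] at hk <;>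
          rcases hk with ⟨rfl, rfl⟩ | ⟨rfl, rfl⟩
        exacts [ha, ha.symm, hb, hb.symm]

theorem nonempty_prism_of_three {a₁ a₂ a₃ b₁ b₂ b₃ : V} {S₁ S₂ S₃ : Set V} {n₁ n₂ n₃ : ℕ}
    (h₁ : G.IP S₁ a₁ b₁ n₁) (h₂ : G.IP S₂ a₂ b₂ n₂) (h₃ : G.IP S₃ a₃ b₃ n₃)
    (e₁ : a₁ ≠ b₁) (e₂ : a₂ ≠ b₂) (e₃ : a₃ ≠ b₃)
    (h₁₂ : ∀ x ∈ S₁, ∀ y ∈ S₂, x ≠ y ∧ (G.Adj x y ↔ (x = a₁ ∧ y = a₂) ∨ (x = b₁ ∧ y = b₂)))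
    (h₁₃ : ∀ x ∈ S₁, ∀ y ∈ S₃, x ≠ y ∧ (G.Adj x y ↔ (x = a₁ ∧ y = a₃) ∨ (x = b₁ ∧ y = b₃)))
    (h₂₃ : ∀ x ∈ S₂, ∀ y ∈ S₃, x ≠ y ∧ (G.Adj x y ↔ (x = a₂ ∧ y = a₃) ∨ (x = b₂ ∧ y = b₃))) :
    Nonempty G.Prism := by
  refine nonempty_prism (a := ![a₁, a₂, a₃]) (b := ![b₁, b₂, b₃]) (S := ![S₁, S₂, S₃])
    (n := ![n₁, n₂, n₃]) ?_ ?_ ?_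
  · intro i; fin_cases i <;> assumption
  · intro i; fin_cases i <;> assumption
  · have sw : ∀ {a a' b b' : V} {S S' : Set V},
        (∀ x ∈ S, ∀ y ∈ S', x ≠ y ∧ (G.Adj x y ↔ (x = a ∧ y = a') ∨ (x = b ∧ y = b'))) →
        ∀ x ∈ S', ∀ y ∈ S, x ≠ y ∧ (G.Adj x y ↔ (x = a' ∧ y = a) ∨ (x = b' ∧ y = b)) := by
      intro a a' b b' S S' h x hx y hy
      obtain ⟨h1, h2⟩ := h y hy x hx
      exact ⟨h1.symm, by rw [G.adj_comm, h2]; tauto⟩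
    intro i j hij
    fin_cases i <;> fin_cases j
    · exact absurd rfl hij
    · exact h₁₂
    · exact h₁₃
    · exact sw h₁₂
    · exact absurd rfl hij
    · exact h₂₃
    · exact sw h₁₃
    · exact sw h₂₃
    · exact absurd rfl hij

/-- The last index `m` is one less than the number of vertices, so having an even number of vertices
reads as `m` odd. -/
theorem InClassA.odd_of_cyc (hG : G.InClassA) {S : Set V} {x y : V} {m : ℕ} (h : G.Cyc S x y m)
    (hm : 3 ≤ m) : Odd m := by
  by_contra hodd
  rw [Nat.not_odd_iff_even] at hodd
  exact hG.1 (m + 1) hodd.add_one (h.hasHole hm)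

theorem InClassA.false_of_compl_cyc (hG : G.InClassA) {S : Set V} {x y : V} {m : ℕ}
    (h : Gᶜ.Cyc S x y m) (hm : 4 ≤ m) : False :=
  hG.2.1 (m + 1) (by omega) (h.hasHole (by omega))

/-- If a vertex `d` is adjacent to exactly two vertices, consecutive ones, of a hole, then it is
not linked to the rest of the hole by a connected set avoiding the neighbours of these two
vertices. -/
theorem InClassA.false_of_linked_triangle (hG : G.InClassA) {p : ℕ → V} {m : ℕ}
    (hp : G.IndCycle p m) (hm : 3 ≤ m) {d : V} (hd0 : G.Adj d (p 0)) (hdm : G.Adj d (p m))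
    (hd : ∀ i, 0 < i → i < m → d ≠ p i ∧ ¬ G.Adj d (p i)) {L : Set V} (hL : G.Conn L)
    (hdL : d ∈ L) (h0L : p 0 ∉ L) (hmL : p m ∉ L)
    (hLa : ∀ l ∈ L, l ≠ d → (∀ i ≤ m, l ≠ p i) → ¬ G.Adj l (p 0) ∧ ¬ G.Adj l (p m))
    (ht : ∃ i, 0 < i ∧ i < m ∧ ∃ l ∈ L, l = p i ∨ G.Adj l (p i)) : False := by
  -- An induced path `F` of `L`, of length `e`, leads from `d` to a vertex `f` attached to the
  -- inside of the hole, with no earlier attachment. If `p a` and `p b` are the first and last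
  -- internal neighbours of `f`, the two holes through `F` make `a + e` and `m - b + e` even.
  classical
  obtain ⟨F, d', f, e, hF, hFL, rfl, ⟨i₀, hi₀, hi₀m, hfi⟩, hFd, hFf⟩ :=
    hL.exists_ip (fun l => l = d) (fun l => ∃ i, 0 < i ∧ i < m ∧ (l = p i ∨ G.Adj l (p i)))
      ⟨d, hdL, rfl⟩ (by obtain ⟨i, h1, h2, l, hl, h3⟩ := ht; exact ⟨l, hl, i, h1, h2, h3⟩)
  have hdf : d' ≠ f := by
    rintro rfl
    obtain ⟨h1, h2⟩ := hd i₀ hi₀ hi₀m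
    tauto
  have he : 1 ≤ e := by
    obtain ⟨q, rfl, rfl, -, -⟩ := hF
    by_contra hcon
    have : e = 0 := by omega
    subst this
    exact hdf rfl
  -- If `f` lay on the hole, its predecessor on `F` would already be attached to it.
  have hint : ∀ l ∈ F, ∀ i, 0 < i → i < m → l ≠ p i := by
    rintro l hl i h1 h2 rfl
    have hlf := hFf _ hl ⟨i, h1, h2, Or.inl rfl⟩
    obtain ⟨q, rfl, hqe, rfl, hq⟩ := hF
    have hadj := hq.adj_succ (i := e - 1) (by omega)
    have e1 : e - 1 + 1 = e := by omega
    rw [e1, hqe, ← hlf] at hadj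
    have := hFf (q (e - 1)) ⟨e - 1, by simp, rfl⟩ ⟨i, h1, h2, Or.inr hadj⟩
    rw [← hlf] at this
    exact hadj.ne this
  have hFp : ∀ l ∈ F, ∀ i ≤ m, l ≠ p i := by
    intro l hl i him
    rcases Nat.eq_zero_or_pos i with rfl | hpos
    · rintro rfl; exact h0L (hFL hl)
    · rcases him.eq_or_lt with rfl | him
      · rintro rfl; exact hmL (hFL hl)
      · exact hint l hl i hpos him
  have hFend : ∀ l ∈ F, l ≠ d' → ¬ G.Adj l (p 0) ∧ ¬ G.Adj l (p m) :=
    fun l hl hne => hLa l (hFL hl) hne (hFp l hl)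
  have hFin : ∀ l ∈ F, ∀ i, 0 < i → i < m → G.Adj l (p i) → l = f :=
    fun l hl i h1 h2 ha => hFf l hl ⟨i, h1, h2, Or.inr ha⟩
  have hfF := hF.right_mem
  have hdF := hF.left_mem
  have hfi' : G.Adj f (p i₀) := hfi.resolve_left (hint f hfF i₀ hi₀ hi₀m)
  -- the first and the last neighbour of `f` on the hole
  have hex : ∃ i, 0 < i ∧ G.Adj f (p i) := ⟨i₀, hi₀, hfi'⟩
  obtain ⟨ha0, hfa⟩ := Nat.find_spec hex
  have hamin : ∀ k, 0 < k → G.Adj f (p k) → Nat.find hex ≤ k := fun k h1 h2 =>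
    Nat.find_le ⟨h1, h2⟩
  generalize Nat.find hex = a at *
  have ham : a < m := (hamin i₀ hi₀ hfi').trans_lt hi₀m
  have hfb : G.Adj f (p (Nat.findGreatest (fun i => G.Adj f (p i)) (m - 1))) :=
    Nat.findGreatest_spec (P := fun i => G.Adj f (p i)) (show a ≤ m - 1 by omega) hfa
  have hbm := Nat.findGreatest_le (P := fun i => G.Adj f (p i)) (m - 1)
  have hbmax : ∀ k, k < m → G.Adj f (p k) →
      k ≤ Nat.findGreatest (fun i => G.Adj f (p i)) (m - 1) := fun k h1 h2 =>
    Nat.le_findGreatest (by omega) h2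
  generalize Nat.findGreatest (fun i => G.Adj f (p i)) (m - 1) = b at *
  have hab : a ≤ b := hbmax a ham hfa
  have hm_odd := hG.odd_of_cyc hp.cyc hm
  have hseg : ∀ i j, i ≤ j → j ≤ m → (0 < i ∨ j < m) →
      G.IP (p '' Set.Icc i j) (p i) (p j) (j - i) := by
    intro i j h1 h2 h3
    refine IP.of_seg h1 (fun k l hk hkl hl => ?_)
    obtain ⟨h4, h5⟩ := hp k l hkl (by omega)
    exact ⟨h4, h5.trans (by omega)⟩
  have hsega := hseg 0 a (by omega) (by omega) (by omega)
  have hsegb := hseg b m (by omega) (by omega) (by omega)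
  have hcrossa : ∀ s ∈ p '' Set.Icc 0 a, ∀ s' ∈ F,
      s ≠ s' ∧ (G.Adj s s' ↔ (s = p a ∧ s' = f) ∨ (s = p 0 ∧ s' = d')) := by
    rintro _ ⟨k, ⟨-, hk⟩, rfl⟩ s' hs'
    refine ⟨fun e => hFp s' hs' k (by omega) e.symm, fun hadj => ?_, ?_⟩
    · rcases Nat.eq_zero_or_pos k with rfl | hpos
      · right
        refine ⟨rfl, ?_⟩
        by_contra hne
        exact (hFend s' hs' hne).1 hadj.symm
      · left
        have e1 := hFin s' hs' k hpos (by omega) hadj.symm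
        subst e1
        have := hamin k hpos hadj.symm
        have e2 : k = a := by omega
        exact ⟨by rw [e2], rfl⟩
    · rintro (⟨h1, rfl⟩ | ⟨h1, rfl⟩) <;> rw [h1]
      · exact hfa.symm
      · exact hd0.symm
  have hcrossb : ∀ s ∈ p '' Set.Icc b m, ∀ s' ∈ F,
      s ≠ s' ∧ (G.Adj s s' ↔ (s = p b ∧ s' = f) ∨ (s = p m ∧ s' = d')) := by
    rintro _ ⟨k, ⟨hk, hk'⟩, rfl⟩ s' hs'
    refine ⟨fun e => hFp s' hs' k (by omega) e.symm, fun hadj => ?_, ?_⟩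
    · rcases hk'.eq_or_lt with rfl | hk'
      · right
        refine ⟨rfl, ?_⟩
        by_contra hne
        exact (hFend s' hs' hne).2 hadj.symm
      · left
        have e1 := hFin s' hs' k (by omega) (by omega) hadj.symm
        subst e1
        have := hbmax k hk' hadj.symm
        have e2 : k = b := by omega
        exact ⟨by rw [e2], rfl⟩
    · rintro (⟨h1, rfl⟩ | ⟨h1, rfl⟩) <;> rw [h1]
      · exact hfb.symm
      · exact hdm.symm
  have o1 := hG.odd_of_cyc (hsega.join_cyc hF.symm hfa.symm hd0.symm
    (fun s hs s' hs' => ⟨(hcrossa s hs s' hs').1, (hcrossa s hs s' hs').2.1⟩)) (by omega)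
  have o2 := hG.odd_of_cyc (hsegb.symm.join_cyc hF.symm hfb.symm hdm.symm
    (fun s hs s' hs' => ⟨(hcrossb s hs s' hs').1, (hcrossb s hs s' hs').2.1⟩)) (by omega)
  rw [Nat.odd_iff] at o1 o2 hm_odd
  have h0m : G.Adj (p 0) (p m) := (hp 0 m (by omega) le_rfl).2.2 (Or.inr ⟨rfl, rfl⟩)
  -- As `m` is odd, so is `b - a`. Hence `a = b` is impossible, `b = a + 1` gives the triangles `d,
  -- p 0, p m` and `f, p a, p b` of a prism, and a wider gap lets `f` shortcut the hole into an odd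
  -- one.
  rcases hab.eq_or_lt with rfl | hab
  · omega
  rcases (show a + 1 ≤ b from hab).eq_or_lt with hab1 | hab1
  · -- a prism
    refine hG.2.2.elim (nonempty_prism_of_three hsega hsegb.symm hF ?_ ?_ hdf ?_ ?_ ?_).some
    · intro e; have := hp.inj (by omega) (by omega) e; omega
    · intro e; have := hp.inj (by omega) (by omega) e; omega
    · rintro _ ⟨k, ⟨-, hk⟩, rfl⟩ _ ⟨l, ⟨hl, hl'⟩, rfl⟩
      obtain ⟨h1, h2⟩ := hp k l (by omega) hl'
      refine ⟨h1, h2.trans ⟨?_, ?_⟩⟩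
      · rintro (h3 | ⟨rfl, rfl⟩)
        · have e1 : k = a := by omega
          have e2 : l = b := by omega
          subst e1 e2; simp
        · simp
      · rintro (⟨e1, e2⟩ | ⟨e1, e2⟩)
        · have := hp.inj (by omega) (by omega) e1
          have := hp.inj (by omega) (by omega) e2
          omega
        · have := hp.inj (by omega) (by omega) e1
          have := hp.inj (by omega) (by omega) e2
          omega
    · intro s hs s' hs'
      exact ⟨(hcrossa s hs s' hs').1, (hcrossa s hs s' hs').2.trans or_comm⟩
    · intro s hs s' hs'
      exact ⟨(hcrossb s hs s' hs').1, (hcrossb s hs s' hs').2.trans or_comm⟩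
  · -- an odd hole
    have hj := hsega.join (IP.single f) hfa.symm (by
      rintro s hs s' rfl
      refine ⟨(hcrossa s hs s' hfF).1, fun hadj => ?_⟩
      rcases (hcrossa s hs s' hfF).2.1 hadj with h | h
      · exact h
      · exact absurd h.2.symm hdf)
    have hc := hj.join_cyc hsegb hfb h0m (by
      rintro s (⟨k, ⟨-, hk⟩, rfl⟩ | rfl) _ ⟨l, ⟨hl, hl'⟩, rfl⟩
      · obtain ⟨h1, h2⟩ := hp k l (by omega) hl'
        refine ⟨h1, fun hadj => ?_⟩
        rcases h2.1 hadj with h3 | ⟨rfl, rfl⟩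
        · omega
        · exact Or.inr ⟨rfl, rfl⟩
      · refine ⟨hFp s hfF l hl', fun hadj => ?_⟩
        rcases (hcrossb (p l) ⟨l, ⟨hl, hl'⟩, rfl⟩ s hfF).2.1 hadj.symm with h | h
        · exact Or.inl ⟨rfl, h.1⟩
        · exact absurd h.2.symm hdf)
    have o3 := hG.odd_of_cyc hc (by omega)
    rw [Nat.odd_iff] at o3
    omega

/-- Two adjacent vertices outside a co-connected set `T`, each having a non-neighbour in `T`, but
no common one: there is no vertex complete to `T` and non-adjacent to both. -/
theorem InClassA.false_of_cover (hG : G.InClassA) {T : Set V} (hT : Gᶜ.Conn T) {h h' w : V}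
    (hh : h ∉ T) (hh' : h' ∉ T) (hadj : G.Adj h h') (hcov : ∀ t ∈ T, G.Adj h t ∨ G.Adj h' t)
    (hmiss : ∃ t ∈ T, ¬ G.Adj h t) (hmiss' : ∃ t ∈ T, ¬ G.Adj h' t)
    (hw : w ∈ G.completeVerts T) (hwh : w ≠ h) (hwh' : w ≠ h') (hnw : ¬ G.Adj w h)
    (hnw' : ¬ G.Adj w h') : False := by
  -- In the complement, an induced path of `T` from a non-neighbour of `h` to one of `h'` is closed
  -- into a hole by `h'`, `w`, `h`. No vertex of `T` misses both, so the path has at least two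
  -- vertices and the antihole at least five.
  obtain ⟨F, q, r, e, hF, hFT, hq, hr, hFq, hFr⟩ :=
    hT.exists_ip (fun t => ¬ G.Adj h t) (fun t => ¬ G.Adj h' t) hmiss hmiss'
  have hne : ∀ f ∈ F, h ≠ f := fun f hf e => hh (e ▸ hFT hf)
  have hne' : ∀ f ∈ F, h' ≠ f := fun f hf e => hh' (e ▸ hFT hf)
  have hqr : q ≠ r := by
    rintro rfl
    rcases hcov q (hFT hF.left_mem) with h1 | h1
    · exact hq h1
    · exact hr h1
  have he : 1 ≤ e := by
    obtain ⟨p, rfl, rfl, -, -⟩ := hF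
    by_contra hcon
    have : e = 0 := by omega
    subst this
    exact hqr rfl
  have h1 := (IP.single h).join hF (by rw [compl_adj]; exact ⟨hne q hF.left_mem, hq⟩) (by
    rintro s rfl s' hs'
    refine ⟨hne s' hs', fun ha => ⟨rfl, hFq s' hs' ?_⟩⟩
    exact (compl_adj _ _ _ |>.1 ha).2)
  have h2 := h1.join (IP.single h')
    (by rw [compl_adj]; exact ⟨(hne' r hF.right_mem).symm, fun ha => hr ha.symm⟩) (by
      rintro s (rfl | hs) s' rfl
      · exact ⟨hadj.ne, fun ha => absurd hadj (compl_adj _ _ _ |>.1 ha).2⟩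
      · exact ⟨(hne' s hs).symm,
          fun ha => ⟨hFr s hs fun hb => (compl_adj _ _ _ |>.1 ha).2 hb.symm, rfl⟩⟩)
  have h3 := h2.close (w := w) (by
      rintro ((rfl | hs) | rfl)
      · exact hwh rfl
      · exact hw.1 (hFT hs)
      · exact hwh' rfl)
    (by rw [compl_adj]; exact ⟨hwh.symm, fun ha => hnw ha.symm⟩)
    (by rw [compl_adj]; exact ⟨hwh'.symm, fun ha => hnw' ha.symm⟩) (by
      rintro s ((rfl | hs) | rfl) ha
      · exact Or.inl rfl
      · exact absurd (hw.2 s (hFT hs)).symm (compl_adj _ _ _ |>.1 ha).2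
      · exact Or.inr rfl)
  exact hG.false_of_compl_cyc h3 (by omega)

end SimpleGraph

namespace SimpleGraph

variable {V : Type*} {G : SimpleGraph V} {T : Set V}

/-! ### Outer vertices and outer paths -/

/-- The vertices that are neither in `T` nor complete to `T`. -/
def outerVerts (G : SimpleGraph V) (T : Set V) : Set V :=
  {v | v ∉ T ∧ v ∉ G.completeVerts T}

/-- Every induced path of length at least `2` whose ends are complete to `T` and whose other
vertices are outer has even length. -/
def EvenOuter (G : SimpleGraph V) (T : Set V) : Prop :=
  ∀ S x y n, G.IP S x y n → 2 ≤ n → x ∈ G.completeVerts T → y ∈ G.completeVerts T →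
    (∀ s ∈ S, s ≠ x → s ≠ y → s ∈ G.outerVerts T) → Even n

theorem exists_not_adj_of_mem_outerVerts {v : V} (h : v ∈ G.outerVerts T) :
    ∃ t ∈ T, ¬ G.Adj v t := by
  by_contra hcon
  push Not at hcon
  exact h.2 ⟨h.1, hcon⟩

theorem ne_of_mem_completeVerts {x y : V} (hx : x ∈ G.completeVerts T)
    (hy : y ∈ G.outerVerts T) : x ≠ y := fun e => hy.2 (e ▸ hx)

theorem IndCycle.seg {p : ℕ → V} {m : ℕ} (hp : G.IndCycle p m) {i j : ℕ} (h1 : i ≤ j) (h2 : j ≤ m)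
    (h3 : 0 < i ∨ j < m) : G.IP (p '' Set.Icc i j) (p i) (p j) (j - i) := by
  refine IP.of_seg h1 (fun k l hk hkl hl => ?_)
  obtain ⟨h4, h5⟩ := hp k l hkl (by omega)
  exact ⟨h4, h5.trans (by omega)⟩

/-- A hole with exactly two `T`-complete vertices `p 0`, `p m`, which are consecutive, is not
linked to a `T`-complete vertex by a connected set avoiding the neighbours of these two
vertices. -/
theorem InClassA.false_of_linked_edge (hG : G.InClassA) (hT : Gᶜ.Conn T) (hE : G.EvenOuter T)
    {p : ℕ → V} {m : ℕ} (hp : G.IndCycle p m) (hm : 3 ≤ m) (h0 : p 0 ∈ G.completeVerts T)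
    (hmC : p m ∈ G.completeVerts T) (hO : ∀ i, 0 < i → i < m → p i ∈ G.outerVerts T)
    {L : Set V} (hL : G.Conn L) (hLT : ∀ l ∈ L, l ∉ T) (h0L : p 0 ∉ L) (hmL : p m ∉ L)
    (hLa : ∀ l ∈ L, (∀ i ≤ m, l ≠ p i) → ¬ G.Adj l (p 0) ∧ ¬ G.Adj l (p m))
    (hLC : ∃ l ∈ L, l ∈ G.completeVerts T)
    (ht : ∃ i, 0 < i ∧ i < m ∧ ∃ l ∈ L, l = p i ∨ G.Adj l (p i))
    (h4 : m = 3 → ∀ l ∈ L, l ∈ G.completeVerts T → ¬ (G.Adj l (p 1) ∧ G.Adj l (p 2))) :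
    False := by
  -- The scheme is that of linked triangles, with outer paths in place of two of the holes: `p 0, …,
  -- p a, f, …, w` and `p m, …, p b, f, …, w` are outer, hence even, and again `b - a` is odd.
  classical
  obtain ⟨F, w, f, e, hF, hFL, hwC, ⟨i₀, hi₀, hi₀m, hfi⟩, hFw, hFf⟩ :=
    hL.exists_ip (fun l => l ∈ G.completeVerts T)
      (fun l => ∃ i, 0 < i ∧ i < m ∧ (l = p i ∨ G.Adj l (p i)))
      hLC (by obtain ⟨i, h1, h2, l, hl, h3⟩ := ht; exact ⟨l, hl, i, h1, h2, h3⟩)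
  have hint : ∀ l ∈ F, ∀ i, 0 < i → i < m → l ≠ p i := by
    rintro l hl i h1 h2 rfl
    have hlf := hFf _ hl ⟨i, h1, h2, Or.inl rfl⟩
    have hwp := ne_of_mem_completeVerts hwC (hO i h1 h2)
    obtain ⟨q, rfl, hqe, rfl, hq⟩ := hF
    have he : 1 ≤ e := by
      by_contra hcon
      have : e = 0 := by omega
      subst this
      exact hwp (hqe.trans hlf.symm)
    have hadj := hq.adj_succ (i := e - 1) (by omega)
    have e1 : e - 1 + 1 = e := by omega
    rw [e1, hqe, ← hlf] at hadj
    have := hFf (q (e - 1)) ⟨e - 1, by simp, rfl⟩ ⟨i, h1, h2, Or.inr hadj⟩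
    rw [← hlf] at this
    exact hadj.ne this
  have hFp : ∀ l ∈ F, ∀ i ≤ m, l ≠ p i := by
    intro l hl i him
    rcases Nat.eq_zero_or_pos i with rfl | hpos
    · rintro rfl; exact h0L (hFL hl)
    · rcases him.eq_or_lt with rfl | him
      · rintro rfl; exact hmL (hFL hl)
      · exact hint l hl i hpos him
  have hFend : ∀ l ∈ F, ¬ G.Adj l (p 0) ∧ ¬ G.Adj l (p m) :=
    fun l hl => hLa l (hFL hl) (hFp l hl)
  have hFin : ∀ l ∈ F, ∀ i, 0 < i → i < m → G.Adj l (p i) → l = f :=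
    fun l hl i h1 h2 ha => hFf l hl ⟨i, h1, h2, Or.inr ha⟩
  have hfF := hF.right_mem
  have hwF := hF.left_mem
  have hfi' : G.Adj f (p i₀) := hfi.resolve_left (hint f hfF i₀ hi₀ hi₀m)
  have hFO : ∀ l ∈ F, l ≠ w → l ∈ G.outerVerts T :=
    fun l hl hne => ⟨hLT l (hFL hl), fun hc => hne (hFw l hl hc)⟩
  -- the first and the last neighbour of `f` on the hole
  have hex : ∃ i, 0 < i ∧ G.Adj f (p i) := ⟨i₀, hi₀, hfi'⟩
  obtain ⟨ha0, hfa⟩ := Nat.find_spec hex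
  have hamin : ∀ k, 0 < k → G.Adj f (p k) → Nat.find hex ≤ k := fun k h1 h2 =>
    Nat.find_le ⟨h1, h2⟩
  generalize Nat.find hex = a at *
  have ham : a < m := (hamin i₀ hi₀ hfi').trans_lt hi₀m
  have hfb : G.Adj f (p (Nat.findGreatest (fun i => G.Adj f (p i)) (m - 1))) :=
    Nat.findGreatest_spec (P := fun i => G.Adj f (p i)) (show a ≤ m - 1 by omega) hfa
  have hbm := Nat.findGreatest_le (P := fun i => G.Adj f (p i)) (m - 1)
  have hbmax : ∀ k, k < m → G.Adj f (p k) →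
      k ≤ Nat.findGreatest (fun i => G.Adj f (p i)) (m - 1) := fun k h1 h2 =>
    Nat.le_findGreatest (by omega) h2
  generalize Nat.findGreatest (fun i => G.Adj f (p i)) (m - 1) = b at *
  have hab : a ≤ b := hbmax a ham hfa
  have hm_odd := hG.odd_of_cyc hp.cyc hm
  have hsega := hp.seg (i := 0) (j := a) (by omega) (by omega) (by omega)
  have hsegb := hp.seg (i := b) (j := m) (by omega) (by omega) (by omega)
  have hcrossa : ∀ s ∈ p '' Set.Icc 0 a, ∀ s' ∈ F,
      s ≠ s' ∧ (G.Adj s s' → s = p a ∧ s' = f) := by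
    rintro _ ⟨k, ⟨-, hk⟩, rfl⟩ s' hs'
    refine ⟨fun e => hFp s' hs' k (by omega) e.symm, fun hadj => ?_⟩
    rcases Nat.eq_zero_or_pos k with rfl | hpos
    · exact absurd hadj.symm (hFend s' hs').1
    · have e1 := hFin s' hs' k hpos (by omega) hadj.symm
      subst e1
      have := hamin k hpos hadj.symm
      have e2 : k = a := by omega
      exact ⟨by rw [e2], rfl⟩
  have hcrossb : ∀ s ∈ p '' Set.Icc b m, ∀ s' ∈ F,
      s ≠ s' ∧ (G.Adj s s' → s = p b ∧ s' = f) := by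
    rintro _ ⟨k, ⟨hk, hk'⟩, rfl⟩ s' hs'
    refine ⟨fun e => hFp s' hs' k (by omega) e.symm, fun hadj => ?_⟩
    rcases hk'.eq_or_lt with rfl | hk'
    · exact absurd hadj.symm (hFend s' hs').2
    · have e1 := hFin s' hs' k (by omega) (by omega) hadj.symm
      subst e1
      have := hbmax k hk' hadj.symm
      have e2 : k = b := by omega
      exact ⟨by rw [e2], rfl⟩
  have o1 := hE _ _ _ _ (hsega.join hF.symm hfa.symm hcrossa) (by omega) h0 hwC (by
    rintro s (⟨k, ⟨-, hk⟩, rfl⟩ | hs) h1 h2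
    · exact hO k (Nat.pos_of_ne_zero (by rintro rfl; exact h1 rfl)) (by omega)
    · exact hFO s hs h2)
  have o2 := hE _ _ _ _ (hsegb.symm.join hF.symm hfb.symm hcrossb) (by omega) hmC hwC (by
    rintro s (⟨k, ⟨hk, hk'⟩, rfl⟩ | hs) h1 h2
    · exact hO k (by omega) (lt_of_le_of_ne hk' (by rintro rfl; exact h1 rfl))
    · exact hFO s hs h2)
  rw [Nat.even_iff] at o1 o2
  rw [Nat.odd_iff] at hm_odd
  have h0m : G.Adj (p 0) (p m) := (hp 0 m (by omega) le_rfl).2.2 (Or.inr ⟨rfl, rfl⟩)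
  rcases hab.eq_or_lt with rfl | hab
  · omega
  rcases (show a + 1 ≤ b from hab).eq_or_lt with hab1 | hab1
  · subst hab1
    have hpa := hO a ha0 ham
    have hpb := hO (a + 1) (by omega) (by omega)
    have hpab : G.Adj (p a) (p (a + 1)) := (hp a (a + 1) (by omega) (by omega)).2.2 (Or.inl rfl)
    -- A vertex `t` of `T` missing both would link the triangle `f, p a, p (a + 1)` to `p 0`,
    -- through `F`, `w` and `t`.
    have hcov : ∀ t ∈ T, G.Adj (p a) t ∨ G.Adj (p (a + 1)) t := by
      intro t ht
      by_contra hcon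
      push Not at hcon
      obtain ⟨p', hp'0, hp'm, hp's, hp'⟩ := hp.rotate (j := a) ham
      have hmem : ∀ i ≤ m, ∃ k ≤ m, p' i = p k := by
        intro i hi
        have : p' i ∈ p '' Set.Iic m := by rw [hp's]; exact ⟨i, hi, rfl⟩
        obtain ⟨k, hk, e⟩ := this
        exact ⟨k, hk, e.symm⟩
      refine hG.false_of_linked_triangle hp' hm (d := f) (hp'0 ▸ hfa) (hp'm ▸ hfb) ?_
        (L := F ∪ {t}) (hF.conn.union (Conn.single t) hwF (Or.inr ⟨t, rfl, hwC.2 t ht⟩))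
        (Or.inl hfF) ?_ ?_ ?_ ?_
      · intro i hi him
        obtain ⟨k, hk, e⟩ := hmem i him.le
        rw [e]
        refine ⟨hFp f hfF k hk, fun hadj => ?_⟩
        have hka : k ≠ a := by
          rintro rfl
          have := hp'.inj him.le (by omega) (e.trans hp'0.symm); omega
        have hkb : k ≠ a + 1 := by
          rintro rfl
          have := hp'.inj him.le (by omega) (e.trans hp'm.symm); omega
        rcases Nat.eq_zero_or_pos k with rfl | hpos
        · exact (hFend f hfF).1 hadj
        · rcases hk.eq_or_lt with rfl | hk
          · exact (hFend f hfF).2 hadj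
          · have := hamin k hpos hadj
            have := hbmax k hk hadj
            omega
      · rw [hp'0]
        rintro (h | h)
        · exact hFp _ h a ham.le rfl
        · exact hpa.1 (h ▸ ht)
      · rw [hp'm]
        rintro (h | h)
        · exact hFp _ h (a + 1) (by omega) rfl
        · exact hpb.1 (h ▸ ht)
      · rw [hp'0, hp'm]
        rintro l (hl | rfl) hlf -
        · exact ⟨fun h => hlf (hFin l hl a ha0 ham h),
            fun h => hlf (hFin l hl (a + 1) (by omega) (by omega) h)⟩
        · exact ⟨fun h => hcon.1 h.symm, fun h => hcon.2 h.symm⟩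
      · have : p 0 ∈ p' '' Set.Iic m := by rw [← hp's]; exact ⟨0, by simp, rfl⟩
        obtain ⟨i, hi, e⟩ := this
        refine ⟨i, Nat.pos_of_ne_zero ?_, lt_of_le_of_ne hi ?_, t, Or.inr rfl, Or.inr ?_⟩
        · rintro rfl
          have := hp.inj (by omega) (by omega) (hp'0.symm.trans e); omega
        · rintro rfl
          have := hp.inj (by omega) (by omega) (hp'm.symm.trans e); omega
        · rw [e]; exact (h0.2 t ht).symm
    have key : ∀ w' ∈ G.completeVerts T, ¬ G.Adj w' (p a) → ¬ G.Adj w' (p (a + 1)) → False :=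
      fun w' hw' h1 h2 => hG.false_of_cover hT hpa.1 hpb.1 hpab hcov
        (exists_not_adj_of_mem_outerVerts hpa) (exists_not_adj_of_mem_outerVerts hpb) hw'
        (ne_of_mem_completeVerts hw' hpa) (ne_of_mem_completeVerts hw' hpb) h1 h2
    -- It remains to find a `T`-complete vertex missing `p a` and `p (a + 1)`: this is `w` if `w ≠
    -- f`, and otherwise `p 0` or `p m`. Neither of these two works when `m = 3`, which is the case
    -- ruled out by `h4`.
    by_cases hfw : w = f
    · by_cases ha : 2 ≤ a
      · refine key _ h0 (fun h => ?_) (fun h => ?_)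
        · have := (hp 0 a (by omega) (by omega)).2.1 h; omega
        · have := (hp 0 (a + 1) (by omega) (by omega)).2.1 h; omega
      · have ha1 : a = 1 := by omega
        subst ha1
        by_cases hm3 : m = 3
        · refine h4 hm3 w (hFL hwF) hwC ?_
          rw [hfw]; exact ⟨hfa, hfb⟩
        · refine key _ hmC (fun h => ?_) (fun h => ?_)
          · have := (hp 1 m (by omega) le_rfl).2.1 h.symm; omega
          · have := (hp 2 m (by omega) le_rfl).2.1 h.symm; omega
    · exact key w hwC (fun h => hfw (hFin w hwF a ha0 ham h))
        (fun h => hfw (hFin w hwF (a + 1) (by omega) (by omega) h))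
  -- A wider gap gives the odd hole `p 0, …, p a, f, p b, …, p m`.
  · have hj := hsega.join (IP.single f) hfa.symm (by
      rintro s hs s' rfl
      exact hcrossa s hs s' hfF)
    have hc := hj.join_cyc hsegb hfb h0m (by
      rintro s (⟨k, ⟨-, hk⟩, rfl⟩ | rfl) _ ⟨l, ⟨hl, hl'⟩, rfl⟩
      · obtain ⟨h1, h2⟩ := hp k l (by omega) hl'
        refine ⟨h1, fun hadj => ?_⟩
        rcases h2.1 hadj with h3 | ⟨rfl, rfl⟩
        · omega
        · exact Or.inr ⟨rfl, rfl⟩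
      · refine ⟨hFp s hfF l hl', fun hadj => ?_⟩
        have h := (hcrossb (p l) ⟨l, ⟨hl, hl'⟩, rfl⟩ s hfF).2 hadj.symm
        exact Or.inl ⟨rfl, h.1⟩)
    have o3 := hG.odd_of_cyc hc (by omega)
    rw [Nat.odd_iff] at o3
    omega

end SimpleGraph

namespace SimpleGraph

variable {V : Type*} {G : SimpleGraph V} {T : Set V}

/-! ### Holes with attached connected sets -/

theorem Cyc.of_adj {S : Set V} {x y u v : V} {m : ℕ} (h : G.Cyc S x y m) (hm : 2 ≤ m)
    (hu : u ∈ S) (hv : v ∈ S) (huv : G.Adj u v) : G.Cyc S u v m := by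
  obtain ⟨p, rfl, rfl, rfl, hp⟩ := h
  obtain ⟨i, hi, rfl⟩ := hu
  obtain ⟨j, hj, rfl⟩ := hv
  simp only [Set.mem_Iic] at hi hj
  rcases (hp.adj_iff hi hj hm).1 huv with rfl | rfl | ⟨rfl, rfl⟩ | ⟨rfl, rfl⟩
  · exact hp.rotate (by omega)
  · exact (hp.rotate (by omega)).symm
  · exact hp.cyc
  · exact hp.cyc.symm

/-- An index-free form of `InClassA.false_of_linked_triangle`; with `Cyc.of_adj` it can be used at
any edge of a hole. The next lemma does the same for `InClassA.false_of_linked_edge`. -/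
theorem InClassA.false_of_triangle_link (hG : G.InClassA) {S : Set V} {x y d : V} {m : ℕ}
    (h : G.Cyc S x y m) (hm : 3 ≤ m) (hdx : G.Adj d x) (hdy : G.Adj d y)
    (hd : ∀ s ∈ S, s ≠ x → s ≠ y → d ≠ s ∧ ¬ G.Adj d s) {L : Set V} (hL : G.Conn L)
    (hdL : d ∈ L) (hxL : x ∉ L) (hyL : y ∉ L)
    (hLa : ∀ l ∈ L, l ≠ d → l ∉ S → ¬ G.Adj l x ∧ ¬ G.Adj l y)
    (ht : ∃ s ∈ S, s ≠ x ∧ s ≠ y ∧ G.Touches s L) : False := by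
  obtain ⟨p, rfl, rfl, rfl, hp⟩ := h
  refine hG.false_of_linked_triangle hp hm hdx hdy ?_ hL hdL hxL hyL ?_ ?_
  · intro i h1 h2
    refine hd (p i) ⟨i, h2.le, rfl⟩ (fun e => ?_) (fun e => ?_)
    · have := hp.inj (by omega) (by omega) e; omega
    · have := hp.inj (by omega) (by omega) e; omega
  · intro l hl hld hlp
    refine hLa l hl hld ?_
    rintro ⟨i, hi, rfl⟩
    exact hlp i hi rfl
  · obtain ⟨_, ⟨i, hi, rfl⟩, h1, h2, h3⟩ := ht
    refine ⟨i, Nat.pos_of_ne_zero (by rintro rfl; exact h1 rfl),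
      lt_of_le_of_ne hi (by rintro rfl; exact h2 rfl), ?_⟩
    rcases h3 with h3 | ⟨l, hl, h3⟩
    · exact ⟨_, h3, Or.inl rfl⟩
    · exact ⟨l, hl, Or.inr h3.symm⟩

theorem InClassA.false_of_edge_link (hG : G.InClassA) (hT : Gᶜ.Conn T) (hE : G.EvenOuter T)
    {S : Set V} {x y : V} {m : ℕ} (h : G.Cyc S x y m) (hm : 3 ≤ m)
    (hx : x ∈ G.completeVerts T) (hy : y ∈ G.completeVerts T)
    (hO : ∀ s ∈ S, s ≠ x → s ≠ y → s ∈ G.outerVerts T) {L : Set V} (hL : G.Conn L)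
    (hLT : ∀ l ∈ L, l ∉ T) (hxL : x ∉ L) (hyL : y ∉ L)
    (hLa : ∀ l ∈ L, l ∉ S → ¬ G.Adj l x ∧ ¬ G.Adj l y)
    (hLC : ∃ l ∈ L, l ∈ G.completeVerts T)
    (ht : ∃ s ∈ S, s ≠ x ∧ s ≠ y ∧ G.Touches s L)
    (h4 : m = 3 → ∀ l ∈ L, l ∈ G.completeVerts T → ∃ s ∈ S, s ≠ x ∧ s ≠ y ∧ ¬ G.Adj l s) :
    False := by
  obtain ⟨p, rfl, rfl, rfl, hp⟩ := h
  refine hG.false_of_linked_edge hT hE hp hm hx hy ?_ hL hLT hxL hyL ?_ hLC ?_ ?_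
  · intro i h1 h2
    refine hO (p i) ⟨i, h2.le, rfl⟩ (fun e => ?_) (fun e => ?_)
    · have := hp.inj (by omega) (by omega) e; omega
    · have := hp.inj (by omega) (by omega) e; omega
  · intro l hl hlp
    refine hLa l hl ?_
    rintro ⟨i, hi, rfl⟩
    exact hlp i hi rfl
  · obtain ⟨_, ⟨i, hi, rfl⟩, h1, h2, h3⟩ := ht
    refine ⟨i, Nat.pos_of_ne_zero (by rintro rfl; exact h1 rfl),
      lt_of_le_of_ne hi (by rintro rfl; exact h2 rfl), ?_⟩
    rcases h3 with h3 | ⟨l, hl, h3⟩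
    · exact ⟨_, h3, Or.inl rfl⟩
    · exact ⟨l, hl, Or.inr h3.symm⟩
  · rintro rfl l hl hlC ⟨h1, h2⟩
    obtain ⟨_, ⟨i, hi, rfl⟩, h3, h4, h5⟩ := h4 rfl l hl hlC
    simp only [Set.mem_Iic] at hi
    interval_cases i
    · exact h3 rfl
    · exact h5 h1
    · exact h5 h2
    · exact h4 rfl

set_option maxHeartbeats 2000000 in
/-- The parity of a path (or of a hole, when its ends are adjacent) whose ends are complete to `T`
and attach to a connected set `L` of outer vertices, none of its other `T`-complete vertices
attaching to `L`. -/
theorem InClassA.even_of_attached (hG : G.InClassA) (hT : Gᶜ.Conn T) (hE : G.EvenOuter T)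
    {p : ℕ → V} {m : ℕ}
    (hp : ∀ i j, i < j → j ≤ m → p i ≠ p j ∧ (i ≠ 0 ∨ j ≠ m → (G.Adj (p i) (p j) ↔ j = i + 1)))
    (hm : 3 ≤ m) (hpT : ∀ i ≤ m, p i ∉ T) (h0 : p 0 ∈ G.completeVerts T)
    (hmC : p m ∈ G.completeVerts T) {L : Set V} (hL : G.Conn L) (hLO : L ⊆ G.outerVerts T)
    {x y : V} (hxL : x ∈ L) (hyL : y ∈ L) (hx : ∀ l ∈ L, G.Adj (p 0) l ↔ l = x)
    (hy : ∀ l ∈ L, G.Adj (p m) l ↔ l = y)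
    (hC : ∀ i, 0 < i → i < m → p i ∈ G.completeVerts T → ¬ G.Touches (p i) L)
    (h3 : m = 3 → p 1 ∈ G.completeVerts T ∧ p 2 ∈ G.completeVerts T)
    (hadj : G.Adj (p 0) (p m) → (∃ d, L = {d}) ∧ (∃ i, 0 < i ∧ i < m ∧ G.Touches (p i) L) ∧
      ∃ i, 0 < i ∧ i < m ∧ p i ∈ G.completeVerts T) :
    Even m ∨ (G.Adj (p 0) (p m) ∧
      ((∀ i, 0 < i → i < m → (p i ∈ G.completeVerts T ↔ i = m - 1) ∧
          (G.Touches (p i) L ↔ i = 1)) ∨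
        ∀ i, 0 < i → i < m → (p i ∈ G.completeVerts T ↔ i = 1) ∧
          (G.Touches (p i) L ↔ i = m - 1))) := by
  classical
  by_contra hcon
  obtain ⟨hodd, hbad⟩ := not_or.1 hcon
  clear hcon
  refine hodd ?_
  have inj : ∀ {i j}, i ≤ m → j ≤ m → p i = p j → i = j := by
    intro i j hi hj e
    rcases lt_trichotomy i j with hl | hl | hl
    · exact absurd e (hp i j hl hj).1
    · exact hl
    · exact absurd e.symm (hp j i hl hi).1
  have nadj : ∀ i j, i < j → j ≤ m → (i ≠ 0 ∨ j ≠ m ∨ ¬ G.Adj (p 0) (p m)) →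
      (G.Adj (p i) (p j) ↔ j = i + 1) := by
    intro i j h1 h2 h3
    by_cases h4 : i = 0 ∧ j = m
    · obtain ⟨rfl, rfl⟩ := h4
      exact iff_of_false (by tauto) (by omega)
    · exact (hp i j h1 h2).2 (by omega)
  have hseg : ∀ i j, i ≤ j → j ≤ m → (i ≠ 0 ∨ j ≠ m ∨ ¬ G.Adj (p 0) (p m)) →
      G.IP (p '' Set.Icc i j) (p i) (p j) (j - i) := by
    intro i j h1 h2 h3
    refine IP.of_seg h1 (fun k l hk hkl hl => ⟨(hp k l hkl (by omega)).1,
      nadj k l hkl (by omega) ?_⟩)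
    by_cases h4 : G.Adj (p 0) (p m)
    · have : i ≠ 0 ∨ j ≠ m := by tauto
      omega
    · exact Or.inr (Or.inr h4)
  have hO : ∀ i ≤ m, p i ∉ G.completeVerts T → p i ∈ G.outerVerts T := fun i hi h => ⟨hpT i hi, h⟩
  have hsegeven : ∀ r s, r + 2 ≤ s → s ≤ m → (r ≠ 0 ∨ s ≠ m ∨ ¬ G.Adj (p 0) (p m)) →
      p r ∈ G.completeVerts T → p s ∈ G.completeVerts T →
      (∀ j, r < j → j < s → p j ∉ G.completeVerts T) → Even (s - r) := by
    intro r s h1 h2 h3 h4 h5 h6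
    refine hE _ _ _ _ (hseg r s (by omega) h2 h3) (by omega) h4 h5 ?_
    rintro _ ⟨j, ⟨hj, hj'⟩, rfl⟩ h7 h8
    exact hO j (by omega) (h6 j (lt_of_le_of_ne hj (by rintro rfl; exact h7 rfl))
      (lt_of_le_of_ne hj' (by rintro rfl; exact h8 rfl)))
  have t0 : G.Touches (p 0) L := Or.inr ⟨x, hxL, (hx x hxL).2 rfl⟩
  have tm : G.Touches (p m) L := Or.inr ⟨y, hyL, (hy y hyL).2 rfl⟩
  -- By induction along the vertices attached to `L`, the last `T`-complete index up to each of them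
  -- is even. At `k = m` this index is `m` itself.
  have main : ∀ k ≤ m, G.Touches (p k) L → ∀ r ≤ k, p r ∈ G.completeVerts T →
      (∀ j, r < j → j ≤ k → p j ∉ G.completeVerts T) → Even r := by
    intro k
    induction k using Nat.strong_induction_on with
    | _ k ih =>
    intro hkm hkt r hrk hrC hrlast
    rcases Nat.eq_zero_or_pos k with rfl | hkpos
    · have : r = 0 := by omega
      subst this; simp
    -- the previous vertex attaching to `L`
    have hit := Nat.findGreatest_spec (P := fun i => G.Touches (p i) L) (Nat.zero_le (k - 1)) t0
    have hik := Nat.findGreatest_le (P := fun i => G.Touches (p i) L) (k - 1)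
    have himax : ∀ j, Nat.findGreatest (fun i => G.Touches (p i) L) (k - 1) < j → j < k →
        ¬ G.Touches (p j) L :=
      fun j h1 h2 => Nat.findGreatest_is_greatest h1 (by omega)
    generalize Nat.findGreatest (fun i => G.Touches (p i) L) (k - 1) = i at *
    -- the last `T`-complete vertex up to `p i`
    have hr0C := Nat.findGreatest_spec (P := fun i => p i ∈ G.completeVerts T) (Nat.zero_le i) h0
    have hr0i := Nat.findGreatest_le (P := fun i => p i ∈ G.completeVerts T) i
    have hr0max : ∀ j, Nat.findGreatest (fun i => p i ∈ G.completeVerts T) i < j → j ≤ i →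
        p j ∉ G.completeVerts T :=
      fun j h1 h2 => Nat.findGreatest_is_greatest h1 h2
    generalize Nat.findGreatest (fun i => p i ∈ G.completeVerts T) i = r0 at *
    have hr0even : Even r0 := ih i (by omega) (by omega) hit r0 hr0i hr0C hr0max
    -- If the attached vertices `p i`, `p k` are consecutive, `hC` leaves `k = m` as the only
    -- possible new `T`-complete index, and the segment from `p r0` to it is an outer path.
    by_cases hki : k = i + 1
    · rcases hrk.eq_or_lt with rfl | hrk
      · have hrm : r = m := by
          by_contra hne
          exact hC r hkpos (by omega) hrC hkt
        have hr0ne : r0 ≠ i := by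
          rintro rfl
          rcases Nat.eq_zero_or_pos r0 with rfl | hpos
          · omega
          · exact hC r0 hpos (by omega) hr0C hit
        have := hsegeven r0 r (by omega) hkm (by
          by_cases h4 : G.Adj (p 0) (p m)
          · obtain ⟨-, -, j, hj0, hjm, hjC⟩ := hadj h4
            left
            rintro rfl
            exact hr0max j hj0 (by omega) hjC
          · exact Or.inr (Or.inr h4)) hr0C hrC (fun j h1 h2 => hr0max j h1 (by omega))
        have h5 := this.add hr0even
        rwa [Nat.sub_add_cancel (by omega)] at h5
      · exact ih i (by omega) (by omega) hit r (by omega) hrC (fun j h1 h2 => hrlast j h1 (by omega))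
    by_cases hri : r < i
    · exact ih i (by omega) (by omega) hit r (by omega) hrC (fun j h1 h2 => hrlast j h1 (by omega))
    -- the first `T`-complete vertex from `p i` on
    have hex : ∃ s, i ≤ s ∧ p s ∈ G.completeVerts T := ⟨r, by omega, hrC⟩
    obtain ⟨his, hsC⟩ := Nat.find_spec hex
    have hsmin : ∀ j, i ≤ j → p j ∈ G.completeVerts T → Nat.find hex ≤ j :=
      fun j h1 h2 => Nat.find_le ⟨h1, h2⟩
    generalize Nat.find hex = s at *
    clear hex
    have hsr : s ≤ r := hsmin r (by omega) hrC
    -- Either `s = i`, covered by the induction, or `p r0, …, p s` is an outer path.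
    have hseven : Even s := by
      rcases his.eq_or_lt with rfl | his'
      · exact ih i (by omega) (by omega) hit i le_rfl hsC (fun j h1 h2 => by omega)
      · have hr0ne : r0 ≠ i := by
          rintro rfl
          have := hsmin r0 le_rfl hr0C
          omega
        have := hsegeven r0 s (by omega) (by omega) (by
          by_cases h4 : G.Adj (p 0) (p m)
          · obtain ⟨-, -, j, hj0, hjm, hjC⟩ := hadj h4
            by_contra hh
            push Not at hh
            obtain ⟨rfl, rfl, -⟩ := hh
            by_cases hji : j ≤ i
            · exact hr0max j hj0 hji hjC
            · have := hsmin j (by omega) hjC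
              omega
          · exact Or.inr (Or.inr h4)) hr0C hsC (fun j h1 h2 => by
            by_cases hji : j ≤ i
            · exact hr0max j h1 hji
            · intro hjC
              have := hsmin j (by omega) hjC
              omega)
        have h5 := this.add hr0even
        rwa [Nat.sub_add_cancel (by omega)] at h5
    have gapne : i ≠ 0 ∨ k ≠ m ∨ ¬ G.Adj (p 0) (p m) := by
      by_contra hh
      push Not at hh
      obtain ⟨rfl, rfl, h4⟩ := hh
      obtain ⟨-, ⟨j, hj0, hjm, hjt⟩, -⟩ := hadj h4
      exact himax j hj0 hjm hjt
    have hnL : ∀ j, i ≤ j → j ≤ k → p j ∉ L := by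
      intro j h1 h2 hjL
      rcases h1.eq_or_lt with rfl | h1
      · exact himax (i + 1) (by omega) (by omega) (Or.inr ⟨p i, hjL,
          ((nadj i (i + 1) (by omega) (by omega) (by omega)).2 rfl).symm⟩)
      · rcases h2.eq_or_lt with rfl | h2
        · refine himax (j - 1) (by omega) (by omega) (Or.inr ⟨p j, hjL,
            (nadj (j - 1) j (by omega) (by omega) (by omega)).2 (by omega)⟩)
        · exact himax j h1 h2 (Or.inl hjL)
    have hadji : ∃ l ∈ L, G.Adj (p i) l := hit.resolve_left (hnL i le_rfl (by omega))
    have hadjk : ∃ l ∈ L, G.Adj (p k) l := hkt.resolve_left (hnL k (by omega) le_rfl)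
    -- Strictly between `p i` and `p k` nothing is attached to `L`, so this segment and a path `F`
    -- of `L` form a hole, and `k - i + e` is even.
    obtain ⟨F, f, f', e, hF, hFL, hf, hf', hFf, hFf'⟩ :=
      hL.exists_ip (fun l => G.Adj (p i) l) (fun l => G.Adj (p k) l) hadji hadjk
    have hcross : ∀ j, i ≤ j → j ≤ k → ∀ l ∈ F,
        p j ≠ l ∧ (G.Adj (p j) l → (j = k ∧ l = f') ∨ (j = i ∧ l = f)) := by
      intro j h1 h2 l hl
      refine ⟨fun e => hnL j h1 h2 (e ▸ hFL hl), fun ha => ?_⟩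
      rcases h1.eq_or_lt with rfl | h1
      · exact Or.inr ⟨rfl, hFf l hl ha⟩
      · rcases h2.eq_or_lt with rfl | h2
        · exact Or.inl ⟨rfl, hFf' l hl ha⟩
        · exact absurd (Or.inr ⟨l, hFL hl, ha⟩) (himax j h1 h2)
    have hcyc := (hseg i k (by omega) hkm gapne).join_cyc hF.symm hf' hf (by
      rintro _ ⟨j, ⟨h1, h2⟩, rfl⟩ l hl
      refine ⟨(hcross j h1 h2 l hl).1, fun ha => ?_⟩
      rcases (hcross j h1 h2 l hl).2 ha with ⟨rfl, rfl⟩ | ⟨rfl, rfl⟩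
      · exact Or.inl ⟨rfl, rfl⟩
      · exact Or.inr ⟨rfl, rfl⟩)
    have hcodd := hG.odd_of_cyc hcyc (by omega)
    suffices hrs : Even (r - s) by
      have h5 := hrs.add hseven
      rwa [Nat.sub_add_cancel hsr] at h5
    rcases hsr.eq_or_lt with rfl | hsr
    · simp
    -- The other way round this hole, from `p s` through `p i`, `F` and `p k` to `p r`, is an outer
    -- path. Both parities together make `r - s` even.
    by_cases hrs2 : s + 2 ≤ r
    · have g1 : i ≠ 0 ∨ s ≠ m ∨ ¬ G.Adj (p 0) (p m) := by omega
      have g2 : r ≠ 0 ∨ k ≠ m ∨ ¬ G.Adj (p 0) (p m) := by omega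
      have j1 := (hseg i s his (by omega) g1).symm.join hF hf (by
        rintro _ ⟨j, ⟨h1, h2⟩, rfl⟩ l hl
        refine ⟨(hcross j h1 (by omega) l hl).1, fun ha => ?_⟩
        rcases (hcross j h1 (by omega) l hl).2 ha with ⟨rfl, rfl⟩ | ⟨rfl, rfl⟩
        · omega
        · exact ⟨rfl, rfl⟩)
      have j2 := j1.join (hseg r k hrk hkm g2).symm hf'.symm (by
        rintro s' (⟨j, ⟨h1, h2⟩, rfl⟩ | hs') _ ⟨l, ⟨h1', h2'⟩, rfl⟩
        · refine ⟨(hp j l (by omega) (by omega)).1, fun ha => ?_⟩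
          have := (nadj j l (by omega) (by omega) (by
            by_cases h4 : G.Adj (p 0) (p m)
            · have : i ≠ 0 ∨ k ≠ m := by tauto
              omega
            · exact Or.inr (Or.inr h4))).1 ha
          omega
        · refine ⟨(hcross l (by omega) (by omega) s' hs').1.symm, fun ha => ?_⟩
          rcases (hcross l (by omega) (by omega) s' hs').2 ha.symm with ⟨rfl, rfl⟩ | ⟨rfl, rfl⟩
          · exact ⟨rfl, rfl⟩
          · omega)
      have heven := hE _ _ _ _ j2 (by omega) hsC hrC (by
        rintro s' ((⟨j, ⟨h1, h2⟩, rfl⟩ | hs') | ⟨j, ⟨h1, h2⟩, rfl⟩) h7 h8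
        · refine hO j (by omega) (fun hjC => h7 ?_)
          have := hsmin j h1 hjC
          have : j = s := by omega
          rw [this]
        · exact hLO (hFL hs')
        · exact hO j (by omega)
            (hrlast j (lt_of_le_of_ne h1 (by rintro rfl; exact h8 rfl)) (by omega)))
      rw [Nat.even_iff] at heven ⊢
      rw [Nat.odd_iff] at hcodd
      omega
    -- Now `p s` and `p (s + 1)` are the only `T`-complete vertices of the hole. By
    -- `InClassA.false_of_edge_link`, no further `T`-complete vertex attached to `L` can miss both,
    -- up to a proviso for 4-holes. The candidates are `p m` and `p 0`.
    exfalso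
    have hrs1 : r = s + 1 := by omega
    subst hrs1
    have hSO : ∀ v ∈ p '' Set.Icc i k ∪ F, v ≠ p s → v ≠ p (s + 1) → v ∈ G.outerVerts T := by
      rintro v (⟨j, ⟨h1, h2⟩, rfl⟩ | hv) h7 h8
      · refine hO j (by omega) (fun hjC => ?_)
        have := hsmin j h1 hjC
        have hj1 : j ≠ s := by rintro rfl; exact h7 rfl
        have hj2 : j ≠ s + 1 := by rintro rfl; exact h8 rfl
        exact hrlast j (by omega) h2 hjC
      · exact hLO (hFL hv)
    have hss : G.Adj (p s) (p (s + 1)) := (nadj s (s + 1) (by omega) (by omega) (by omega)).2 rfl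
    have hcyc' := hcyc.of_adj (by omega) (Or.inl ⟨s, ⟨his, by omega⟩, rfl⟩)
      (Or.inl ⟨s + 1, ⟨by omega, hrk⟩, rfl⟩) hss
    have hsL := hnL s his (by omega)
    have hs1L := hnL (s + 1) (by omega) hrk
    have hsi : s = i → i = 0 := by
      rintro rfl
      by_contra hne
      exact hC s (by omega) (by omega) hsC hit
    have hsk : s + 1 = k → k = m := by
      intro e
      rw [e] at hrC
      by_contra hne
      exact hC k (by omega) (by omega) hrC hkt
    have hK : ∀ w ∈ G.completeVerts T, (∃ l ∈ L, G.Adj w l) → w ≠ p s → w ≠ p (s + 1) →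
        ¬ G.Adj w (p s) → ¬ G.Adj w (p (s + 1)) →
        (k = i + 2 → ∃ j, i ≤ j ∧ j ≤ k ∧ j ≠ s ∧ j ≠ s + 1 ∧ ¬ G.Adj w (p j)) → False := by
      intro w hwC hwL hw1 hw2 hw3 hw4 hw5
      refine hG.false_of_edge_link hT hE hcyc' (by omega) hsC hrC hSO (L := {w} ∪ L)
        ((Conn.single w).union hL rfl (Or.inr hwL)) ?_ ?_ ?_ ?_ ⟨w, Or.inl rfl, hwC⟩ ?_ ?_
      · rintro l (rfl | hl)
        · exact hwC.1
        · exact (hLO hl).1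
      · rintro (h | h)
        · exact hw1 h.symm
        · exact hsL h
      · rintro (h | h)
        · exact hw2 h.symm
        · exact hs1L h
      · rintro l (rfl | hl) hlS
        · exact ⟨hw3, hw4⟩
        · constructor
          · intro ha
            have hts : G.Touches (p s) L := Or.inr ⟨l, hl, ha.symm⟩
            have e1 : s = i := by
              by_contra hne
              exact himax s (by omega) (by omega) hts
            have e2 := hsi e1
            have e3 : s = 0 := by omega
            rw [e3, G.adj_comm] at ha
            rw [e2] at hf
            have h5 := (hx l hl).1 ha
            have h6 := (hx f (hFL hF.left_mem)).1 hf
            exact hlS (Or.inr (h5.trans h6.symm ▸ hF.left_mem))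
          · intro ha
            have hts : G.Touches (p (s + 1)) L := Or.inr ⟨l, hl, ha.symm⟩
            have e1 : s + 1 = k := by
              by_contra hne
              exact himax (s + 1) (by omega) (by omega) hts
            have e2 := hsk e1
            rw [e1, e2, G.adj_comm] at ha
            rw [e2] at hf'
            have h5 := (hy l hl).1 ha
            have h6 := (hy f' (hFL hF.right_mem)).1 hf'
            exact hlS (Or.inr (h5.trans h6.symm ▸ hF.right_mem))
      · refine ⟨f, Or.inr hF.left_mem, ?_, ?_, Or.inl (Or.inr (hFL hF.left_mem))⟩
        · rintro rfl; exact hsL (hFL hF.left_mem)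
        · rintro rfl; exact hs1L (hFL hF.left_mem)
      · rintro hM l (rfl | hl) hlC
        · have hki2 : k = i + 2 := by clear hw5; omega
          obtain ⟨j, h1, h2, h3, h4, h5⟩ := hw5 hki2
          refine ⟨p j, Or.inl ⟨j, ⟨h1, h2⟩, rfl⟩, fun e => h3 (inj (by omega) (by omega) e),
            fun e => h4 (inj (by omega) (by omega) e), h5⟩
        · exact absurd hlC (hLO hl).2
    have hFd : ∀ d, L = {d} → F = {d} ∧ f = d ∧ f' = d ∧ e = 0 := by
      rintro d rfl
      have h1 : f = d := hFL hF.left_mem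
      have h2 : f' = d := hFL hF.right_mem
      refine ⟨?_, h1, h2, ?_⟩
      · ext v
        constructor
        · intro hv; exact hFL hv
        · rintro rfl; exact h1 ▸ hF.left_mem
      · obtain ⟨q, hq0, hqe, hqS, hq⟩ := hF
        exact (hq.inj (by omega) le_rfl (hq0.trans (h1.trans (h2.symm.trans hqe.symm)))).symm
    rcases his.eq_or_lt with hisE | hisL
    · -- the edge starts at `p 0`
      have hi0 := hsi hisE.symm
      have hs0 : s = 0 := by omega
      subst hs0
      subst hi0
      have hm3 : m ≠ 3 := by
        intro e
        exact hrlast 2 (by omega) (by omega) (h3 e).2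
      -- If `p 0` and `p m` are adjacent, `p m` cannot be this vertex. But then `L = {d}`, and
      -- either `k = m - 1`, an exceptional configuration, or `p 1, …, p k, d, p m` is an outer path
      -- of length `k + 1`, which is odd because the hole has `k + 2` vertices.
      by_cases h4 : G.Adj (p 0) (p m)
      · obtain ⟨⟨d, hd⟩, -, -⟩ := hadj h4
        obtain ⟨rfl, rfl, rfl, rfl⟩ := hFd d hd
        have hkm' : k ≠ m := by tauto
        by_cases hkm2 : k = m - 1
        · refine hbad ⟨h4, Or.inr fun j h1 h2 => ⟨⟨fun h => ?_, ?_⟩, ⟨fun h => ?_, ?_⟩⟩⟩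
          · by_contra hne
            exact hrlast j (by omega) (by omega) h
          · rintro rfl; exact hrC
          · by_contra hne
            exact himax j h1 (by omega) h
          · intro e; rw [e, ← hkm2]; exact hkt
        · have hfm : G.Adj f' (p m) :=
            ((hy f' (hFL hF.left_mem)).2 (by rw [hd] at hyL; exact hyL.symm)).symm
          have j1 := (hseg 1 k (by omega) hkm (by omega)).join hF hf' (by
            rintro _ ⟨j, ⟨h1, h2⟩, rfl⟩ l hl
            refine ⟨(hcross j (by omega) (by omega) l hl).1, fun ha => ?_⟩
            rcases (hcross j (by omega) (by omega) l hl).2 ha with ⟨rfl, rfl⟩ | ⟨rfl, rfl⟩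
            · exact ⟨rfl, rfl⟩
            · omega)
          have j2 := j1.join (IP.single (p m)) hfm (by
            rintro v (⟨j, ⟨h1, h2⟩, rfl⟩ | hv) _ rfl
            · refine ⟨(hp j m (by omega) le_rfl).1, fun ha => ?_⟩
              have := (nadj j m (by omega) le_rfl (by omega)).1 ha
              omega
            · refine ⟨?_, fun _ => ⟨hv, rfl⟩⟩
              rw [show v = f' from hv]; exact hfm.ne)
          have heven := hE _ _ _ _ j2 (by omega) hrC hmC (by
            rintro v ((⟨j, ⟨h1, h2⟩, rfl⟩ | hv) | rfl) h7 h8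
            · exact hSO _ (Or.inl ⟨j, ⟨by omega, h2⟩, rfl⟩)
                (fun e => by have := inj (by omega) (by omega) e; omega) h7
            · exact hLO (hFL hv)
            · exact absurd rfl h8)
          rw [Nat.even_iff] at heven
          rw [Nat.odd_iff] at hcodd
          omega
      · refine hK (p m) hmC ⟨y, hyL, (hy y hyL).2 rfl⟩ ?_ ?_ (fun h => h4 h.symm) ?_ ?_
        · exact (hp 0 m (by omega) le_rfl).1.symm
        · exact (hp 1 m (by omega) le_rfl).1.symm
        · intro ha
          have := (nadj 1 m (by omega) le_rfl (by omega)).1 ha.symm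
          omega
        · intro hk2
          refine ⟨2, by omega, by omega, by omega, by omega, fun ha => ?_⟩
          rcases (show 2 ≤ m by omega).eq_or_lt with e | e
          · omega
          · have := (nadj 2 m e le_rfl (by omega)).1 ha.symm
            omega
    · by_cases hsk' : s + 1 = k
      · have hkm' := hsk hsk'
        subst hkm'
        have hs : s = k - 1 := by omega
        have hi1 : i ≠ 0 := by
          rintro rfl
          have := hsmin 0 le_rfl h0
          omega
        -- The mirror image: `p s, …, p i, d, p 0` is an odd outer path unless `i = 1`, the other
        -- exceptional configuration.
        by_cases h4 : G.Adj (p 0) (p k)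
        · obtain ⟨⟨d, hd⟩, -, -⟩ := hadj h4
          obtain ⟨rfl, rfl, rfl, rfl⟩ := hFd d hd
          by_cases hi2 : i = 1
          · refine hbad ⟨h4, Or.inl fun j h1 h2 => ⟨⟨fun h => ?_, ?_⟩, ⟨fun h => ?_, ?_⟩⟩⟩
            · have := hsmin j (by omega) h; omega
            · rintro rfl; rw [← hs]; exact hsC
            · by_contra hne
              exact himax j (by omega) h2 h
            · rintro rfl; rw [← hi2]; exact hit
          · have hf0 : G.Adj f' (p 0) :=
              ((hx f' (hFL hF.left_mem)).2 (by rw [hd] at hxL; exact hxL.symm)).symm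
            have j1 := (hseg i s (by omega) (by omega) (by omega)).symm.join hF hf (by
              rintro _ ⟨j, ⟨h1, h2⟩, rfl⟩ l hl
              refine ⟨(hcross j (by omega) (by omega) l hl).1, fun ha => ?_⟩
              rcases (hcross j (by omega) (by omega) l hl).2 ha with ⟨rfl, rfl⟩ | ⟨rfl, rfl⟩
              · omega
              · exact ⟨rfl, rfl⟩)
            have j2 := j1.join (IP.single (p 0)) hf0 (by
              rintro v (⟨j, ⟨h1, h2⟩, rfl⟩ | hv) _ rfl
              · refine ⟨(hp 0 j (by omega) (by omega)).1.symm, fun ha => ?_⟩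
                have := (nadj 0 j (by omega) (by omega) (by omega)).1 ha.symm
                omega
              · refine ⟨?_, fun _ => ⟨hv, rfl⟩⟩
                rw [show v = f' from hv]; exact hf0.ne)
            have heven := hE _ _ _ _ j2 (by omega) hsC h0 (by
              rintro v ((⟨j, ⟨h1, h2⟩, rfl⟩ | hv) | rfl) h7 h8
              · exact hSO _ (Or.inl ⟨j, ⟨by omega, by omega⟩, rfl⟩) h7
                  (fun e => by have := inj (by omega) (by omega) e; omega)
              · exact hLO (hFL hv)
              · exact absurd rfl h8)
            rw [Nat.even_iff] at heven
            rw [Nat.odd_iff] at hcodd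
            omega
        · refine hK (p 0) h0 ⟨x, hxL, (hx x hxL).2 rfl⟩ ?_ ?_ ?_ ?_ ?_
          · exact (hp 0 s (by omega) (by omega)).1
          · exact (hp 0 (s + 1) (by omega) (by omega)).1
          · intro ha
            have := (nadj 0 s (by omega) (by omega) (by omega)).1 ha
            omega
          · rw [hsk']; exact h4
          · intro hk2
            refine ⟨i, le_rfl, by omega, by omega, by omega, fun ha => ?_⟩
            have h5 := (nadj 0 i (by omega) (by omega) (by omega)).1 ha
            have h6 := (h3 (by omega)).1
            rw [show i = 1 by omega] at hit
            exact hC 1 (by omega) (by omega) h6 hit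
      · have hs2 : 2 ≤ s := by
          by_contra hlt
          have e0 : i = 0 := by omega
          subst e0
          have := hsmin 0 le_rfl h0
          omega
        refine hK (p 0) h0 ⟨x, hxL, (hx x hxL).2 rfl⟩ ?_ ?_ ?_ ?_ (by omega)
        · exact (hp 0 s (by omega) (by omega)).1
        · exact (hp 0 (s + 1) (by omega) (by omega)).1
        · intro ha
          have := (nadj 0 s (by omega) (by omega) (by omega)).1 ha
          omega
        · intro ha
          have := (nadj 0 (s + 1) (by omega) (by omega) (by omega)).1 ha
          omega
  exact main m le_rfl tm m le_rfl hmC (fun j h1 h2 => by omega)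

end SimpleGraph

namespace SimpleGraph

variable {V : Type*} {G : SimpleGraph V} {T : Set V}

/-! ### Outer paths have even length -/

theorem conn_iff_preconnected {S : Set V} : G.Conn S ↔ (G.induce S).Preconnected := by
  constructor
  · rintro h ⟨x, hx⟩ ⟨y, hy⟩
    have hr := h x hx y hy
    have key : ∀ z, Relation.ReflTransGen (fun a b => G.Adj a b ∧ a ∈ S ∧ b ∈ S) x z →
        ∀ hz : z ∈ S, (G.induce S).Reachable ⟨x, hx⟩ ⟨z, hz⟩ := by
      intro z hz
      induction hz with
      | refl => intro _; exact .refl _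
      | tail _ h2 ih =>
        intro hz
        exact (ih h2.2.1).trans (Adj.reachable (by simpa using h2.1))
    exact key y hr hy
  · intro h x hx y hy
    have hr := (reachable_iff_reflTransGen _ _).1 (h ⟨x, hx⟩ ⟨y, hy⟩)
    exact hr.lift Subtype.val (fun a b hab => ⟨by simpa using hab, a.2, b.2⟩)

/-- Applied to the complement, this removes a vertex from `T` while keeping `T` co-connected, which
allows induction on the size of `T` in `InClassA.evenOuter`. -/
theorem Conn.exists_diff_singleton [Finite V] {S : Set V} (h : G.Conn S) (hS : S.Nontrivial) :
    ∃ z ∈ S, G.Conn (S \ {z}) := by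
  have : Nontrivial S := hS.coe_sort
  have hc : (G.induce S).Connected := { preconnected := conn_iff_preconnected.1 h }
  obtain ⟨z, hz⟩ := hc.exists_preconnected_induce_compl_singleton_of_finite
  refine ⟨z, z.2, ?_⟩
  intro x hx y hy
  have hz' := conn_iff_preconnected.2 hz
  have := hz' ⟨x, hx.1⟩ (fun e => hx.2 (congrArg Subtype.val e)) ⟨y, hy.1⟩
    (fun e => hy.2 (congrArg Subtype.val e))
  refine this.lift Subtype.val ?_
  rintro a b ⟨h1, h2, h3⟩
  exact ⟨by simpa using h1, ⟨a.2, fun e => h2 (Subtype.ext e)⟩, ⟨b.2, fun e => h3 (Subtype.ext e)⟩⟩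

/-- The complement of the path on `p 0, …, p 3` is the path `p 2, p 0, p 3, p 1`. A co-path of `T`
from a non-neighbour of `p 1` to one of `p 2` closes it into an antihole with at least five
vertices. This case is separate because `InClassA.even_of_attached` wants `p 1` and `p 2` complete
when `m = 3`. -/
theorem InClassA.false_of_length_three (hG : G.InClassA) (hT : Gᶜ.Conn T) {p : ℕ → V}
    (hp : G.IndPath p 3) (h0 : p 0 ∈ G.completeVerts T) (h3 : p 3 ∈ G.completeVerts T)
    (h1 : p 1 ∈ G.outerVerts T) (h2 : p 2 ∈ G.outerVerts T) : False := by
  obtain ⟨F, q, r, e, hF, hFT, hq, hr, hFq, hFr⟩ :=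
    hT.exists_ip (fun t => ¬ G.Adj (p 1) t) (fun t => ¬ G.Adj (p 2) t)
      (exists_not_adj_of_mem_outerVerts h1) (exists_not_adj_of_mem_outerVerts h2)
  have hne : ∀ i, i ≤ 3 → ∀ f ∈ F, p i ≠ f := by
    rintro i hi f hf rfl
    have := hFT hf
    interval_cases i
    exacts [h0.1 this, h1.1 this, h2.1 this, h3.1 this]
  have hpp : ∀ i j, i ≤ 3 → j ≤ 3 → (Gᶜ.Adj (p i) (p j) ↔ i + 2 ≤ j ∨ j + 2 ≤ i) := by
    intro i j hi hj
    rw [compl_adj, hp.adj_iff hi hj]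
    constructor
    · rintro ⟨h1, h2⟩
      have : i ≠ j := by rintro rfl; exact h1 rfl
      omega
    · intro h
      exact ⟨fun e => by have := hp.inj hi hj e; omega, by omega⟩
  have hpne : ∀ i j, i ≤ 3 → j ≤ 3 → i ≠ j → p i ≠ p j :=
    fun i j hi hj h e => h (hp.inj hi hj e)
  have c1 := (IP.single (p 1)).join hF
    (by rw [compl_adj]; exact ⟨hne 1 (by omega) q hF.left_mem, hq⟩) (by
    rintro s rfl s' hs'
    exact ⟨hne 1 (by omega) s' hs', fun ha => ⟨rfl, hFq s' hs' (compl_adj _ _ _ |>.1 ha).2⟩⟩)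
  have c2 := c1.join (IP.single (p 2))
    (by rw [compl_adj]; exact ⟨(hne 2 (by omega) r hF.right_mem).symm, fun ha => hr ha.symm⟩) (by
    rintro s (rfl | hs) s' rfl
    · refine ⟨hpne 1 2 (by omega) (by omega) (by omega), fun ha => ?_⟩
      have := (hpp 1 2 (by omega) (by omega)).1 ha
      omega
    · exact ⟨(hne 2 (by omega) s hs).symm,
        fun ha => ⟨hFr s hs fun hb => (compl_adj _ _ _ |>.1 ha).2 hb.symm, rfl⟩⟩)
  have c3 := c2.join (IP.single (p 0)) ((hpp 2 0 (by omega) (by omega)).2 (by omega)) (by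
    rintro s ((rfl | hs) | rfl) s' rfl
    · refine ⟨hpne 1 0 (by omega) (by omega) (by omega), fun ha => ?_⟩
      have := (hpp 1 0 (by omega) (by omega)).1 ha
      omega
    · exact ⟨(hne 0 (by omega) s hs).symm,
        fun ha => absurd (h0.2 s (hFT hs)).symm (compl_adj _ _ _ |>.1 ha).2⟩
    · exact ⟨hpne 2 0 (by omega) (by omega) (by omega), fun _ => ⟨rfl, rfl⟩⟩)
  have c4 := c3.close (w := p 3) (by
      rintro (((h | hs) | h) | h)
      · exact hpne 3 1 (by omega) (by omega) (by omega) h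
      · exact hne 3 (by omega) _ hs rfl
      · exact hpne 3 2 (by omega) (by omega) (by omega) h
      · exact hpne 3 0 (by omega) (by omega) (by omega) h)
    ((hpp 1 3 (by omega) (by omega)).2 (by omega)) ((hpp 0 3 (by omega) (by omega)).2 (by omega))
    (by
      rintro s (((rfl | hs) | rfl) | rfl) ha
      · exact Or.inl rfl
      · exact absurd (h3.2 s (hFT hs)).symm (compl_adj _ _ _ |>.1 ha).2
      · have := (hpp 2 3 (by omega) (by omega)).1 ha
        omega
      · exact Or.inr rfl)
  exact hG.false_of_compl_cyc c4 (by omega)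

/-- The Roussel–Rubio lemma for graphs without prisms and long antiholes. -/
theorem InClassA.evenOuter [Finite V] (hG : G.InClassA) :
    ∀ {T : Set V}, Gᶜ.Conn T → G.EvenOuter T := by
  suffices H : ∀ n, ∀ T : Set V, T.ncard = n → Gᶜ.Conn T → G.EvenOuter T from
    fun {T} hT => H _ T rfl hT
  intro n
  induction n using Nat.strong_induction_on with
  | _ n ih =>
  rintro T rfl hT S x y m ⟨p, rfl, rfl, rfl, hp⟩ hm h0 hmC hO
  have hO' : ∀ i, 0 < i → i < m → p i ∈ G.outerVerts T := by
    intro i h1 h2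
    refine hO _ ⟨i, h2.le, rfl⟩ (fun e => ?_) (fun e => ?_)
    · have := hp.inj (by omega) (by omega) e; omega
    · have := hp.inj (by omega) (by omega) e; omega
  have hpT : ∀ i ≤ m, p i ∉ T := by
    intro i hi
    rcases Nat.eq_zero_or_pos i with rfl | h1
    · exact h0.1
    · rcases hi.eq_or_lt with rfl | h2
      · exact hmC.1
      · exact (hO' i h1 h2).1
  obtain ⟨t, htT, -⟩ := exists_not_adj_of_mem_outerVerts (hO' 1 (by omega) (by omega))
  by_cases hTn : T.Nontrivial
  · by_contra hodd
    rw [Nat.not_even_iff_odd] at hodd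
    by_cases hm3 : m = 3
    · subst hm3
      exact hG.false_of_length_three hT hp h0 hmC (hO' 1 (by omega) (by omega))
        (hO' 2 (by omega) (by omega))
    -- The removed vertex `z` is outer for `T \ {z}` and plays the role of `L`. Both ends see it,
    -- and an internal vertex complete to `T \ {z}` cannot, since it would be complete to `T`.
    obtain ⟨z, hzT, hz⟩ := hT.exists_diff_singleton hTn
    have hE : G.EvenOuter (T \ {z}) :=
      ih _ (Set.ncard_sdiff_singleton_lt_of_mem hzT (Set.toFinite _)) _ rfl hz
    have hmono : ∀ v ∈ G.completeVerts T, v ∈ G.completeVerts (T \ {z}) :=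
      fun v hv => ⟨fun h => hv.1 h.1, fun t ht => hv.2 t ht.1⟩
    have hzO : z ∈ G.outerVerts (T \ {z}) := by
      refine ⟨fun h => h.2 rfl, fun h => ?_⟩
      obtain ⟨u, hu, hne⟩ := hTn.exists_ne z
      rcases Relation.ReflTransGen.cases_head (hT z hzT u hu) with e | ⟨c, hc, -⟩
      · exact hne e.symm
      · have := (compl_adj _ _ _).1 hc.1
        exact this.2 (h.2 c ⟨hc.2.2, fun e => this.1 (by rw [Set.mem_singleton_iff.1 e])⟩)
    rw [Nat.odd_iff] at hodd
    have h0m : ¬ G.Adj (p 0) (p m) := by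
      rw [hp.adj_iff (by omega) le_rfl]; omega
    rcases hG.even_of_attached hz hE (p := p) (m := m)
      (fun i j h1 h2 => ⟨(hp i j h1 h2).1, fun _ => (hp i j h1 h2).2⟩) (by omega)
      (fun i hi h => hpT i hi h.1) (hmono _ h0) (hmono _ hmC) (Conn.single z)
      (by rintro _ rfl; exact hzO) rfl rfl
      (by rintro _ rfl; exact iff_of_true (h0.2 _ hzT) rfl)
      (by rintro _ rfl; exact iff_of_true (hmC.2 _ hzT) rfl)
      (by
        intro i h1 h2 hiC
        have hi := hO' i h1 h2
        rintro (h | ⟨z', hz', h⟩)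
        · exact hi.1 (by rw [Set.mem_singleton_iff.1 h]; exact hzT)
        · refine hi.2 ⟨hi.1, fun t ht => ?_⟩
          by_cases e : t = z
          · rw [e, ← Set.mem_singleton_iff.1 hz']; exact h
          · exact hiC.2 t ⟨ht, e⟩)
      (by intro h; omega) (fun h => absurd h h0m) with h | h
    · rw [Nat.even_iff] at h; omega
    · exact h0m h.1
  -- A single vertex `t` is adjacent to the two ends of the path only and closes it into a hole.
  · rw [Set.not_nontrivial_iff] at hTn
    have hT1 : ∀ s ∈ T, s = t := fun s hs => hTn hs htT
    have hc := hp.ip.close (w := t) (by rintro ⟨i, hi, rfl⟩; exact hpT i hi htT)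
      (h0.2 t htT) (hmC.2 t htT) (by
        rintro _ ⟨i, hi, rfl⟩ ha
        by_contra hcon
        push Not at hcon
        obtain ⟨s, hs, hns⟩ := exists_not_adj_of_mem_outerVerts (hO _ ⟨i, hi, rfl⟩ hcon.1 hcon.2)
        exact hns (hT1 s hs ▸ ha))
    have := hG.odd_of_cyc hc (by omega)
    rw [Nat.odd_iff] at this
    rw [Nat.even_iff]
    omega

end SimpleGraph

namespace SimpleGraph

variable {V : Type*} {G : SimpleGraph V} {T : Set V} {z : ℕ → V} {n : ℕ}

/-! ### Shortest outer paths -/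

/-- `z 0, …, z n` is a shortest outer path for a co-connected set `T` such that the neighbours in
`C(T)` of every outer vertex form a clique. -/
structure IsFrame (G : SimpleGraph V) (T : Set V) (z : ℕ → V) (n : ℕ) : Prop where
  inClassA : G.InClassA
  conn : Gᶜ.Conn T
  nonempty : T.Nonempty
  even : G.EvenOuter T
  clique : ∀ o ∈ G.outerVerts T, ∀ u ∈ G.completeVerts T, ∀ v ∈ G.completeVerts T,
    G.Adj o u → G.Adj o v → u ≠ v → G.Adj u v
  indPath : G.IndPath z n
  two_le : 2 ≤ n
  left_mem : z 0 ∈ G.completeVerts T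
  right_mem : z n ∈ G.completeVerts T
  outer : ∀ i, 0 < i → i < n → z i ∈ G.outerVerts T
  shortest : ∀ S x y k, G.IP S x y k → 2 ≤ k → x ∈ G.completeVerts T → y ∈ G.completeVerts T →
    (∀ s ∈ S, s ≠ x → s ≠ y → s ∈ G.outerVerts T) → n ≤ k

/-- The interior of the path `z 0, …, z n`. -/
def inner (z : ℕ → V) (n : ℕ) : Set V := z '' Set.Icc 1 (n - 1)

/-- The `T`-complete vertices whose only neighbour among `z 1, …, z (n - 1)` is `z 1`. -/
def sideVerts (G : SimpleGraph V) (T : Set V) (z : ℕ → V) (n : ℕ) : Set V :=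
  {v | v ∈ G.completeVerts T ∧ ∀ i, 0 < i → i < n → (G.Adj v (z i) ↔ i = 1)}

/-- The sequence `z` read backwards. -/
def flip (z : ℕ → V) (n : ℕ) : ℕ → V := fun i => z (n - i)

theorem inner_flip : inner (flip z n) n = inner z n := by
  ext v
  simp only [inner, flip, Set.mem_image, Set.mem_Icc]
  constructor
  · rintro ⟨i, hi, rfl⟩
    exact ⟨n - i, by omega, rfl⟩
  · rintro ⟨i, hi, rfl⟩
    exact ⟨n - i, by omega, by congr 1; omega⟩

theorem mem_sideVerts_flip {v : V} : v ∈ G.sideVerts T (flip z n) n ↔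
    v ∈ G.completeVerts T ∧ ∀ i, 0 < i → i < n → (G.Adj v (z i) ↔ i = n - 1) := by
  refine and_congr_right fun _ => ⟨fun h i h1 h2 => ?_, fun h i h1 h2 => ?_⟩
  · have := h (n - i) (by omega) (by omega)
    simp only [flip] at this
    rw [show n - (n - i) = i by omega] at this
    rw [this]; omega
  · simp only [flip]
    rw [h (n - i) (by omega) (by omega)]; omega

theorem flip_flip_eq {i : ℕ} (hi : i ≤ n) : flip (flip z n) n i = z i := by
  simp only [flip]; congr 1; omega

theorem sideVerts_flip_flip : G.sideVerts T (flip (flip z n) n) n = G.sideVerts T z n := by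
  ext v
  refine and_congr_right fun _ => ?_
  constructor
  · intro h i h1 h2
    rw [← flip_flip_eq (z := z) h2.le]; exact h i h1 h2
  · intro h i h1 h2
    rw [flip_flip_eq (z := z) h2.le]; exact h i h1 h2

theorem IndPath.flip {p : ℕ → V} {m : ℕ} (h : G.IndPath p m) :
    G.IndPath (SimpleGraph.flip p m) m := by
  intro i j h1 h2
  obtain ⟨h3, h4⟩ := h (m - j) (m - i) (by omega) (by omega)
  simp only [SimpleGraph.flip]
  exact ⟨h3.symm, by rw [G.adj_comm, h4]; omega⟩

/-! ### Basic properties of the two sides of a frame -/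

namespace IsFrame

theorem flip (h : G.IsFrame T z n) : G.IsFrame T (SimpleGraph.flip z n) n where
  inClassA := h.inClassA
  conn := h.conn
  nonempty := h.nonempty
  even := h.even
  clique := h.clique
  indPath := h.indPath.flip
  two_le := h.two_le
  left_mem := by simpa [SimpleGraph.flip] using h.right_mem
  right_mem := by simpa [SimpleGraph.flip] using h.left_mem
  outer := fun i h1 h2 => h.outer (n - i) (by omega) (by omega)
  shortest := h.shortest

theorem even_n (h : G.IsFrame T z n) : Even n := by
  refine h.even _ _ _ _ h.indPath.ip h.two_le h.left_mem h.right_mem ?_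
  rintro _ ⟨i, hi, rfl⟩ h1 h2
  exact h.outer i (Nat.pos_of_ne_zero (by rintro rfl; exact h1 rfl))
    (lt_of_le_of_ne hi (by rintro rfl; exact h2 rfl))

/-- If `n = 2`, the outer vertex `z 1` would have two non-adjacent `T`-complete neighbours. -/
theorem four_le (h : G.IsFrame T z n) : 4 ≤ n := by
  have h1 := h.even_n
  rw [Nat.even_iff] at h1
  have h2 := h.two_le
  by_contra hcon
  have e : n = 2 := by omega
  subst e
  have := h.clique _ (h.outer 1 (by omega) (by omega)) _ h.left_mem _ h.right_mem
    (h.indPath.adj_succ (i := 0) (by omega)).symm (h.indPath.adj_succ (i := 1) (by omega))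
    (h.indPath 0 2 (by omega) le_rfl).1
  rw [(h.indPath 0 2 (by omega) le_rfl).2] at this
  omega

theorem inner_subset (h : G.IsFrame T z n) : inner z n ⊆ G.outerVerts T := by
  rintro _ ⟨i, ⟨h1, h2⟩, rfl⟩
  have := h.two_le
  exact h.outer i h1 (by omega)

theorem ip_inner (h : G.IsFrame T z n) : G.IP (inner z n) (z 1) (z (n - 1)) (n - 2) := by
  have := h.two_le
  exact h.indPath.seg (i := 1) (j := n - 1) (by omega) (by omega)

theorem _root_.SimpleGraph.mem_inner {i : ℕ} (h1 : 0 < i) (h2 : i < n) : z i ∈ inner z n :=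
  ⟨i, ⟨h1, by omega⟩, rfl⟩

theorem left_mem_side (h : G.IsFrame T z n) : z 0 ∈ G.sideVerts T z n := by
  refine ⟨h.left_mem, fun i h1 h2 => ?_⟩
  rw [(h.indPath 0 i h1 h2.le).2]

theorem right_mem_side (h : G.IsFrame T z n) : z n ∈ G.sideVerts T (SimpleGraph.flip z n) n := by
  simpa [SimpleGraph.flip] using h.flip.left_mem_side

theorem adj_inner_iff (h : G.IsFrame T z n) {u : V} (hu : u ∈ G.sideVerts T z n) {l : V}
    (hl : l ∈ inner z n) : G.Adj u l ↔ l = z 1 := by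
  have := h.two_le
  obtain ⟨i, ⟨h1, h2⟩, rfl⟩ := hl
  rw [hu.2 i h1 (by omega)]
  exact ⟨fun e => by rw [e], fun e => h.indPath.inj (by omega) (by omega) e⟩

theorem adj_inner_iff' (h : G.IsFrame T z n) {u : V}
    (hu : u ∈ G.sideVerts T (SimpleGraph.flip z n) n) {l : V} (hl : l ∈ inner z n) :
    G.Adj u l ↔ l = z (n - 1) := by
  rw [h.flip.adj_inner_iff hu (by rwa [inner_flip])]; rfl

theorem adj_one (h : G.IsFrame T z n) {u : V} (hu : u ∈ G.sideVerts T z n) : G.Adj u (z 1) :=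
  (hu.2 1 (by omega) (by have := h.two_le; omega)).2 rfl

theorem adj_last (h : G.IsFrame T z n) {u : V}
    (hu : u ∈ G.sideVerts T (SimpleGraph.flip z n) n) : G.Adj u (z (n - 1)) :=
  h.flip.adj_one hu

theorem side_clique (h : G.IsFrame T z n) {u v : V} (hu : u ∈ G.sideVerts T z n)
    (hv : v ∈ G.sideVerts T z n) (hne : u ≠ v) : G.Adj u v :=
  h.clique _ (h.outer 1 (by omega) (by have := h.two_le; omega)) _ hu.1 _ hv.1
    (h.adj_one hu).symm (h.adj_one hv).symm hne

theorem side_ne (h : G.IsFrame T z n) {u v : V} (hu : u ∈ G.sideVerts T z n)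
    (hv : v ∈ G.sideVerts T (SimpleGraph.flip z n) n) : u ≠ v := by
  rintro rfl
  have := h.four_le
  have h1 := (mem_sideVerts_flip.1 hv).2 1 (by omega) (by omega)
  have := h1.1 (h.adj_one hu)
  omega

theorem ip_left (h : G.IsFrame T z n) {u : V} (hu : u ∈ G.sideVerts T z n) :
    G.IP ({u} ∪ inner z n) u (z (n - 1)) (n - 1) := by
  have h2 := h.two_le
  have := (IP.single u).join h.ip_inner (h.adj_one hu) (by
    rintro s rfl l hl
    exact ⟨ne_of_mem_completeVerts hu.1 (h.inner_subset hl),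
      fun ha => ⟨rfl, (h.adj_inner_iff hu hl).1 ha⟩⟩)
  rwa [show 0 + 1 + (n - 2) = n - 1 by omega] at this

/-- An edge `uv` would close `u, z 1, …, z (n - 1), v` into a hole with `n + 1` vertices, an odd
number. -/
theorem side_not_adj (h : G.IsFrame T z n) {u v : V} (hu : u ∈ G.sideVerts T z n)
    (hv : v ∈ G.sideVerts T (SimpleGraph.flip z n) n) : ¬ G.Adj u v := by
  intro huv
  have h4 := h.four_le
  have := (h.ip_left hu).close (w := v) (by
      rintro (h1 | h1)
      · exact huv.ne h1.symm
      · exact ne_of_mem_completeVerts hv.1 (h.inner_subset h1) rfl)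
    huv (h.adj_last hv).symm (by
      rintro s (rfl | hs) ha
      · exact Or.inl rfl
      · exact Or.inr ((h.adj_inner_iff' hv hs).1 ha.symm))
  have o := h.inClassA.odd_of_cyc this (by omega)
  have e := h.even_n
  rw [Nat.odd_iff] at o
  rw [Nat.even_iff] at e
  omega

theorem inner_conn (h : G.IsFrame T z n) : G.Conn (inner z n) := h.ip_inner.conn

theorem adj_inner_of_touches (h : G.IsFrame T z n) {v : V} (hv : v ∈ G.completeVerts T)
    (ht : G.Touches v (inner z n)) : ∃ i, 0 < i ∧ i < n ∧ G.Adj v (z i) := by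
  have := h.two_le
  rcases ht with ht | ⟨_, ⟨i, ⟨h1, h2⟩, rfl⟩, ha⟩
  · exact absurd hv (h.inner_subset ht).2
  · exact ⟨i, h1, by omega, ha⟩

/-- If `v` missed `b`, let `z j` be its last neighbour in the interior: the outer path `v, z j, …, z
(n - 1), b` has length `n + 1 - j`, so minimality of `n` gives `j = 1` and puts `v` in the first
side. -/
theorem mem_side_or_adj (h : G.IsFrame T z n) {v : V} (hv : v ∈ G.completeVerts T)
    (ht : G.Touches v (inner z n)) (hvA : v ∉ G.sideVerts T z n)
    (hvB : v ∉ G.sideVerts T (SimpleGraph.flip z n) n) :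
    ∀ b ∈ G.sideVerts T (SimpleGraph.flip z n) n, G.Adj v b := by
  classical
  intro b hb
  by_contra hvb
  have h4 := h.four_le
  obtain ⟨i, h1, h2, ha⟩ := h.adj_inner_of_touches hv ht
  have hj := Nat.findGreatest_spec (P := fun i => G.Adj v (z i)) (show i ≤ n - 1 by omega) ha
  have hjn := Nat.findGreatest_le (P := fun i => G.Adj v (z i)) (n - 1)
  have hjmax : ∀ k, Nat.findGreatest (fun i => G.Adj v (z i)) (n - 1) < k → k ≤ n - 1 →
      ¬ G.Adj v (z k) := fun k h1 h2 => Nat.findGreatest_is_greatest h1 h2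
  have hij := Nat.le_findGreatest (P := fun i => G.Adj v (z i)) (show i ≤ n - 1 by omega) ha
  generalize Nat.findGreatest (fun i => G.Adj v (z i)) (n - 1) = j at *
  have hvne : v ≠ b := by rintro rfl; exact hvB hb
  have p1 := (IP.single v).join (h.indPath.seg hjn (by omega)) hj (by
    rintro s rfl _ ⟨k, ⟨h3, h5⟩, rfl⟩
    refine ⟨ne_of_mem_completeVerts hv (h.outer k (by omega) (by omega)), fun ha => ⟨rfl, ?_⟩⟩
    by_contra hne
    exact hjmax k (lt_of_le_of_ne h3 (by rintro rfl; exact hne rfl)) h5 ha)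
  have p2 := p1.join (IP.single b) (h.adj_last hb).symm (by
    rintro s (rfl | ⟨k, ⟨h3, h5⟩, rfl⟩) s' rfl
    · exact ⟨hvne, fun ha => absurd ha hvb⟩
    · refine ⟨(ne_of_mem_completeVerts hb.1 (h.outer k (by omega) (by omega))).symm,
        fun ha => ⟨?_, rfl⟩⟩
      have := ((mem_sideVerts_flip.1 hb).2 k (by omega) (by omega)).1 ha.symm
      rw [this])
  have := h.shortest _ _ _ _ p2 (by omega) hv hb.1 (by
    rintro s ((rfl | ⟨k, ⟨h3, h5⟩, rfl⟩) | rfl) h6 h7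
    · exact absurd rfl h6
    · exact h.outer k (by omega) (by omega)
    · exact absurd rfl h7)
  have hj1 : j = 1 := by omega
  subst hj1
  refine hvA ⟨hv, fun k h3 h5 => ⟨fun ha => ?_, ?_⟩⟩
  · by_contra hne
    exact hjmax k (by omega) (by omega) ha
  · rintro rfl; exact hj

theorem mem_side_or_adj' (h : G.IsFrame T z n) {v : V} (hv : v ∈ G.completeVerts T)
    (ht : G.Touches v (inner z n)) (hvA : v ∉ G.sideVerts T z n)
    (hvB : v ∉ G.sideVerts T (SimpleGraph.flip z n) n) :
    ∀ a ∈ G.sideVerts T z n, G.Adj v a := by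
  have := h.flip.mem_side_or_adj hv (by rwa [inner_flip]) hvB (by rwa [sideVerts_flip_flip])
  rwa [sideVerts_flip_flip] at this

/-- A `T`-complete vertex attaching to the interior of the frame and with a non-neighbour on
each side, belongs to one of the sides. -/
theorem mem_sides (h : G.IsFrame T z n) {v u b : V} (hv : v ∈ G.completeVerts T)
    (ht : G.Touches v (inner z n)) (hu : u ∈ G.sideVerts T z n)
    (hb : b ∈ G.sideVerts T (SimpleGraph.flip z n) n) (hn : ¬ (G.Adj v u ∧ G.Adj v b)) :
    v ∈ G.sideVerts T z n ∨ v ∈ G.sideVerts T (SimpleGraph.flip z n) n := by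
  by_contra hcon
  rw [not_or] at hcon
  exact hn ⟨h.mem_side_or_adj' hv ht hcon.1 hcon.2 u hu, h.mem_side_or_adj hv ht hcon.1 hcon.2 b hb⟩

/-- An odd induced path from one side to the other has its second vertex on the first side or its
penultimate vertex on the second side. -/
theorem second_or_penultimate (h : G.IsFrame T z n) {p : ℕ → V} {m : ℕ} (hp : G.IndPath p m)
    (h0 : p 0 ∈ G.sideVerts T z n) (hm : p m ∈ G.sideVerts T (SimpleGraph.flip z n) n)
    (hodd : Odd m) : p 1 ∈ G.sideVerts T z n ∨
      p (m - 1) ∈ G.sideVerts T (SimpleGraph.flip z n) n := by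
  -- A `T`-complete internal vertex attached to the interior of the frame would be in a side, hence
  -- adjacent to an end of the path, hence second or penultimate. If there is none,
  -- `InClassA.even_of_attached` applies with `L` the interior.
  by_contra hcon
  rw [not_or] at hcon
  obtain ⟨hA, hB⟩ := hcon
  rw [Nat.odd_iff] at hodd
  have hm3 : 3 ≤ m := by
    by_contra hlt
    have e : m = 1 := by omega
    subst e
    exact h.side_not_adj h0 hm (hp.adj_succ (by omega))
  have h4 := h.four_le
  have h0m : ¬ G.Adj (p 0) (p m) := h.side_not_adj h0 hm
  have hno : ∀ i ≤ m, ¬ (G.Adj (p i) (p 0) ∧ G.Adj (p i) (p m)) := by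
    rintro i hi ⟨h1, h2⟩
    rw [hp.adj_iff (by omega) (by omega)] at h1 h2
    omega
  have hpT : ∀ i ≤ m, p i ∉ T :=
    fun i hi ht => hno i hi ⟨(h0.1.2 _ ht).symm, (hm.1.2 _ ht).symm⟩
  have hC : ∀ i, 0 < i → i < m → p i ∈ G.completeVerts T → ¬ G.Touches (p i) (inner z n) := by
    intro i h1 h2 hiC ht
    rcases h.mem_sides hiC ht h0 hm (hno i h2.le) with h5 | h5
    · have := h.side_clique h0 h5 (hp 0 i h1 h2.le).1
      rw [(hp 0 i h1 h2.le).2] at this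
      have e : i = 1 := by omega
      subst e
      exact hA h5
    · have := h.flip.side_clique h5 hm (hp i m h2 le_rfl).1
      rw [(hp i m h2 le_rfl).2] at this
      have e : i = m - 1 := by omega
      subst e
      exact hB h5
  have hO : ∀ i ≤ m, p i ∉ G.completeVerts T → p i ∈ G.outerVerts T := fun i hi h => ⟨hpT i hi, h⟩
  -- The two internal vertices cannot both be outer, by parity. If just one were, its two neighbours
  -- on the path would contradict the clique property.
  have h3 : m = 3 → p 1 ∈ G.completeVerts T ∧ p 2 ∈ G.completeVerts T := by
    rintro rfl
    have a01 := hp.adj_succ (i := 0) (by omega)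
    have a12 := hp.adj_succ (i := 1) (by omega)
    have a23 := hp.adj_succ (i := 2) (by omega)
    by_cases h1 : p 1 ∈ G.completeVerts T <;> by_cases h2 : p 2 ∈ G.completeVerts T
    · exact ⟨h1, h2⟩
    · have := h.clique _ (hO 2 (by omega) h2) _ h1 _ hm.1 a12.symm a23
        (hp 1 3 (by omega) (by omega)).1
      rw [(hp 1 3 (by omega) (by omega)).2] at this
      omega
    · have := h.clique _ (hO 1 (by omega) h1) _ h0.1 _ h2 a01.symm a12
        (hp 0 2 (by omega) (by omega)).1
      rw [(hp 0 2 (by omega) (by omega)).2] at this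
      omega
    · have := h.even _ _ _ _ hp.ip (by omega) h0.1 hm.1 (by
        rintro _ ⟨i, hi, rfl⟩ h5 h6
        simp only [Set.mem_Iic] at hi
        interval_cases i
        · exact absurd rfl h5
        · exact hO 1 (by omega) h1
        · exact hO 2 (by omega) h2
        · exact absurd rfl h6)
      rw [Nat.even_iff] at this
      omega
  rcases h.inClassA.even_of_attached h.conn h.even (p := p) (m := m)
    (fun i j h1 h2 => ⟨(hp i j h1 h2).1, fun _ => (hp i j h1 h2).2⟩) hm3 hpT h0.1 hm.1
    h.inner_conn h.inner_subset (mem_inner (i := 1) (by omega) (by omega))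
    (mem_inner (i := n - 1) (by omega) (by omega))
    (fun l hl => h.adj_inner_iff h0 hl) (fun l hl => h.adj_inner_iff' hm hl) hC h3
    (fun ha => absurd ha h0m) with h5 | h5
  · rw [Nat.even_iff] at h5; omega
  · exact h0m h5.1

end IsFrame

end SimpleGraph

namespace SimpleGraph

variable {V : Type*} {G : SimpleGraph V} {T : Set V} {z : ℕ → V} {n : ℕ}

/-! ### An exceptional hole at one side of a frame -/

theorem IndCycle.flip {c : ℕ → V} {m : ℕ} (h : G.IndCycle c m) :
    G.IndCycle (SimpleGraph.flip c m) m := by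
  intro a b hab hb
  obtain ⟨h1, h2⟩ := h (m - b) (m - a) (by omega) (by omega)
  simp only [SimpleGraph.flip]
  refine ⟨h1.symm, ?_⟩
  rw [G.adj_comm, h2]; omega

theorem IndCycle.conn_seg {c : ℕ → V} {m i j : ℕ} (h : G.IndCycle c m) (hj : j ≤ m) :
    G.Conn (c '' Set.Icc i j) :=
  Conn.of_seg fun k _ hk => (h k (k + 1) (by omega) (by omega)).2.2 (Or.inl rfl)

namespace IsFrame

theorem not_adj_one (h : G.IsFrame T z n) {b : V}
    (hb : b ∈ G.sideVerts T (SimpleGraph.flip z n) n) : ¬ G.Adj b (z 1) := by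
  have := h.four_le
  intro ha
  have := ((mem_sideVerts_flip.1 hb).2 1 (by omega) (by omega)).1 ha
  omega

/-- This refutes the exceptional outcomes of `InClassA.even_of_attached` for `L = {z 1}`. Replacing
`c 0` by `z 1` gives a second hole `c'`, whose only `T`-complete vertices are `c (m - 1)` and `c m`.
-/
theorem false_of_ends (h : G.IsFrame T z n) {c : ℕ → V} {m : ℕ} (hc : G.IndCycle c m)
    (hm : 3 ≤ m) (h0 : c 0 ∈ G.sideVerts T z n) (hmA : c m ∈ G.sideVerts T z n)
    (hz : ∀ i, 0 < i → i < m → (G.Touches (c i) {z 1} ↔ i = 1))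
    (hC : ∀ i, 0 < i → i < m → (c i ∈ G.completeVerts T ↔ i = m - 1)) : False := by
  classical
  have h4 := h.four_le
  have hG := h.inClassA
  have hmodd := hG.odd_of_cyc hc.cyc hm
  rw [Nat.odd_iff] at hmodd
  have hadj : ∀ i j, i ≤ m → j ≤ m → (G.Adj (c i) (c j) ↔
      j = i + 1 ∨ i = j + 1 ∨ (i = 0 ∧ j = m) ∨ (j = 0 ∧ i = m)) :=
    fun i j hi hj => hc.adj_iff hi hj (by omega)
  have hno : ∀ i ≤ m, ¬ (G.Adj (c i) (c 0) ∧ G.Adj (c i) (c m)) := by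
    rintro i hi ⟨h1, h2⟩
    rw [hadj _ _ (by omega) (by omega)] at h1 h2
    omega
  have hcT : ∀ i ≤ m, c i ∉ T :=
    fun i hi ht => hno i hi ⟨(h0.1.2 _ ht).symm, (hmA.1.2 _ ht).symm⟩
  have hO : ∀ i, 0 < i → i < m - 1 → c i ∈ G.outerVerts T := fun i h1 h2 =>
    ⟨hcT i (by omega), fun hi => by have := (hC i h1 (by omega)).1 hi; omega⟩
  have hm5 : 5 ≤ m := by
    by_contra hlt
    have e : m = 3 := by omega
    subst e
    have := h.clique _ (hO 1 (by omega) (by omega)) _ h0.1 _ ((hC 2 (by omega) (by omega)).2 rfl)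
      ((hadj _ _ (by omega) (by omega)).2 (by omega))
      ((hadj _ _ (by omega) (by omega)).2 (by omega)) (hc 0 2 (by omega) (by omega)).1
    rw [hadj _ _ (by omega) (by omega)] at this
    omega
  have hz1 : z 1 ∈ G.outerVerts T := h.outer 1 (by omega) (by omega)
  have hcz : ∀ i ≤ m, c i ≠ z 1 := by
    intro i hi e
    exact hno i hi ⟨e ▸ (h.adj_one h0).symm, e ▸ (h.adj_one hmA).symm⟩
  have hzadj : ∀ i, 0 < i → i < m → (G.Adj (c i) (z 1) ↔ i = 1) := by
    intro i h1 h2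
    rw [← hz i h1 h2]
    constructor
    · exact fun ha => Or.inr ⟨_, rfl, ha⟩
    · rintro (e | ⟨_, rfl, ha⟩)
      · exact absurd e (hcz i h2.le)
      · exact ha
  have hqC : c (m - 1) ∈ G.completeVerts T := (hC _ (by omega) (by omega)).2 rfl
  have hqt : ¬ G.Touches (c (m - 1)) (inner z n) := by
    intro ht
    have hq0 : ¬ G.Adj (c (m - 1)) (c 0) := by
      rw [hadj _ _ (by omega) (by omega)]; omega
    rcases h.mem_sides hqC ht h0 h.right_mem_side (fun h => hq0 h.1) with h5 | h5
    · exact hq0 (h.side_clique h5 h0 (hc 0 (m - 1) (by omega) (by omega)).1.symm)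
    · refine h.side_not_adj hmA h5 ?_
      rw [hadj _ _ (by omega) (by omega)]; omega
  -- the hole obtained by replacing `c 0` with `z 1`
  obtain ⟨c', hc'0, hc'i⟩ : ∃ c' : ℕ → V, c' 0 = z 1 ∧ ∀ i, 0 < i → c' i = c i :=
    ⟨fun i => if i = 0 then z 1 else c i, if_pos rfl, fun i hi => if_neg (by omega)⟩
  have hc' : G.IndCycle c' m := by
    intro i j hij hj
    rw [hc'i j (by omega)]
    rcases Nat.eq_zero_or_pos i with rfl | hi
    · rw [hc'0]
      refine ⟨(hcz j hj).symm, ?_⟩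
      rw [G.adj_comm]
      rcases hj.eq_or_lt with rfl | hj
      · exact iff_of_true (h.adj_one hmA) (by omega)
      · rw [hzadj j hij hj]; omega
    · rw [hc'i i hi]
      obtain ⟨h1, h2⟩ := hc i j hij hj
      exact ⟨h1, h2⟩
  have hcmi : ∀ l ∈ inner z n, G.Adj (c m) l ↔ l = z 1 := fun l hl => h.adj_inner_iff hmA hl
  have hc0i : ∀ l ∈ inner z n, G.Adj (c 0) l ↔ l = z 1 := fun l hl => h.adj_inner_iff h0 hl
  -- the vertices of the other side are adjacent to `c (m - 1)`
  have hB : ∀ b ∈ G.sideVerts T (SimpleGraph.flip z n) n, G.Adj (c (m - 1)) b := by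
    intro b hb
    by_contra hnb
    -- A non-neighbour `b`, together with the interior of the frame, would be linked to `c'` away
    -- from its unique `T`-complete edge.
    have hcyc := hc'.rotate (j := m - 1) (by omega)
    rw [Nat.sub_add_cancel (by omega), hc'i m (by omega), hc'i (m - 1) (by omega)] at hcyc
    have hmb := h.side_not_adj hmA hb
    refine hG.false_of_edge_link h.conn h.even hcyc hm hqC hmA.1 ?_ (L := {b} ∪ inner z n)
      ((Conn.single b).union h.inner_conn rfl (Or.inr ⟨_, mem_inner (by omega) (by omega),
        h.adj_last hb⟩)) ?_ ?_ ?_ ?_ ⟨b, Or.inl rfl, hb.1⟩ ?_ (by omega)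
    · rintro _ ⟨i, hi, rfl⟩ h1 h2
      simp only [Set.mem_Iic] at hi
      rcases Nat.eq_zero_or_pos i with rfl | hi0
      · rw [hc'0]; exact hz1
      · rw [hc'i i hi0] at h1 h2 ⊢
        have e1 : i ≠ m - 1 := by rintro rfl; exact h1 rfl
        have e2 : i ≠ m := by rintro rfl; exact h2 rfl
        exact hO i hi0 (by omega)
    · rintro l (rfl | hl)
      · exact hb.1.1
      · exact (h.inner_subset hl).1
    · rintro (e | e)
      · exact hmb (e ▸ (hadj m (m - 1) (by omega) (by omega)).2 (by omega))
      · exact (h.inner_subset e).2 hqC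
    · rintro (e | e)
      · exact h.side_ne hmA hb e
      · exact (h.inner_subset e).2 hmA.1
    · rintro l (rfl | hl) hlS
      · exact ⟨fun h => hnb h.symm, fun h => hmb h.symm⟩
      · refine ⟨fun ha => hqt (Or.inr ⟨l, hl, ha.symm⟩), fun ha => hlS ?_⟩
        rw [(hcmi l hl).1 ha.symm]
        exact ⟨0, by simp, hc'0⟩
    · refine ⟨z 1, ⟨0, by simp, hc'0⟩, (hcz _ (by omega)).symm, (hcz _ le_rfl).symm,
        Or.inl (Or.inr (mem_inner (by omega) (by omega)))⟩
  obtain ⟨b, hb⟩ : ∃ b, b ∈ G.sideVerts T (SimpleGraph.flip z n) n := ⟨_, h.right_mem_side⟩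
  have hqb := hB b hb
  have hZ2sub : z '' Set.Icc 2 (n - 1) ⊆ inner z n := by
    rintro _ ⟨i, ⟨h1, h2⟩, rfl⟩
    exact mem_inner (by omega) (by omega)
  have hz1Z2 : ∀ l ∈ z '' Set.Icc 2 (n - 1), l ≠ z 1 := by
    rintro _ ⟨i, ⟨h1, h2⟩, rfl⟩
    exact (h.indPath 1 i (by omega) (by omega)).1.symm
  have hZ2conn : G.Conn (z '' Set.Icc 2 (n - 1)) := Conn.of_seg
    fun k _ hk => h.indPath.adj_succ (by omega)
  have hz2 : z 2 ∈ z '' Set.Icc 2 (n - 1) := ⟨2, ⟨le_rfl, by omega⟩, rfl⟩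
  have hz12 : G.Adj (z 1) (z 2) := h.indPath.adj_succ (by omega)
  have hc1O : c 1 ∈ G.outerVerts T := hO 1 (by omega) (by omega)
  have hc01 : G.Adj (c 0) (c 1) := (hadj _ _ (by omega) (by omega)).2 (by omega)
  have hc12 : G.Adj (c 1) (c 2) := (hadj _ _ (by omega) (by omega)).2 (by omega)
  have h0b := h.side_not_adj h0 hb
  have hc1b : ¬ G.Adj (c 1) b := fun ha =>
    h0b (h.clique _ hc1O _ h0.1 _ hb.1 hc01.symm ha (h.side_ne h0 hb))
  have hbz1 := h.not_adj_one hb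
  -- Otherwise an induced path from `c (m - 1)` to `z 1` with outer interior extends by `c 0` to an
  -- outer path and is closed by `c m` into a hole. For its length `ℓ`, both `ℓ + 1` and `ℓ + 2`
  -- would be even.
  have hfar : ∀ i, 2 ≤ i → i ≤ m - 2 → ¬ G.Touches (c i) (z '' Set.Icc 2 (n - 1)) := by
    intro i hi1 hi2 ht
    have hX := (hc.conn_seg (i := 2) (j := m - 2) (by omega)).union hZ2conn
      ⟨i, ⟨hi1, hi2⟩, rfl⟩ ht
    obtain ⟨F, f, f', e, hF, hFX, hf, hf', hFf, hFf'⟩ :=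
      hX.exists_ip (fun l => G.Adj (c (m - 1)) l) (fun l => G.Adj l (z 1))
        ⟨c (m - 2), Or.inl ⟨m - 2, ⟨by omega, le_rfl⟩, rfl⟩,
          (hadj _ _ (by omega) (by omega)).2 (by omega)⟩ ⟨z 2, Or.inr hz2, hz12.symm⟩
    have hFO : ∀ l ∈ F, l ∈ G.outerVerts T := by
      intro l hl
      rcases hFX hl with ⟨j, ⟨h1, h2⟩, rfl⟩ | hl
      · exact hO j (by omega) (by omega)
      · exact h.inner_subset (hZ2sub hl)
    have hFz : ∀ l ∈ F, l ≠ z 1 := by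
      intro l hl
      rcases hFX hl with ⟨j, ⟨h1, h2⟩, rfl⟩ | hl
      · exact hcz j (by omega)
      · exact hz1Z2 l hl
    have hF0 : ∀ l ∈ F, ¬ G.Adj l (c 0) := by
      intro l hl ha
      rcases hFX hl with ⟨j, ⟨h1, h2⟩, rfl⟩ | hl
      · rw [hadj _ _ (by omega) (by omega)] at ha; omega
      · exact hz1Z2 l hl ((hc0i l (hZ2sub hl)).1 ha.symm)
    have hFm : ∀ l ∈ F, ¬ G.Adj l (c m) := by
      intro l hl ha
      rcases hFX hl with ⟨j, ⟨h1, h2⟩, rfl⟩ | hl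
      · rw [hadj _ _ (by omega) (by omega)] at ha; omega
      · exact hz1Z2 l hl ((hcmi l (hZ2sub hl)).1 ha.symm)
    have p1 := ((IP.single (c (m - 1))).join hF hf (by
      rintro s rfl l hl
      exact ⟨ne_of_mem_completeVerts hqC (hFO l hl), fun ha => ⟨rfl, hFf l hl ha⟩⟩)).join
        (IP.single (z 1)) hf' (by
      rintro s (rfl | hs) _ rfl
      · refine ⟨hcz _ (by omega), fun ha => ?_⟩
        have := (hzadj _ (by omega) (by omega)).1 ha
        omega
      · exact ⟨hFz s hs, fun ha => ⟨hFf' s hs ha, rfl⟩⟩)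
    have p2 := p1.join (IP.single (c 0)) (h.adj_one h0).symm (by
      rintro s ((rfl | hs) | rfl) _ rfl
      · refine ⟨(hc 0 _ (by omega) (by omega)).1.symm, fun ha => ?_⟩
        rw [hadj _ _ (by omega) (by omega)] at ha
        omega
      · exact ⟨(ne_of_mem_completeVerts h0.1 (hFO s hs)).symm, fun ha => absurd ha (hF0 s hs)⟩
      · exact ⟨(hcz 0 (by omega)).symm, fun _ => ⟨rfl, rfl⟩⟩)
    have ev := h.even _ _ _ _ p2 (by omega) hqC h0.1 (by
      rintro s (((rfl | hs) | rfl) | rfl) h1 h2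
      · exact absurd rfl h1
      · exact hFO s hs
      · exact hz1
      · exact absurd rfl h2)
    have od := hG.odd_of_cyc (p1.close (w := c m) (by
      rintro ((e | hs) | e)
      · exact (hc (m - 1) m (by omega) le_rfl).1 (Set.mem_singleton_iff.1 e).symm
      · exact (hFO _ hs).2 hmA.1
      · exact hcz m le_rfl e)
      ((hadj _ _ (by omega) (by omega)).2 (by omega)) (h.adj_one hmA).symm (by
      rintro s ((rfl | hs) | rfl) ha
      · exact Or.inl rfl
      · exact absurd ha (hFm s hs)
      · exact Or.inr rfl)) (by omega)
    rw [Nat.even_iff] at ev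
    rw [Nat.odd_iff] at od
    omega
  -- If `c 1` sees some `z j` with `j ≥ 2`, take the last one: `c 0, c 1, z j, …, z (n - 1), b` has
  -- length `n + 2 - j`, so `j = 2`. Then `z 2` forms a triangle with the edge `z 1, c 1` of `c'`
  -- and is linked to `c (m - 1)` by the rest of the interior and `b`.
  by_cases ht1 : G.Touches (c 1) (z '' Set.Icc 2 (n - 1))
  · have hc1n : ∃ i, 2 ≤ i ∧ i ≤ n - 1 ∧ G.Adj (c 1) (z i) := by
      rcases ht1 with ht1 | ⟨_, ⟨i, ⟨h1, h2⟩, rfl⟩, ha⟩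
      · exact absurd (Or.inr ⟨_, ht1, hc12.symm⟩) (hfar 2 le_rfl (by omega))
      · exact ⟨i, h1, h2, ha⟩
    obtain ⟨i, hi2, hin, hia⟩ := hc1n
    have hj := Nat.findGreatest_spec (P := fun i => G.Adj (c 1) (z i)) hin hia
    have hjn := Nat.findGreatest_le (P := fun i => G.Adj (c 1) (z i)) (n - 1)
    have hjmax : ∀ k, Nat.findGreatest (fun i => G.Adj (c 1) (z i)) (n - 1) < k → k ≤ n - 1 →
        ¬ G.Adj (c 1) (z k) := fun k h1 h2 => Nat.findGreatest_is_greatest h1 h2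
    have hij := Nat.le_findGreatest (P := fun i => G.Adj (c 1) (z i)) hin hia
    generalize Nat.findGreatest (fun i => G.Adj (c 1) (z i)) (n - 1) = j at *
    have hc1z : ∀ k, j ≤ k → k ≤ n - 1 → c 1 ≠ z k := by
      rintro k h1 h2 e
      exact hfar 2 le_rfl (by omega) (Or.inr ⟨z k, ⟨k, ⟨by omega, h2⟩, rfl⟩, e ▸ hc12.symm⟩)
    have p1 := (((IP.single (c 0)).join (IP.single (c 1)) hc01 (by
      rintro _ rfl _ rfl
      exact ⟨hc01.ne, fun _ => ⟨rfl, rfl⟩⟩)).join (h.indPath.seg hjn (by omega)) hj (by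
      rintro s (rfl | rfl) _ ⟨k, ⟨h1, h2⟩, rfl⟩
      · have hk : z k ∈ inner z n := mem_inner (by omega) (by omega)
        refine ⟨ne_of_mem_completeVerts h0.1 (h.inner_subset hk), fun ha => ?_⟩
        exact absurd ((hc0i _ hk).1 ha) (hz1Z2 _ ⟨k, ⟨by omega, h2⟩, rfl⟩)
      · refine ⟨hc1z k h1 h2, fun ha => ⟨rfl, ?_⟩⟩
        by_contra hne
        exact hjmax k (lt_of_le_of_ne h1 (by rintro rfl; exact hne rfl)) h2 ha)).join
        (IP.single b) (h.adj_last hb).symm (by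
      rintro s ((rfl | rfl) | ⟨k, ⟨h1, h2⟩, rfl⟩) _ rfl
      · exact ⟨h.side_ne h0 hb, fun ha => absurd ha h0b⟩
      · exact ⟨(ne_of_mem_completeVerts hb.1 hc1O).symm, fun ha => absurd ha hc1b⟩
      · have hk : z k ∈ inner z n := mem_inner (by omega) (by omega)
        exact ⟨(ne_of_mem_completeVerts hb.1 (h.inner_subset hk)).symm,
          fun ha => ⟨(h.adj_inner_iff' hb hk).1 ha.symm, rfl⟩⟩)
    have hlen := h.shortest _ _ _ _ p1 (by omega) h0.1 hb.1 (by
      rintro s (((rfl | rfl) | ⟨k, ⟨h1, h2⟩, rfl⟩) | rfl) h5 h6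
      · exact absurd rfl h5
      · exact hc1O
      · exact h.outer k (by omega) (by omega)
      · exact absurd rfl h6)
    have hj2 : j = 2 := by omega
    subst hj2
    have hcyc := hc'.rotate (j := 0) (by omega)
    rw [hc'0, zero_add, hc'i 1 (by omega)] at hcyc
    refine hG.false_of_triangle_link hcyc hm (d := z 2) hz12.symm hj.symm ?_
      (L := z '' Set.Icc 2 (n - 1) ∪ {b})
      (hZ2conn.union (Conn.single b) (s := z (n - 1)) ⟨n - 1, ⟨by omega, le_rfl⟩, rfl⟩
        (Or.inr ⟨b, rfl, (h.adj_last hb).symm⟩)) (Or.inl hz2) ?_ ?_ ?_ ?_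
    · rintro _ ⟨k, hk, rfl⟩ h1 h2
      simp only [Set.mem_Iic] at hk
      rcases Nat.eq_zero_or_pos k with rfl | hk0
      · exact absurd hc'0 h1
      rw [hc'i k hk0] at h1 h2 ⊢
      have hk1 : k ≠ 1 := by rintro rfl; exact h2 rfl
      by_cases hkm2 : k ≤ m - 2
      · have := hfar k (by omega) hkm2
        exact ⟨fun e => this (Or.inl (e ▸ hz2)), fun ha => this (Or.inr ⟨_, hz2, ha.symm⟩)⟩
      · rcases hk.eq_or_lt with rfl | hk
        · refine ⟨(ne_of_mem_completeVerts hmA.1 (h.inner_subset (hZ2sub hz2))).symm,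
            fun ha => hz1Z2 _ hz2 ((hcmi _ (hZ2sub hz2)).1 ha.symm)⟩
        · have e : k = m - 1 := by omega
          subst e
          exact ⟨(ne_of_mem_completeVerts hqC (h.inner_subset (hZ2sub hz2))).symm,
            fun ha => hqt (Or.inr ⟨_, hZ2sub hz2, ha.symm⟩)⟩
    · rintro (e | e)
      · exact hz1Z2 _ e rfl
      · exact hz1.2 (by rw [Set.mem_singleton_iff.1 e]; exact hb.1)
    · rintro (⟨k, ⟨h1, h2⟩, e⟩ | e)
      · exact hc1z k h1 h2 e.symm
      · exact hc1O.2 (by rw [Set.mem_singleton_iff.1 e]; exact hb.1)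
    · rintro l (⟨k, ⟨h1, h2⟩, rfl⟩ | rfl) h5 -
      · have hk2 : k ≠ 2 := by rintro rfl; exact h5 rfl
        refine ⟨fun ha => ?_, fun ha => hjmax k (by omega) h2 ha.symm⟩
        rw [h.indPath.adj_iff (by omega) (by omega)] at ha
        omega
      · exact ⟨hbz1, fun ha => hc1b ha.symm⟩
    · refine ⟨c (m - 1), ⟨m - 1, by simp, hc'i _ (by omega)⟩, hcz _ (by omega),
        (hc 1 (m - 1) (by omega) (by omega)).1.symm, Or.inr ⟨b, Or.inr rfl, hqb⟩⟩
  -- If `c 1` sees none of them, a hole passes through `z 1, c 1, c 2`, and on it `c 0` sees only `z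
  -- 1` and `c 1`. These two must cover `T`, while `b` misses both.
  · have hX := ((hc.conn_seg (i := 2) (j := m - 1) (by omega)).union (Conn.single b)
      ⟨m - 1, ⟨by omega, le_rfl⟩, rfl⟩ (Or.inr ⟨b, rfl, hqb⟩)).union hZ2conn (s := b) (Or.inr rfl)
      (Or.inr ⟨z (n - 1), ⟨n - 1, ⟨by omega, le_rfl⟩, rfl⟩, h.adj_last hb⟩)
    obtain ⟨F, f, f', e, hF, hFX, hf, hf', hFf, hFf'⟩ :=
      hX.exists_ip (fun l => G.Adj (c 1) l) (fun l => G.Adj l (z 1))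
        ⟨c 2, Or.inl (Or.inl ⟨2, ⟨le_rfl, by omega⟩, rfl⟩), hc12⟩ ⟨z 2, Or.inr hz2, hz12.symm⟩
    have hXc1 : ∀ l ∈ F, c 1 ≠ l ∧ (G.Adj (c 1) l → l = c 2) := by
      intro l hl
      rcases hFX hl with (⟨j, ⟨h1, h2⟩, rfl⟩ | rfl) | hl
      · refine ⟨(hc 1 j (by omega) (by omega)).1, fun ha => ?_⟩
        rw [hadj _ _ (by omega) (by omega)] at ha
        rw [show j = 2 by omega]
      · exact ⟨(ne_of_mem_completeVerts hb.1 hc1O).symm, fun ha => absurd ha hc1b⟩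
      · exact ⟨fun e => ht1 (Or.inl (e ▸ hl)), fun ha => absurd (Or.inr ⟨l, hl, ha⟩) ht1⟩
    have hXz : ∀ l ∈ F, z 1 ≠ l := by
      intro l hl
      rcases hFX hl with (⟨j, ⟨h1, h2⟩, rfl⟩ | rfl) | hl
      · exact (hcz j (by omega)).symm
      · exact (ne_of_mem_completeVerts hb.1 hz1).symm
      · exact (hz1Z2 l hl).symm
    have hXc0 : ∀ l ∈ F, c 0 ≠ l ∧ ¬ G.Adj (c 0) l := by
      intro l hl
      rcases hFX hl with (⟨j, ⟨h1, h2⟩, rfl⟩ | rfl) | hl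
      · refine ⟨(hc 0 j (by omega) (by omega)).1, fun ha => ?_⟩
        rw [hadj _ _ (by omega) (by omega)] at ha
        omega
      · exact ⟨h.side_ne h0 hb, h0b⟩
      · exact ⟨ne_of_mem_completeVerts h0.1 (h.inner_subset (hZ2sub hl)),
          fun ha => hz1Z2 l hl ((hc0i l (hZ2sub hl)).1 ha)⟩
    have hf2 : f = c 2 := (hXc1 f hF.left_mem).2 hf
    have hff' : f ≠ f' := by
      rintro rfl
      rw [hf2, hzadj 2 (by omega) (by omega)] at hf'
      omega
    have he : 1 ≤ e := by
      obtain ⟨q, rfl, rfl, -, -⟩ := hF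
      by_contra hcon
      have : e = 0 := by omega
      subst this
      exact hff' rfl
    have hc1z1 : G.Adj (c 1) (z 1) := (hzadj 1 (by omega) (by omega)).2 rfl
    have hcyc := ((IP.single (c 1)).join hF hf (by
      rintro _ rfl l hl
      exact ⟨(hXc1 l hl).1, fun ha => ⟨rfl, hFf l hl ha⟩⟩)).close (w := z 1) (by
      rintro (e | e)
      · exact hcz 1 (by omega) (Set.mem_singleton_iff.1 e).symm
      · exact hXz _ e rfl) hc1z1 hf' (by
      rintro s (rfl | hs) ha
      · exact Or.inl rfl
      · exact Or.inr (hFf' s hs ha))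
    -- A vertex `t` of `T` missing both would link `c 0` to `c 2` along `t, c (m - 1), …, c 3`.
    have hcov : ∀ t ∈ T, G.Adj (c 1) t ∨ G.Adj (z 1) t := by
      intro t ht
      by_contra hcon
      rw [not_or] at hcon
      refine hG.false_of_triangle_link hcyc (by omega) (d := c 0) hc01 (h.adj_one h0) ?_
        (L := {c 0} ∪ ({t} ∪ c '' Set.Icc 3 (m - 1)))
        ((Conn.single (c 0)).union ((Conn.single t).union (hc.conn_seg (by omega)) rfl
          (Or.inr ⟨c (m - 1), ⟨m - 1, ⟨by omega, le_rfl⟩, rfl⟩, (hqC.2 t ht).symm⟩)) rfl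
          (Or.inr ⟨t, Or.inl rfl, h0.1.2 t ht⟩)) (Or.inl rfl) ?_ ?_ ?_ ?_
      · rintro s ((rfl | hs) | rfl) h1 h2
        · exact absurd rfl h1
        · exact hXc0 s hs
        · exact absurd rfl h2
      · rintro (e | e | ⟨k, ⟨h1, h2⟩, e⟩)
        · exact hc01.ne (Set.mem_singleton_iff.1 e).symm
        · exact hcT 1 (by omega) (by rw [Set.mem_singleton_iff.1 e]; exact ht)
        · exact (hc 1 k (by omega) (by omega)).1 e.symm
      · rintro (e | e | ⟨k, ⟨h1, h2⟩, e⟩)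
        · exact hcz 0 (by omega) (Set.mem_singleton_iff.1 e).symm
        · exact hz1.1 (by rw [Set.mem_singleton_iff.1 e]; exact ht)
        · exact hcz k (by omega) e
      · rintro l (rfl | rfl | ⟨k, ⟨h1, h2⟩, rfl⟩) h5 -
        · exact absurd rfl h5
        · exact ⟨fun ha => hcon.1 ha.symm, fun ha => hcon.2 ha.symm⟩
        · refine ⟨fun ha => ?_, fun ha => ?_⟩
          · rw [hadj _ _ (by omega) (by omega)] at ha; omega
          · rw [hzadj _ (by omega) (by omega)] at ha; omega
      · refine ⟨c 2, Or.inl (Or.inr (hf2 ▸ hF.left_mem)), hc12.ne.symm, hcz 2 (by omega),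
          Or.inr ⟨c 3, Or.inr (Or.inr ⟨3, ⟨le_rfl, by omega⟩, rfl⟩), ?_⟩⟩
        rw [hadj _ _ (by omega) (by omega)]; omega
    exact hG.false_of_cover h.conn hc1O.1 hz1.1 hc1z1 hcov
      (exists_not_adj_of_mem_outerVerts hc1O) (exists_not_adj_of_mem_outerVerts hz1) hb.1
      (ne_of_mem_completeVerts hb.1 hc1O) (ne_of_mem_completeVerts hb.1 hz1)
      (fun ha => hc1b ha.symm) hbz1

end IsFrame

end SimpleGraph

namespace SimpleGraph

variable {V : Type*} {G : SimpleGraph V} {T : Set V} {z : ℕ → V} {n : ℕ}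

/-! ### Extremal vertices of the sides -/

namespace IsFrame

/-- The fourth vertex of a 4-hole with three `T`-complete vertices has two non-adjacent `T`-complete
neighbours, so it is not outer. This provides the hypothesis of `InClassA.even_of_attached` for `m =
3`. -/
theorem mem_completeVerts_of_four (h : G.IsFrame T z n) {c : ℕ → V} {k : ℕ}
    (hc : G.IndCycle c 3) (hcT : ∀ i ≤ 3, c i ∉ T) (h0 : c 0 ∈ G.completeVerts T)
    (h3 : c 3 ∈ G.completeVerts T) (hk0 : 0 < k) (hk3 : k < 3) (hk : c k ∈ G.completeVerts T) :
    c 1 ∈ G.completeVerts T ∧ c 2 ∈ G.completeVerts T := by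
  have hadj : ∀ i j, i ≤ 3 → j ≤ 3 → (G.Adj (c i) (c j) ↔
      j = i + 1 ∨ i = j + 1 ∨ (i = 0 ∧ j = 3) ∨ (j = 0 ∧ i = 3)) :=
    fun i j hi hj => hc.adj_iff hi hj (by omega)
  have key : ∀ i j l, i ≤ 3 → j ≤ 3 → l ≤ 3 → c j ∈ G.completeVerts T →
      c l ∈ G.completeVerts T → G.Adj (c i) (c j) → G.Adj (c i) (c l) → c j ≠ c l →
      ¬ G.Adj (c j) (c l) → c i ∈ G.completeVerts T := by
    intro i j l hi _ _ hj hl h1 h2 h3 h4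
    by_contra hcon
    exact h4 (h.clique _ ⟨hcT i hi, hcon⟩ _ hj _ hl h1 h2 h3)
  have hk' : k = 1 ∨ k = 2 := by omega
  rcases hk' with rfl | rfl
  · refine ⟨hk, key 2 1 3 (by omega) (by omega) (by omega) hk h3 ?_ ?_ ?_ ?_⟩
    · rw [hadj _ _ (by omega) (by omega)]; omega
    · rw [hadj _ _ (by omega) (by omega)]; omega
    · exact (hc 1 3 (by omega) (by omega)).1
    · rw [hadj _ _ (by omega) (by omega)]; omega
  · refine ⟨key 1 0 2 (by omega) (by omega) (by omega) h0 hk ?_ ?_ ?_ ?_, hk⟩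
    · rw [hadj _ _ (by omega) (by omega)]; omega
    · rw [hadj _ _ (by omega) (by omega)]; omega
    · exact (hc 0 2 (by omega) (by omega)).1
    · rw [hadj _ _ (by omega) (by omega)]; omega

/-- The vertices `u`, `u'` and a path of `W` form a hole through the edge `uu'`, with `z 1` adjacent
to both. If `z 1` saw nothing else on it, there would be a linked triangle; if nothing else on it
were `T`-complete, a linked edge. So `InClassA.even_of_attached` applies with `L = {z 1}`, and
`false_of_ends` removes its exceptional outcomes. -/
theorem false_of_linked_side (h : G.IsFrame T z n) {u u' q r b : V} {W : Set V}
    (hu : u ∈ G.sideVerts T z n) (hu' : u' ∈ G.sideVerts T z n) (huu : u ≠ u') (hW : G.Conn W)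
    (huW : u ∉ W) (huW' : u' ∉ W) (hq : q ∈ W) (hr : r ∈ W) (hqr : q ≠ r)
    (hWq : ∀ l ∈ W, G.Adj u l ↔ l = q) (hWr : ∀ l ∈ W, G.Adj u' l ↔ l = r) (hbW : b ∈ W)
    (hb : b ∈ G.sideVerts T (SimpleGraph.flip z n) n) : False := by
  have hG := h.inClassA
  have h4 := h.four_le
  have hboth : ∀ l ∈ W, ¬ (G.Adj u l ∧ G.Adj u' l) := fun l hl ⟨h1, h2⟩ =>
    hqr (((hWq l hl).1 h1).symm.trans ((hWr l hl).1 h2))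
  have hWT : ∀ l ∈ W, l ∉ T := fun l hl ht => hboth l hl ⟨hu.1.2 l ht, hu'.1.2 l ht⟩
  have hz1W : z 1 ∉ W := fun hz => hboth _ hz ⟨h.adj_one hu, h.adj_one hu'⟩
  have hz1 : z 1 ∈ G.outerVerts T := h.outer 1 (by omega) (by omega)
  have huu' : G.Adj u u' := h.side_clique hu hu' huu
  obtain ⟨F, f, f', e, hF, hFW, hf, hf', hFf, hFf'⟩ :=
    hW.exists_ip (fun l => G.Adj u l) (fun l => G.Adj u' l) ⟨q, hq, (hWq q hq).2 rfl⟩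
      ⟨r, hr, (hWr r hr).2 rfl⟩
  obtain rfl : f = q := (hWq f (hFW hF.left_mem)).1 hf
  obtain rfl : f' = r := (hWr f' (hFW hF.right_mem)).1 hf'
  have hcyc := ((IP.single u).join hF hf (by
    rintro s rfl l hl
    exact ⟨fun e => huW (e ▸ hFW hl), fun ha => ⟨rfl, hFf l hl ha⟩⟩)).close (w := u') (by
      rintro (e | hl)
      · exact huu e.symm
      · exact huW' (hFW hl)) huu' hf'.symm (by
      rintro s (rfl | hs) ha
      · exact Or.inl rfl
      · exact Or.inr (hFf' s hs ha.symm))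
  have he : 1 ≤ e := by
    by_contra hlt
    have e0 : e = 0 := by omega
    subst e0
    obtain ⟨p, rfl, rfl, -, -⟩ := hF
    exact hqr rfl
  have hm : 3 ≤ 0 + 1 + e + 1 := by omega
  generalize 0 + 1 + e + 1 = m at *
  have hSF : ∀ s ∈ {u} ∪ F ∪ {u'}, s ≠ u → s ≠ u' → s ∈ F := by
    rintro s ((rfl | hs) | rfl) h1 h2
    · exact absurd rfl h1
    · exact hs
    · exact absurd rfl h2
  have hWa : ∀ l ∈ W, l ∉ {u} ∪ F ∪ {u'} → ¬ G.Adj l u ∧ ¬ G.Adj l u' := by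
    intro l hl hlS
    refine ⟨fun ha => hlS (Or.inl (Or.inr ?_)), fun ha => hlS (Or.inl (Or.inr ?_))⟩
    · rw [(hWq l hl).1 ha.symm]; exact hF.left_mem
    · rw [(hWr l hl).1 ha.symm]; exact hF.right_mem
  have hfu : f ≠ u := fun e => huW (e ▸ hq)
  have hfu' : f ≠ u' := fun e => huW' (e ▸ hq)
  have hfS : f ∈ {u} ∪ F ∪ {u'} := Or.inl (Or.inr hF.left_mem)
  have hzF : ∃ l ∈ F, G.Adj (z 1) l := by
    by_contra hno
    push Not at hno
    refine hG.false_of_triangle_link hcyc hm (h.adj_one hu).symm (h.adj_one hu').symm ?_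
      (hW.union h.inner_conn hbW (Or.inr ⟨_, mem_inner (by omega) (by omega), h.adj_last hb⟩))
      (Or.inr (mem_inner (by omega) (by omega))) ?_ ?_ ?_
      ⟨f, hfS, hfu, hfu', Or.inl (Or.inl hq)⟩
    · intro s hs h1 h2
      have := hSF s hs h1 h2
      exact ⟨fun e => hz1W (e ▸ hFW this), hno s this⟩
    · rintro (hl | hl)
      · exact huW hl
      · exact ne_of_mem_completeVerts hu.1 (h.inner_subset hl) rfl
    · rintro (hl | hl)
      · exact huW' hl
      · exact ne_of_mem_completeVerts hu'.1 (h.inner_subset hl) rfl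
    · rintro l (hl | hl) hlz hlS
      · exact hWa l hl hlS
      · exact ⟨fun ha => hlz ((h.adj_inner_iff hu hl).1 ha.symm),
          fun ha => hlz ((h.adj_inner_iff hu' hl).1 ha.symm)⟩
  have hCF : ∃ l ∈ F, l ∈ G.completeVerts T := by
    by_contra hno
    push Not at hno
    refine hG.false_of_edge_link h.conn h.even hcyc hm hu.1 hu'.1
      (fun s hs h1 h2 => ⟨hWT s (hFW (hSF s hs h1 h2)), hno s (hSF s hs h1 h2)⟩) hW hWT huW huW'
      hWa ⟨b, hbW, hb.1⟩ ⟨f, hfS, hfu, hfu', Or.inl hq⟩ ?_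
    intro _ l hl hlC
    refine ⟨f, hfS, hfu, hfu', fun ha => ?_⟩
    have hfO : f ∈ G.outerVerts T := ⟨hWT f hq, hno f hF.left_mem⟩
    have := h.clique f hfO l hlC u hu.1 ha.symm hf.symm (fun e => huW (e ▸ hl))
    exact hno f hF.left_mem ((hWq l hl).1 this.symm ▸ hlC)
  have hmodd := hG.odd_of_cyc hcyc hm
  obtain ⟨c, hc0, hcm, hSc, hc⟩ := hcyc
  have hadj : ∀ i j, i ≤ m → j ≤ m → (G.Adj (c i) (c j) ↔
      j = i + 1 ∨ i = j + 1 ∨ (i = 0 ∧ j = m) ∨ (j = 0 ∧ i = m)) :=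
    fun i j hi hj => hc.adj_iff hi hj (by omega)
  have hcF : ∀ i, 0 < i → i < m → c i ∈ F := by
    intro i h1 h2
    refine hSF _ (hSc ▸ ⟨i, h2.le, rfl⟩) ?_ ?_
    · rw [← hc0]; exact (hc 0 i h1 h2.le).1.symm
    · rw [← hcm]; exact (hc i m h2 le_rfl).1
  have hFc : ∀ l ∈ F, ∃ i, 0 < i ∧ i < m ∧ c i = l := by
    intro l hl
    obtain ⟨i, hi, rfl⟩ : l ∈ c '' Set.Iic m := hSc ▸ Or.inl (Or.inr hl)
    refine ⟨i, Nat.pos_of_ne_zero ?_, lt_of_le_of_ne hi ?_, rfl⟩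
    · rintro rfl; exact huW (hc0 ▸ hFW hl)
    · rintro rfl; exact huW' (hcm ▸ hFW hl)
  have hcu : c 0 ∈ G.sideVerts T z n := hc0 ▸ hu
  have hcu' : c m ∈ G.sideVerts T z n := hcm ▸ hu'
  have hno : ∀ i ≤ m, ¬ (G.Adj (c i) (c 0) ∧ G.Adj (c i) (c m)) := by
    rintro i hi ⟨h1, h2⟩
    rw [hadj _ _ (by omega) (by omega)] at h1 h2
    omega
  have hcT : ∀ i ≤ m, c i ∉ T := fun i hi ht =>
    hno i hi ⟨(hcu.1.2 _ ht).symm, (hcu'.1.2 _ ht).symm⟩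
  have hC : ∀ i, 0 < i → i < m → c i ∈ G.completeVerts T → ¬ G.Touches (c i) {z 1} := by
    intro i h1 h2 hiC ht
    have hiz : G.Adj (c i) (z 1) := by
      rcases ht with e | ⟨_, rfl, ha⟩
      · exact absurd hz1 (by rintro hz; exact hz.2 (e ▸ hiC))
      · exact ha
    refine hno i h2.le ?_
    by_cases hiA : c i ∈ G.sideVerts T z n
    · exact ⟨h.side_clique hiA hcu (hc 0 i h1 h2.le).1.symm,
        h.side_clique hiA hcu' (hc i m h2 le_rfl).1⟩
    · have := h.mem_side_or_adj' hiC (Or.inr ⟨_, mem_inner (by omega) (by omega), hiz⟩) hiA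
        (fun hB => h.not_adj_one hB hiz)
      exact ⟨this _ hcu, this _ hcu'⟩
  obtain ⟨k, hk0, hkm, hkC⟩ : ∃ i, 0 < i ∧ i < m ∧ c i ∈ G.completeVerts T := by
    obtain ⟨l, hl, hlC⟩ := hCF
    obtain ⟨i, h1, h2, rfl⟩ := hFc l hl
    exact ⟨i, h1, h2, hlC⟩
  have h3 : m = 3 → c 1 ∈ G.completeVerts T ∧ c 2 ∈ G.completeVerts T := by
    rintro rfl
    exact h.mem_completeVerts_of_four hc hcT hcu.1 hcu'.1 hk0 hkm hkC
  have hsing : ∀ v, v ∈ G.sideVerts T z n → ∀ l ∈ ({z 1} : Set V), G.Adj v l ↔ l = z 1 := by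
    rintro v hv l rfl
    exact iff_of_true (h.adj_one hv) rfl
  rcases hG.even_of_attached h.conn h.even (p := c) (m := m)
    (fun i j h1 h2 => ⟨(hc i j h1 h2).1, fun h3 => (hc i j h1 h2).2.trans (by omega)⟩) hm hcT
    hcu.1 hcu'.1 (Conn.single (z 1)) (by rintro _ rfl; exact hz1) rfl rfl (hsing _ hcu)
    (hsing _ hcu') hC h3 (fun _ => ⟨⟨_, rfl⟩, by
      obtain ⟨l, hl, ha⟩ := hzF
      obtain ⟨i, h1, h2, rfl⟩ := hFc l hl
      exact ⟨i, h1, h2, Or.inr ⟨_, rfl, ha.symm⟩⟩, k, hk0, hkm, hkC⟩) with hev | ⟨-, hbad | hbad⟩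
  · rw [Nat.odd_iff] at hmodd
    rw [Nat.even_iff] at hev
    omega
  · exact h.false_of_ends hc hm hcu hcu' (fun i h1 h2 => (hbad i h1 h2).2)
      (fun i h1 h2 => (hbad i h1 h2).1)
  · refine h.false_of_ends hc.flip hm (by simpa [SimpleGraph.flip] using hcu')
      (by simpa [SimpleGraph.flip] using hcu) ?_ ?_
    · intro i h1 h2
      simp only [SimpleGraph.flip]
      rw [(hbad (m - i) (by omega) (by omega)).2]; omega
    · intro i h1 h2
      simp only [SimpleGraph.flip]
      rw [(hbad (m - i) (by omega) (by omega)).1]; omega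

end IsFrame

/-- The vertices reachable from `B` without using `u` and its neighbours. -/
def farVerts (G : SimpleGraph V) (B : Set V) (u : V) : Set V :=
  {v | ∃ b ∈ B, b ≠ u ∧ ¬ G.Adj u b ∧ Relation.ReflTransGen
    (fun x y => G.Adj x y ∧ x ∈ {w | w ≠ u ∧ ¬ G.Adj u w} ∧ y ∈ {w | w ≠ u ∧ ¬ G.Adj u w}) b v}

theorem not_adj_of_mem_farVerts {B : Set V} {u v : V} (h : v ∈ G.farVerts B u) :
    v ≠ u ∧ ¬ G.Adj u v := by
  obtain ⟨b, _, h1, h2, hr⟩ := h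
  rcases Relation.ReflTransGen.cases_tail hr with rfl | ⟨w, _, _, _, h3⟩
  · exact ⟨h1, h2⟩
  · exact h3

theorem farVerts_of_adj {B : Set V} {u v w : V} (h : v ∈ G.farVerts B u) (hvw : G.Adj v w)
    (hw : w ≠ u) (hw' : ¬ G.Adj u w) : w ∈ G.farVerts B u := by
  have hv := not_adj_of_mem_farVerts h
  obtain ⟨b, h0, h1, h2, hr⟩ := h
  exact ⟨b, h0, h1, h2, hr.tail ⟨hvw, hv, hw, hw'⟩⟩

theorem farVerts_reach {B : Set V} {u v b : V} (hb : b ∈ B) (h1 : b ≠ u) (h2 : ¬ G.Adj u b)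
    (hr : Relation.ReflTransGen (fun x y => G.Adj x y ∧ x ∈ {w | w ≠ u ∧ ¬ G.Adj u w} ∧
      y ∈ {w | w ≠ u ∧ ¬ G.Adj u w}) b v) :
    Relation.ReflTransGen (fun x y => G.Adj x y ∧ x ∈ G.farVerts B u ∧ y ∈ G.farVerts B u) b v := by
  induction hr with
  | refl => exact .refl
  | tail hxy hyz ih => exact ih.tail ⟨hyz.1, ⟨b, hb, h1, h2, hxy⟩, ⟨b, hb, h1, h2, hxy.tail hyz⟩⟩

theorem farVerts_conn {B : Set V} {u : V} (hB : G.IsClique B) : G.Conn (G.farVerts B u) := by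
  rintro x ⟨b, hb, h1, h2, hr⟩ y ⟨b', hb', h1', h2', hr'⟩
  refine (reach_symm (farVerts_reach hb h1 h2 hr)).trans
    (Relation.ReflTransGen.trans ?_ (farVerts_reach hb' h1' h2' hr'))
  by_cases e : b = b'
  · subst e; exact .refl
  · exact .single ⟨hB hb hb' e, ⟨b, hb, h1, h2, .refl⟩, ⟨b', hb', h1', h2', .refl⟩⟩

/-! ### Choice of the two ends by smallest far components -/

namespace IsFrame

theorem isClique_side (h : G.IsFrame T z n) : G.IsClique (G.sideVerts T z n) :=
  fun _ hu _ hv hne => h.side_clique hu hv hne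

theorem mem_farVerts (h : G.IsFrame T z n) {u b : V} (hu : u ∈ G.sideVerts T z n)
    (hb : b ∈ G.sideVerts T (SimpleGraph.flip z n) n) :
    b ∈ G.farVerts (G.sideVerts T (SimpleGraph.flip z n) n) u :=
  ⟨b, hb, (h.side_ne hu hb).symm, h.side_not_adj hu hb, .refl⟩

/-- A path from a neighbour of `u'` to `B` far from `u`. -/
theorem exists_ip_far (h : G.IsFrame T z n) {u u' v : V} (hu : u ∈ G.sideVerts T z n)
    (hv : v ∈ G.farVerts (G.sideVerts T (SimpleGraph.flip z n) n) u) (ha : G.Adj u' v) :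
    ∃ W q b, G.Conn W ∧ q ∈ W ∧ b ∈ W ∧ b ∈ G.sideVerts T (SimpleGraph.flip z n) n ∧
      (∀ l ∈ W, G.Adj u' l ↔ l = q) ∧ ∀ l ∈ W, l ≠ u ∧ ¬ G.Adj u l := by
  obtain ⟨F, q, b, e, hF, hFW, hq, hb, hFq, -⟩ :=
    (farVerts_conn (u := u) h.flip.isClique_side).exists_ip (fun l => G.Adj u' l)
      (fun l => l ∈ G.sideVerts T (SimpleGraph.flip z n) n) ⟨v, hv, ha⟩
      ⟨z n, h.mem_farVerts hu h.right_mem_side, h.right_mem_side⟩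
  exact ⟨F, q, b, hF.conn, hF.left_mem, hF.right_mem, hb,
    fun l hl => ⟨hFq l hl, by rintro rfl; exact hq⟩, fun l hl => not_adj_of_mem_farVerts (hFW hl)⟩

/-- Two far paths, one for each of `u` and `u'`, are joined inside the clique `B` into a connected
set where `u` and `u'` have exactly one neighbour each, and distinct ones. -/
theorem false_of_mutual (h : G.IsFrame T z n) {u u' v v' : V} (hu : u ∈ G.sideVerts T z n)
    (hu' : u' ∈ G.sideVerts T z n) (huu : u ≠ u')
    (hv : v ∈ G.farVerts (G.sideVerts T (SimpleGraph.flip z n) n) u) (ha : G.Adj u' v)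
    (hv' : v' ∈ G.farVerts (G.sideVerts T (SimpleGraph.flip z n) n) u') (ha' : G.Adj u v') :
    False := by
  obtain ⟨W, r, b, hW, hr, hbW, hb, hWr, hWu⟩ := h.exists_ip_far hu hv ha
  obtain ⟨W', q, b', hW', hq, hbW', hb', hWq, hWu'⟩ := h.exists_ip_far hu' hv' ha'
  have hadj := h.side_clique hu hu' huu
  refine h.false_of_linked_side hu hu' huu (W := W ∪ W') (q := q) (r := r) (b := b)
    (hW.union hW' hbW ?_) ?_ ?_ (Or.inr hq) (Or.inl hr) ?_ ?_ ?_ (Or.inl hbW) hb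
  · by_cases e : b = b'
    · exact Or.inl (e ▸ hbW')
    · exact Or.inr ⟨b', hbW', h.flip.side_clique hb hb' e⟩
  · rintro (hl | hl)
    · exact (hWu u hl).1 rfl
    · exact (hWu' u hl).2 hadj.symm
  · rintro (hl | hl)
    · exact (hWu u' hl).2 hadj
    · exact (hWu' u' hl).1 rfl
  · rintro rfl
    exact (hWu _ hr).2 ((hWq _ hq).2 rfl)
  · rintro l (hl | hl)
    · refine iff_of_false (hWu l hl).2 ?_
      rintro rfl
      exact (hWu _ hl).2 ((hWq _ hq).2 rfl)
    · exact hWq l hl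
  · rintro l (hl | hl)
    · exact hWr l hl
    · refine iff_of_false (hWu' l hl).2 ?_
      rintro rfl
      exact (hWu' _ hl).2 ((hWr _ hr).2 rfl)

/-- There is a vertex of the first side such that the other vertices of this side have no
neighbour in its far component. -/
theorem exists_extremal [Finite V] (h : G.IsFrame T z n) : ∃ a ∈ G.sideVerts T z n,
    ∀ u ∈ G.sideVerts T z n, u ≠ a →
      ∀ v ∈ G.farVerts (G.sideVerts T (SimpleGraph.flip z n) n) a, ¬ G.Adj u v := by
  -- If another vertex `u` of the side had a neighbour in the far component of a minimiser `a`, then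
  -- by `false_of_mutual` the vertex `a` would have none in that of `u`, and the latter would be
  -- strictly contained in the former.
  obtain ⟨a, ha, hmin⟩ := Set.exists_min_image (G.sideVerts T z n)
    (fun u => (G.farVerts (G.sideVerts T (SimpleGraph.flip z n) n) u).ncard) (Set.toFinite _)
    ⟨_, h.left_mem_side⟩
  refine ⟨a, ha, fun u hu hne v hv huv => ?_⟩
  have hno : ∀ v' ∈ G.farVerts (G.sideVerts T (SimpleGraph.flip z n) n) u, ¬ G.Adj a v' :=
    fun v' hv' hav => h.false_of_mutual ha hu hne.symm hv huv hv' hav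
  have hua := h.side_clique hu ha hne
  have hsub : G.farVerts (G.sideVerts T (SimpleGraph.flip z n) n) u ⊆
      G.farVerts (G.sideVerts T (SimpleGraph.flip z n) n) a := by
    rintro x ⟨b, hb, h1, h2, hr⟩
    have hr' := farVerts_reach hb h1 h2 hr
    clear hr
    induction hr' with
    | refl => exact h.mem_farVerts ha hb
    | tail _ hyz ih =>
      exact farVerts_of_adj ih hyz.1
        (by rintro rfl; exact (not_adj_of_mem_farVerts hyz.2.2).2 hua) (hno _ hyz.2.2)
  have hlt := Set.ncard_lt_ncard (hsub.ssubset_of_mem_notMem hv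
    (fun hv' => (not_adj_of_mem_farVerts hv').2 huv)) (Set.toFinite _)
  exact absurd (hmin u hu) (by simpa using hlt)

/-- The vertices `p 2, …, p m` avoid `a` and its neighbours, so they are in its far component. If `p
1` were in the side of `a`, it would have the neighbour `p 2` there. -/
theorem second_notMem (h : G.IsFrame T z n) {a : V} {p : ℕ → V} {m : ℕ}
    (hext : ∀ u ∈ G.sideVerts T z n, u ≠ a →
      ∀ v ∈ G.farVerts (G.sideVerts T (SimpleGraph.flip z n) n) a, ¬ G.Adj u v)
    (ha : a ∈ G.sideVerts T z n) (hp : G.IndPath p m) (h0 : p 0 = a)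
    (hm : p m ∈ G.sideVerts T (SimpleGraph.flip z n) n) : p 1 ∉ G.sideVerts T z n := by
  intro h1
  have hm2 : 2 ≤ m := by
    by_contra hlt
    rcases Nat.lt_or_ge m 1 with hm0 | hm1
    · have : m = 0 := by omega
      subst this
      exact h.side_ne ha hm h0.symm
    · have : m = 1 := by omega
      subst this
      exact h.side_ne h1 hm rfl
  have key : ∀ j, j + 2 ≤ m →
      p (m - j) ∈ G.farVerts (G.sideVerts T (SimpleGraph.flip z n) n) a := by
    intro j hj
    induction j with
    | zero => simpa using h.mem_farVerts ha hm
    | succ j ih =>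
      refine farVerts_of_adj (ih (by omega)) ?_ ?_ ?_
      · rw [hp.adj_iff (by omega) (by omega)]; omega
      · rw [← h0]; exact (hp 0 _ (by omega) (by omega)).1.symm
      · rw [← h0, hp.adj_iff (by omega) (by omega)]; omega
  have h2 := key (m - 2) (by omega)
  rw [show m - (m - 2) = 2 by omega] at h2
  refine hext _ h1 ?_ _ h2 (hp.adj_succ (by omega))
  rw [← h0]
  exact (hp 0 1 (by omega) (by omega)).1.symm

/-- There are vertices `a`, `b` on the two sides such that no induced path from `a` to `b` has its
second vertex on the first side or its penultimate vertex on the second side. -/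
theorem exists_ends [Finite V] (h : G.IsFrame T z n) : ∃ a ∈ G.sideVerts T z n,
    ∃ b ∈ G.sideVerts T (SimpleGraph.flip z n) n, ∀ p m, G.IndPath p m → p 0 = a → p m = b →
      p 1 ∉ G.sideVerts T z n ∧ p (m - 1) ∉ G.sideVerts T (SimpleGraph.flip z n) n := by
  obtain ⟨a, ha, hexa⟩ := h.exists_extremal
  obtain ⟨b, hb, hexb⟩ := h.flip.exists_extremal
  refine ⟨a, ha, b, hb, fun p m hp h0 hm => ⟨h.second_notMem hexa ha hp h0 (hm ▸ hb), ?_⟩⟩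
  exact h.flip.second_notMem hexb hb hp.flip (by simpa [SimpleGraph.flip] using hm) (by
    rw [sideVerts_flip_flip]
    simpa [SimpleGraph.flip, h0] using ha)

theorem even_of_ip (h : G.IsFrame T z n) {a b : V} (ha : a ∈ G.sideVerts T z n)
    (hb : b ∈ G.sideVerts T (SimpleGraph.flip z n) n)
    (hend : ∀ p m, G.IndPath p m → p 0 = a → p m = b →
      p 1 ∉ G.sideVerts T z n ∧ p (m - 1) ∉ G.sideVerts T (SimpleGraph.flip z n) n)
    {S : Set V} {m : ℕ} (hS : G.IP S a b m) : Even m := by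
  by_contra hodd
  rw [Nat.not_even_iff_odd] at hodd
  obtain ⟨p, h0, hm, -, hp⟩ := hS
  have := hend p m hp h0 hm
  rcases h.second_or_penultimate hp (h0 ▸ ha) (hm ▸ hb) hodd with h1 | h1
  · exact this.1 h1
  · exact this.2 h1

/-- The vertices of an induced path between the two special ends are not in `T`, and its
`T`-complete internal vertices are not attached to the interior of the frame. -/
theorem not_touches_of_indPath (h : G.IsFrame T z n) {a b : V} (ha : a ∈ G.sideVerts T z n)
    (hb : b ∈ G.sideVerts T (SimpleGraph.flip z n) n)
    (hend : ∀ p m, G.IndPath p m → p 0 = a → p m = b →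
      p 1 ∉ G.sideVerts T z n ∧ p (m - 1) ∉ G.sideVerts T (SimpleGraph.flip z n) n)
    {p : ℕ → V} {m : ℕ} (hp : G.IndPath p m) (h0 : p 0 = a) (hm : p m = b) (hm3 : 3 ≤ m) :
    (∀ i ≤ m, p i ∉ T) ∧ ∀ i, 0 < i → i < m → p i ∈ G.completeVerts T →
      ¬ G.Touches (p i) (inner z n) := by
  obtain ⟨hA, hB⟩ := hend p m hp h0 hm
  rw [← h0] at ha
  rw [← hm] at hb
  have hno : ∀ i ≤ m, ¬ (G.Adj (p i) (p 0) ∧ G.Adj (p i) (p m)) := by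
    rintro i hi ⟨h1, h2⟩
    rw [hp.adj_iff (by omega) (by omega)] at h1 h2
    omega
  refine ⟨fun i hi ht => hno i hi ⟨(ha.1.2 _ ht).symm, (hb.1.2 _ ht).symm⟩, ?_⟩
  intro i h1 h2 hiC ht
  rcases h.mem_sides hiC ht ha hb (hno i h2.le) with h5 | h5
  · have := h.side_clique ha h5 (hp 0 i h1 h2.le).1
    rw [(hp 0 i h1 h2.le).2] at this
    have e : i = 1 := by omega
    subst e
    exact hA h5
  · have := h.flip.side_clique h5 hb (hp i m h2 le_rfl).1
    rw [(hp i m h2 le_rfl).2] at this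
    have e : i = m - 1 := by omega
    subst e
    exact hB h5

end IsFrame

end SimpleGraph

namespace SimpleGraph

variable {V : Type*} {G : SimpleGraph V} {T : Set V} {z : ℕ → V} {n : ℕ}

/-! ### Snakes -/

/-- The vertex sets of the four paths of an induced snake. -/
structure IsSnake (G : SimpleGraph V) (a b a' b' c c' d d' : V) (S₁ S₂ S₃ S₄ : Set V)
    (n₁ n₂ n₃ n₄ : ℕ) : Prop where
  ip₁ : G.IP S₁ a a' n₁
  ip₂ : G.IP S₂ b b' n₂
  ip₃ : G.IP S₃ c c' n₃
  ip₄ : G.IP S₄ d d' n₄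
  one_le₃ : 1 ≤ n₃
  one_le₄ : 1 ≤ n₄
  adj₁₂ : ∀ x ∈ S₁, ∀ y ∈ S₂, x ≠ y ∧ ¬ G.Adj x y
  adj₁₃ : ∀ x ∈ S₁, ∀ y ∈ S₃, x ≠ y ∧ (G.Adj x y ↔ x = a' ∧ y = c)
  adj₁₄ : ∀ x ∈ S₁, ∀ y ∈ S₄, x ≠ y ∧ (G.Adj x y ↔ x = a' ∧ y = d)
  adj₂₃ : ∀ x ∈ S₂, ∀ y ∈ S₃, x ≠ y ∧ (G.Adj x y ↔ x = b' ∧ y = c')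
  adj₂₄ : ∀ x ∈ S₂, ∀ y ∈ S₄, x ≠ y ∧ (G.Adj x y ↔ x = b' ∧ y = d')
  adj₃₄ : ∀ x ∈ S₃, ∀ y ∈ S₄, x ≠ y ∧ (G.Adj x y ↔ (x = c ∧ y = d) ∨ (x = c' ∧ y = d'))

theorem Snake.isSnake {a b : V} (S : G.Snake a b) :
    G.IsSnake a b S.a' S.b' S.c S.c' S.d S.d' {v | v ∈ S.S₁.support} {v | v ∈ S.S₂.support}
      {v | v ∈ S.S₃.support} {v | v ∈ S.S₄.support} S.S₁.length S.S₂.length S.S₃.length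
      S.S₄.length := by
  obtain ⟨a', b', c, c', d, d', S₁, S₂, S₃, S₄, p₁, p₂, p₃, p₄, l₃, l₄, h₁₂, h₁₃, h₁₄, h₂₃, h₂₄,
    h₃₄, hadj⟩ := S
  have ma' := S₁.end_mem_support
  have mb' := S₂.end_mem_support
  have mc := S₃.start_mem_support
  have mc' := S₃.end_mem_support
  have md := S₄.start_mem_support
  have md' := S₄.end_mem_support
  have hadj' : ∀ x y, x ∈ S₁.support ++ S₂.support ++ S₃.support ++ S₄.support →
      y ∈ S₁.support ++ S₂.support ++ S₃.support ++ S₄.support →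
      (G.Adj x y ↔ (x ∈ S₁.support ∧ y ∈ S₁.support ∧ s(x, y) ∈ S₁.edges) ∨
        (x ∈ S₂.support ∧ y ∈ S₂.support ∧ s(x, y) ∈ S₂.edges) ∨
        (x ∈ S₃.support ∧ y ∈ S₃.support ∧ s(x, y) ∈ S₃.edges) ∨
        (x ∈ S₄.support ∧ y ∈ S₄.support ∧ s(x, y) ∈ S₄.edges) ∨
        (x = a' ∧ y = c ∨ x = c ∧ y = a') ∨ (x = a' ∧ y = d ∨ x = d ∧ y = a') ∨
        (x = c ∧ y = d ∨ x = d ∧ y = c) ∨ (x = b' ∧ y = c' ∨ x = c' ∧ y = b') ∨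
        (x = b' ∧ y = d' ∨ x = d' ∧ y = b') ∨ (x = c' ∧ y = d' ∨ x = d' ∧ y = c')) := by
    intro x y hx hy
    rw [hadj x y hx hy]
    simp only [List.mem_append, List.mem_cons, List.not_mem_nil, or_false, Sym2.eq_iff, or_assoc]
    -- Recording both endpoints with each edge lets the disjointness of the four supports decide
    -- which alternatives survive.
    have e : ∀ {u v : V} (w : G.Walk u v), s(x, y) ∈ w.edges ↔
        x ∈ w.support ∧ y ∈ w.support ∧ s(x, y) ∈ w.edges := fun w =>
      ⟨fun h => ⟨w.fst_mem_support_of_mem_edges h, w.snd_mem_support_of_mem_edges h, h⟩,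
        fun h => h.2.2⟩
    simp only [← e]
  simp only [List.mem_append] at hadj'
  dsimp only
  clear hadj
  simp only [List.Disjoint] at h₁₂ h₁₃ h₁₄ h₂₃ h₂₄ h₃₄
  have ch : ∀ {u v : V} (w : G.Walk u v), (∀ x ∈ w.support, ∀ y ∈ w.support, G.Adj x y →
      s(x, y) ∈ w.edges) → w.IsChordless := fun w h =>
    w.isChordless_iff_forall_mem_edges.2 (fun {u v} hu hv ha => h u hu v hv ha)
  refine ⟨p₁.ip (ch _ ?_), p₂.ip (ch _ ?_), p₃.ip (ch _ ?_), p₄.ip (ch _ ?_), l₃, l₄,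
    ?_, ?_, ?_, ?_, ?_, ?_⟩
  all_goals
    intro x hx y hy
    try simp only [Set.mem_ofPred_eq] at hx hy
    have hxy := hadj' x y (by tauto) (by tauto)
    clear hadj' ch p₁ p₂ p₃ p₄ l₃ l₄
    grind (splits := 30)

namespace IsSnake

variable {a b a' b' c c' d d' : V} {S₁ S₂ S₃ S₄ : Set V} {n₁ n₂ n₃ n₄ : ℕ}

theorem swap₃₄ (h : G.IsSnake a b a' b' c c' d d' S₁ S₂ S₃ S₄ n₁ n₂ n₃ n₄) :
    G.IsSnake a b a' b' d d' c c' S₁ S₂ S₄ S₃ n₁ n₂ n₄ n₃ := by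
  obtain ⟨i₁, i₂, i₃, i₄, l₃, l₄, h₁₂, h₁₃, h₁₄, h₂₃, h₂₄, h₃₄⟩ := h
  refine ⟨i₁, i₂, i₄, i₃, l₄, l₃, h₁₂, h₁₄, h₁₃, h₂₄, h₂₃, fun x hx y hy => ?_⟩
  obtain ⟨h1, h2⟩ := h₃₄ y hy x hx
  exact ⟨h1.symm, by rw [G.adj_comm, h2]; tauto⟩

theorem swap₁₂ (h : G.IsSnake a b a' b' c c' d d' S₁ S₂ S₃ S₄ n₁ n₂ n₃ n₄) :
    G.IsSnake b a b' a' c' c d' d S₂ S₁ S₃ S₄ n₂ n₁ n₃ n₄ := by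
  obtain ⟨i₁, i₂, i₃, i₄, l₃, l₄, h₁₂, h₁₃, h₁₄, h₂₃, h₂₄, h₃₄⟩ := h
  refine ⟨i₂, i₁, i₃.symm, i₄.symm, l₃, l₄, fun x hx y hy => ?_, h₂₃, h₂₄, h₁₃, h₁₄,
    fun x hx y hy => ?_⟩
  · obtain ⟨h1, h2⟩ := h₁₂ y hy x hx
    exact ⟨h1.symm, fun h => h2 h.symm⟩
  · obtain ⟨h1, h2⟩ := h₃₄ x hx y hy
    exact ⟨h1, by rw [h2]; tauto⟩

theorem c_ne (h : G.IsSnake a b a' b' c c' d d' S₁ S₂ S₃ S₄ n₁ n₂ n₃ n₄) : c ≠ c' := by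
  obtain ⟨p, rfl, rfl, -, hp⟩ := h.ip₃
  exact (hp 0 n₃ h.one_le₃ le_rfl).1

theorem adj_ac (h : G.IsSnake a b a' b' c c' d d' S₁ S₂ S₃ S₄ n₁ n₂ n₃ n₄) : G.Adj a' c :=
  (h.adj₁₃ _ h.ip₁.right_mem _ h.ip₃.left_mem).2.2 ⟨rfl, rfl⟩

theorem adj_cd (h : G.IsSnake a b a' b' c c' d d' S₁ S₂ S₃ S₄ n₁ n₂ n₃ n₄) : G.Adj c d :=
  (h.adj₃₄ _ h.ip₃.left_mem _ h.ip₄.left_mem).2.2 (Or.inl ⟨rfl, rfl⟩)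

theorem not_adj_c (h : G.IsSnake a b a' b' c c' d d' S₁ S₂ S₃ S₄ n₁ n₂ n₃ n₄) :
    ∀ s ∈ S₂, s ≠ c ∧ ¬ G.Adj s c := fun s hs =>
  ⟨(h.adj₂₃ s hs c h.ip₃.left_mem).1, fun ha =>
    h.c_ne ((h.adj₂₃ s hs c h.ip₃.left_mem).2.1 ha).2⟩

/-- The path of the snake from `a` to `b` through `S₃`. -/
theorem ip (h : G.IsSnake a b a' b' c c' d d' S₁ S₂ S₃ S₄ n₁ n₂ n₃ n₄) :
    G.IP (S₁ ∪ S₃ ∪ S₂) a b (n₁ + 1 + n₃ + 1 + n₂) := by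
  refine (h.ip₁.join h.ip₃ h.adj_ac fun s hs s' hs' =>
    ⟨(h.adj₁₃ s hs s' hs').1, (h.adj₁₃ s hs s' hs').2.1⟩).join h.ip₂.symm h.swap₁₂.adj_ac.symm ?_
  rintro s (hs | hs) s' hs'
  · exact ⟨(h.adj₁₂ s hs s' hs').1, fun ha => absurd ha (h.adj₁₂ s hs s' hs').2⟩
  · exact ⟨(h.adj₂₃ s' hs' s hs).1.symm,
      fun ha => ((h.adj₂₃ s' hs' s hs).2.1 ha.symm).symm⟩

/-- The hole of the snake formed by `S₃` and `S₄`. -/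
theorem cyc (h : G.IsSnake a b a' b' c c' d d' S₁ S₂ S₃ S₄ n₁ n₂ n₃ n₄) :
    G.Cyc (S₃ ∪ S₄) c d (n₃ + 1 + n₄) := by
  refine h.ip₃.join_cyc h.ip₄.symm h.swap₁₂.adj_cd h.adj_cd fun s hs s' hs' => ?_
  obtain ⟨h1, h2⟩ := h.adj₃₄ s hs s' hs'
  exact ⟨h1, fun ha => (h2.1 ha).symm⟩

/-- The edge `cd` separates the part of the snake before it from the rest. -/
theorem false_of_link (h : G.IsSnake a b a' b' c c' d d' S₁ S₂ S₃ S₄ n₁ n₂ n₃ n₄)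
    (hG : G.InClassA) {L : Set V} (hL : G.Conn (S₁ ∪ L ∪ S₂))
    (hLa : ∀ l ∈ L, l ≠ c ∧ l ≠ d ∧ ¬ G.Adj l c ∧ ¬ G.Adj l d) : False := by
  have h3 := h.one_le₃
  have h4 := h.one_le₄
  -- On the hole formed by `S₃` and `S₄`, the vertex `a'` sees only `c` and `d`. The connected set
  -- reaches `b'`, which sees `c'`.
  refine hG.false_of_triangle_link h.cyc (by omega) h.adj_ac h.swap₃₄.adj_ac ?_ hL
    (Or.inl (Or.inl h.ip₁.right_mem)) ?_ ?_ ?_ ⟨c', Or.inl h.ip₃.right_mem, h.c_ne.symm,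
      (h.adj₃₄ _ h.ip₃.right_mem _ h.ip₄.left_mem).1,
      Or.inr ⟨b', Or.inr h.ip₂.right_mem, h.swap₁₂.adj_ac.symm⟩⟩
  · rintro s (hs | hs) h1 h2
    · exact ⟨(h.adj₁₃ _ h.ip₁.right_mem s hs).1,
        fun ha => h1 ((h.adj₁₃ _ h.ip₁.right_mem s hs).2.1 ha).2⟩
    · exact ⟨(h.adj₁₄ _ h.ip₁.right_mem s hs).1,
        fun ha => h2 ((h.adj₁₄ _ h.ip₁.right_mem s hs).2.1 ha).2⟩
  · rintro ((hl | hl) | hl)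
    · exact (h.adj₁₃ _ hl _ h.ip₃.left_mem).1 rfl
    · exact (hLa _ hl).1 rfl
    · exact (h.not_adj_c _ hl).1 rfl
  · rintro ((hl | hl) | hl)
    · exact (h.adj₁₄ _ hl _ h.ip₄.left_mem).1 rfl
    · exact (hLa _ hl).2.1 rfl
    · exact (h.swap₃₄.not_adj_c _ hl).1 rfl
  · rintro l ((hl | hl) | hl) hla -
    · exact ⟨fun ha => hla ((h.adj₁₃ _ hl _ h.ip₃.left_mem).2.1 ha).1,
        fun ha => hla ((h.adj₁₄ _ hl _ h.ip₄.left_mem).2.1 ha).1⟩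
    · exact (hLa _ hl).2.2
    · exact ⟨(h.not_adj_c _ hl).2, (h.swap₃₄.not_adj_c _ hl).2⟩

end IsSnake

/-- A special even pair, in terms of vertex sets of induced paths. -/
structure IsSpecialPair (G : SimpleGraph V) (a b : V) : Prop where
  ne : a ≠ b
  not_adj : ¬ G.Adj a b
  even : ∀ S m, G.IP S a b m → Even m
  length_eq_zero : ∀ a' b' c c' d d' S₁ S₂ S₃ S₄ n₁ n₂ n₃ n₄,
    G.IsSnake a b a' b' c c' d d' S₁ S₂ S₃ S₄ n₁ n₂ n₃ n₄ → n₁ = 0 ∧ n₂ = 0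

theorem IsSpecialPair.isSpecialEvenPair {a b : V} (h : G.IsSpecialPair a b) :
    G.IsSpecialEvenPair a b := by
  refine ⟨⟨h.ne, h.not_adj, fun w hw hc => h.even _ _ (hw.ip hc)⟩, ?_⟩
  rintro ⟨S, hS⟩
  have := h.length_eq_zero _ _ _ _ _ _ _ _ _ _ _ _ _ _ S.isSnake
  unfold Snake.IsProper at hS
  omega

theorem IP.exists_penultimate {S : Set V} {x y : V} {m : ℕ} (h : G.IP S x y m) (hm : 1 ≤ m) :
    x ∈ S \ {y} ∧ G.Conn (S \ {y}) ∧ ∃ w ∈ S \ {y}, ∀ s ∈ S, G.Adj s y ↔ s = w := by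
  obtain ⟨p, rfl, rfl, rfl, hp⟩ := h
  have e : p '' Set.Iic m \ {p m} = p '' Set.Icc 0 (m - 1) := by
    ext v
    constructor
    · rintro ⟨⟨i, hi, rfl⟩, hne⟩
      have : i ≠ m := by rintro rfl; exact hne rfl
      simp only [Set.mem_Iic] at hi
      exact ⟨i, ⟨by omega, by omega⟩, rfl⟩
    · rintro ⟨i, ⟨_, hi⟩, rfl⟩
      exact ⟨⟨i, by simp; omega, rfl⟩, (hp i m (by omega) le_rfl).1⟩
  rw [e]
  refine ⟨⟨0, by simp, rfl⟩, Conn.of_seg fun k _ hk => hp.adj_succ (by omega), p (m - 1),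
    ⟨m - 1, by simp, rfl⟩, ?_⟩
  rintro _ ⟨i, hi, rfl⟩
  simp only [Set.mem_Iic] at hi
  rw [hp.adj_iff hi le_rfl]
  constructor
  · intro h; congr 1; omega
  · intro h; have := hp.inj hi (by omega) h; omega

/-! ### Excluding proper snakes between the chosen ends -/

namespace IsFrame

variable {a b a' b' c c' d d' : V} {S₁ S₂ S₃ S₄ : Set V} {n₁ n₂ n₃ n₄ : ℕ}

/-- The vertex `d` turns out to be outer and `a'` to be `T`-complete. A hole through the edge `a'c`
avoiding `d` then has another vertex seen by `d` and another `T`-complete vertex, so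
`InClassA.even_of_attached` applies with `L = {d}`. Its exceptional outcomes would make `d` adjacent
to the neighbour of `a'` on `S₁` or to that of `c` on `S₃`, which a snake forbids. -/
theorem false_of_isSnake_of_mem (h : G.IsFrame T z n) (ha : a ∈ G.sideVerts T z n)
    (hb : b ∈ G.sideVerts T (SimpleGraph.flip z n) n)
    (hS : G.IsSnake a b a' b' c c' d d' S₁ S₂ S₃ S₄ n₁ n₂ n₃ n₄) (h₁ : 1 ≤ n₁)
    (hT : ∀ s ∈ S₁ ∪ S₂ ∪ S₃ ∪ S₄, s ∉ T)
    (hC : ∀ s ∈ S₁ ∪ S₂ ∪ S₃ ∪ S₄, s ≠ a → s ≠ b → s ∈ G.completeVerts T →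
      ¬ G.Touches s (inner z n))
    (hcd : ∀ t ∈ T, G.Adj c t ∨ G.Adj d t) (hc : c ∈ G.completeVerts T) : False := by
  classical
  have hG := h.inClassA
  have h4 := h.four_le
  have ma := hS.ip₁.left_mem
  have ma' := hS.ip₁.right_mem
  have mb := hS.ip₂.left_mem
  have mb' := hS.ip₂.right_mem
  have mc := hS.ip₃.left_mem
  have mc' := hS.ip₃.right_mem
  have md := hS.ip₄.left_mem
  have md' := hS.ip₄.right_mem
  have hac := hS.adj_ac
  have had : G.Adj a' d := hS.swap₃₄.adj_ac
  have hcd' := hS.adj_cd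
  have hT₁ : ∀ s ∈ S₁, s ∉ T := fun s hs => hT s (by simp [hs])
  have hT₂ : ∀ s ∈ S₂, s ∉ T := fun s hs => hT s (by simp [hs])
  have hT₃ : ∀ s ∈ S₃, s ∉ T := fun s hs => hT s (by simp [hs])
  have hT₄ : ∀ s ∈ S₄, s ∉ T := fun s hs => hT s (by simp [hs])
  have hbd : b ≠ d ∧ ¬ G.Adj b d := hS.swap₃₄.not_adj_c b mb
  have hba' : ¬ G.Adj b a' := fun h => (hS.adj₁₂ _ ma' _ mb).2 h.symm
  have hba'' : b ≠ a' := (hS.adj₁₂ _ ma' _ mb).1.symm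
  have hcI : ¬ G.Touches c (inner z n) := hC c (by simp [mc]) ((hS.adj₁₃ _ ma _ mc).1.symm)
    (hS.adj₂₃ _ mb _ mc).1.symm hc
  have hda := hS.adj₁₄
  have h2c := hS.not_adj_c
  have h2d := hS.swap₃₄.not_adj_c
  -- If `d` were `T`-complete too, the interior of the frame would join `S₁` to `S₂` without meeting
  -- or seeing `c` and `d`.
  have hdO : d ∈ G.outerVerts T := by
    refine ⟨hT₄ d md, fun hd => ?_⟩
    have hdI : ¬ G.Touches d (inner z n) := hC d (by simp [md]) ((hS.adj₁₄ _ ma _ md).1.symm)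
      (hS.adj₂₄ _ mb _ md).1.symm hd
    refine hS.false_of_link hG (L := inner z n) ?_ ?_
    · refine ((hS.ip₁.conn.union h.inner_conn ma (Or.inr ⟨_, mem_inner (i := 1) (by omega)
        (by omega), h.adj_one ha⟩)).union hS.ip₂.conn (Or.inr (mem_inner (i := n - 1) (by omega)
        (by omega))) (Or.inr ⟨b, mb, (h.adj_last hb).symm⟩))
    · intro l hl
      exact ⟨fun e => hcI (Or.inl (e ▸ hl)), fun e => hdI (Or.inl (e ▸ hl)),
        fun ha => hcI (Or.inr ⟨l, hl, ha.symm⟩), fun ha => hdI (Or.inr ⟨l, hl, ha.symm⟩)⟩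
  -- If `t` misses both, then `t`, `c` and a piece of `S₁` ending at `a'` form a hole on which `d`
  -- sees only `a'` and `c`. It is linked to `t` by `S₄` and `S₂`, since `b` sees `t`.
  have had' : ∀ t ∈ T, G.Adj a' t ∨ G.Adj d t := by
    intro t ht
    by_contra hcon
    rw [not_or] at hcon
    obtain ⟨hta, htd⟩ := hcon
    obtain ⟨F, f', f, e, hF, hFS, rfl, hf, hFq, hFr⟩ := hS.ip₁.conn.exists_ip (fun l => l = a')
      (fun l => G.Adj l t) ⟨a', ma', rfl⟩ ⟨a, ma, ha.1.2 t ht⟩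
    have he : 1 ≤ e := by
      by_contra hlt
      have e0 : e = 0 := by omega
      subst e0
      obtain ⟨p, rfl, rfl, -, -⟩ := hF
      exact hta hf
    have hct : G.Adj c t := hc.2 t ht
    have hcyc := (hF.join (IP.single t) hf (by
      rintro s hs _ rfl
      exact ⟨fun e => hT₁ s (hFS hs) (e ▸ ht), fun ha => ⟨hFr s hs ha, rfl⟩⟩)).close (w := c) (by
        rintro (hl | hl)
        · exact (hS.adj₁₃ _ (hFS hl) _ mc).1 rfl
        · exact hc.1 (hl ▸ ht)) hac hct.symm (by
        rintro s (hs | rfl) ha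
        · exact Or.inl ((hS.adj₁₃ _ (hFS hs) _ mc).2.1 ha).1
        · exact Or.inr rfl)
    have hft : t ≠ f' := fun e => hT₁ f' ma' (e ▸ ht)
    refine hG.false_of_triangle_link hcyc (by omega) had.symm hcd'.symm ?_ (L := S₄ ∪ S₂)
      (hS.ip₄.conn.union hS.ip₂.conn md' (Or.inr ⟨b', mb',
        hS.swap₃₄.swap₁₂.adj_ac.symm⟩)) (Or.inl md) ?_ ?_ ?_
      ⟨t, Or.inl (Or.inr rfl), hft, fun e => hc.1 (e ▸ ht),
        Or.inr ⟨b, Or.inr mb, (hb.1.2 t ht).symm⟩⟩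
    · rintro s ((hs | rfl) | rfl) h1 h2
      · obtain ⟨h3, h4⟩ := hS.adj₁₄ s (hFS hs) d md
        exact ⟨h3.symm, fun ha => h1 (h4.1 ha.symm).1⟩
      · exact ⟨fun e => hT₄ d md (e ▸ ht), htd⟩
      · exact absurd rfl h2
    · rintro (hl | hl)
      · exact (hS.adj₁₄ _ ma' _ hl).1 rfl
      · exact (hS.adj₁₂ _ ma' _ hl).1 rfl
    · rintro (hl | hl)
      · exact (hS.adj₃₄ _ mc _ hl).1 rfl
      · exact (h2c _ hl).1 rfl
    · rintro l (hl | hl) hld -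
      · refine ⟨fun ha => hld ((hS.adj₁₄ _ ma' _ hl).2.1 ha.symm).2, fun ha => ?_⟩
        rcases (hS.adj₃₄ _ mc _ hl).2.1 ha.symm with h5 | h5
        · exact hld h5.2
        · exact hS.c_ne h5.1
      · exact ⟨fun ha => (hS.adj₁₂ _ ma' _ hl).2 ha.symm, (h2c _ hl).2⟩
  have ha'C : a' ∈ G.completeVerts T := by
    by_contra hcon
    exact hG.false_of_cover h.conn (hT₁ a' ma') hdO.1 had had'
      (exists_not_adj_of_mem_outerVerts ⟨hT₁ a' ma', hcon⟩) (exists_not_adj_of_mem_outerVerts hdO)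
      hb.1 hba'' hbd.1 hba' hbd.2
  obtain ⟨maX, hconn₁, w, hw, hwu⟩ := hS.ip₁.exists_penultimate h₁
  obtain ⟨mcX, hconn₃, w', hw', hwu'⟩ := hS.ip₃.symm.exists_penultimate hS.one_le₃
  have ha'I : ¬ G.Touches a' (inner z n) :=
    hC a' (by simp [ma']) (fun e => maX.2 e.symm) hba''.symm ha'C
  -- In this connected set `w` is the only neighbour of `a'` and `w'` the only one of `c`. The
  -- vertex `a` is still in it because `S₁` has positive length.
  obtain ⟨X, hX⟩ : ∃ X, X = S₁ \ {a'} ∪ inner z n ∪ S₂ ∪ S₃ \ {c} := ⟨_, rfl⟩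
  have hXconn : G.Conn X := by
    rw [hX]
    exact (((hconn₁.union h.inner_conn maX (Or.inr ⟨_, mem_inner (i := 1) (by omega)
        (by omega), h.adj_one ha⟩)).union hS.ip₂.conn (Or.inr (mem_inner (i := n - 1) (by omega)
        (by omega))) (Or.inr ⟨b, mb, (h.adj_last hb).symm⟩))).union hconn₃ (Or.inr mb')
        (Or.inr ⟨c', mcX, hS.swap₁₂.adj_ac⟩)
  have hXT : ∀ l ∈ X, l ∉ T := by
    rw [hX]
    rintro l (((hl | hl) | hl) | hl)
    · exact hT₁ l hl.1
    · exact (h.inner_subset hl).1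
    · exact hT₂ l hl
    · exact hT₃ l hl.1
  have ha'X : a' ∉ X := by
    rw [hX]
    rintro (((hl | hl) | hl) | hl)
    · exact hl.2 rfl
    · exact ha'I (Or.inl hl)
    · exact (hS.adj₁₂ _ ma' _ hl).1 rfl
    · exact (hS.adj₁₃ _ ma' _ hl.1).1 rfl
  have hcX : c ∉ X := by
    rw [hX]
    rintro (((hl | hl) | hl) | hl)
    · exact (hS.adj₁₃ _ hl.1 _ mc).1 rfl
    · exact hcI (Or.inl hl)
    · exact (h2c _ hl).1 rfl
    · exact hl.2 rfl
  have hdX : d ∉ X := by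
    rw [hX]
    rintro (((hl | hl) | hl) | hl)
    · exact (hS.adj₁₄ _ hl.1 _ md).1 rfl
    · exact hcI (Or.inr ⟨d, hl, hcd'⟩)
    · exact (h2d _ hl).1 rfl
    · exact (hS.adj₃₄ _ hl.1 _ md).1 rfl
  have hwX : w ∈ X := hX ▸ Or.inl (Or.inl (Or.inl hw))
  have hwX' : w' ∈ X := hX ▸ Or.inr hw'
  have hXa : ∀ l ∈ X, G.Adj l a' ↔ l = w := by
    intro l hl
    refine ⟨fun hla => ?_, fun e => by rw [e]; exact (hwu w hw.1).2 rfl⟩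
    rw [hX] at hl
    rcases hl with ((hl | hl) | hl) | hl
    · exact (hwu l hl.1).1 hla
    · exact absurd (Or.inr ⟨l, hl, hla.symm⟩) ha'I
    · exact absurd hla.symm (hS.adj₁₂ _ ma' _ hl).2
    · exact absurd ((hS.adj₁₃ _ ma' _ hl.1).2.1 hla.symm).2 hl.2
  have hXc : ∀ l ∈ X, G.Adj l c ↔ l = w' := by
    intro l hl
    refine ⟨fun hla => ?_, fun e => by rw [e]; exact (hwu' w' hw'.1).2 rfl⟩
    rw [hX] at hl
    rcases hl with ((hl | hl) | hl) | hl
    · exact absurd ((hS.adj₁₃ _ hl.1 _ mc).2.1 hla).1 hl.2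
    · exact absurd (Or.inr ⟨l, hl, hla.symm⟩) hcI
    · exact absurd hla (h2c _ hl).2
    · exact (hwu' l hl.1).1 hla
  have hww : w ≠ w' := (hS.adj₁₃ _ hw.1 _ hw'.1).1
  have hbX : b ∈ X := hX ▸ Or.inl (Or.inr mb)
  obtain ⟨F, f, f', e, hF, hFX, hf, hf', hFf, hFf'⟩ := hXconn.exists_ip (fun l => G.Adj l a')
    (fun l => G.Adj l c) ⟨w, hwX, (hXa w hwX).2 rfl⟩ ⟨w', hwX', (hXc w' hwX').2 rfl⟩
  obtain rfl : f = w := (hXa f (hFX hF.left_mem)).1 hf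
  obtain rfl : f' = w' := (hXc f' (hFX hF.right_mem)).1 hf'
  have hcyc := ((IP.single a').join hF hf.symm (by
    rintro s rfl l hl
    exact ⟨fun e => ha'X (e ▸ hFX hl), fun ha => ⟨rfl, hFf l hl ha.symm⟩⟩)).close (w := c) (by
      rintro (e | hl)
      · exact hac.ne e.symm
      · exact hcX (hFX hl)) hac hf' (by
      rintro s (rfl | hs) ha
      · exact Or.inl rfl
      · exact Or.inr (hFf' s hs ha))
  have he : 1 ≤ e := by
    by_contra hlt
    have e0 : e = 0 := by omega
    subst e0
    obtain ⟨p, rfl, rfl, -, -⟩ := hF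
    exact hww rfl
  have hm : 3 ≤ 0 + 1 + e + 1 := by omega
  generalize 0 + 1 + e + 1 = m at *
  have hSF : ∀ s ∈ {a'} ∪ F ∪ {c}, s ≠ a' → s ≠ c → s ∈ F := by
    rintro s ((rfl | hs) | rfl) h1 h2
    · exact absurd rfl h1
    · exact hs
    · exact absurd rfl h2
  have hXa' : ∀ l ∈ X, l ∉ {a'} ∪ F ∪ {c} → ¬ G.Adj l a' ∧ ¬ G.Adj l c := by
    intro l hl hlS
    refine ⟨fun ha => hlS (Or.inl (Or.inr ?_)), fun ha => hlS (Or.inl (Or.inr ?_))⟩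
    · rw [(hXa l hl).1 ha]; exact hF.left_mem
    · rw [(hXc l hl).1 ha]; exact hF.right_mem
  have hfa : f ≠ a' := fun e => ha'X (e ▸ hwX)
  have hfc : f ≠ c := fun e => hcX (e ▸ hwX)
  have hfS : f ∈ {a'} ∪ F ∪ {c} := Or.inl (Or.inr hF.left_mem)
  have hdF : ∃ l ∈ F, G.Adj d l := by
    by_contra hno
    push Not at hno
    refine hG.false_of_triangle_link hcyc hm had.symm hcd'.symm ?_ (L := S₄ ∪ X)
      (hS.ip₄.conn.union hXconn md' (Or.inr ⟨b', hX ▸ Or.inl (Or.inr mb'),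
        hS.swap₃₄.swap₁₂.adj_ac.symm⟩)) (Or.inl md) ?_ ?_ ?_
      ⟨f, hfS, hfa, hfc, Or.inl (Or.inr hwX)⟩
    · intro s hs h1 h2
      have := hSF s hs h1 h2
      exact ⟨fun e => hdX (e ▸ hFX this), hno s this⟩
    · rintro (hl | hl)
      · exact (hS.adj₁₄ _ ma' _ hl).1 rfl
      · exact ha'X hl
    · rintro (hl | hl)
      · exact (hS.adj₃₄ _ mc _ hl).1 rfl
      · exact hcX hl
    · rintro l (hl | hl) hld hlS
      · refine ⟨fun ha => hld ((hS.adj₁₄ _ ma' _ hl).2.1 ha.symm).2, fun ha => ?_⟩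
        rcases (hS.adj₃₄ _ mc _ hl).2.1 ha.symm with h5 | h5
        · exact hld h5.2
        · exact hS.c_ne h5.1
      · exact hXa' l hl hlS
  have hCF : ∃ l ∈ F, l ∈ G.completeVerts T := by
    by_contra hno
    push Not at hno
    refine hG.false_of_edge_link h.conn h.even hcyc hm ha'C hc
      (fun s hs h1 h2 => ⟨hXT s (hFX (hSF s hs h1 h2)), hno s (hSF s hs h1 h2)⟩) hXconn hXT ha'X
      hcX hXa' ⟨b, hbX, hb.1⟩ ⟨f, hfS, hfa, hfc, Or.inl hwX⟩ ?_
    intro _ l hl hlC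
    refine ⟨f, hfS, hfa, hfc, fun hla => ?_⟩
    have hfO : f ∈ G.outerVerts T := ⟨hXT f hwX, hno f hF.left_mem⟩
    have := h.clique f hfO l hlC a' ha'C hla.symm hf (fun e => ha'X (e ▸ hl))
    exact hno f hF.left_mem ((hXa l hl).1 this ▸ hlC)
  have hmodd := hG.odd_of_cyc hcyc hm
  obtain ⟨p, rfl, rfl, hSp, hp⟩ := hcyc
  have hpF : ∀ i, 0 < i → i < m → p i ∈ F := fun i h1 h2 =>
    hSF _ (hSp ▸ ⟨i, h2.le, rfl⟩) (hp 0 i h1 h2.le).1.symm (hp i m h2 le_rfl).1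
  have hFp : ∀ l ∈ F, ∃ i, 0 < i ∧ i < m ∧ p i = l := by
    intro l hl
    obtain ⟨i, hi, rfl⟩ : l ∈ p '' Set.Iic m := hSp ▸ Or.inl (Or.inr hl)
    refine ⟨i, Nat.pos_of_ne_zero ?_, lt_of_le_of_ne hi ?_, rfl⟩
    · rintro rfl; exact ha'X (hFX hl)
    · rintro rfl; exact hcX (hFX hl)
  have hpT : ∀ i ≤ m, p i ∉ T := by
    intro i hi
    rcases Nat.eq_zero_or_pos i with rfl | h1
    · exact ha'C.1
    rcases hi.eq_or_lt with rfl | h2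
    · exact hc.1
    · exact hXT _ (hFX (hpF i h1 h2))
  have hdt : ∀ i, 0 < i → i < m → G.Touches (p i) {d} → G.Adj d (p i) := by
    rintro i h1 h2 (e | ⟨_, rfl, ha⟩)
    · exact absurd (hFX (hpF i h1 h2)) (e ▸ hdX)
    · exact ha.symm
  obtain ⟨k, hk0, hkm, hkC⟩ : ∃ i, 0 < i ∧ i < m ∧ p i ∈ G.completeVerts T := by
    obtain ⟨l, hl, hlC⟩ := hCF
    obtain ⟨i, h1, h2, rfl⟩ := hFp l hl
    exact ⟨i, h1, h2, hlC⟩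
  rcases hG.even_of_attached h.conn h.even (p := p) (m := m)
    (fun i j h1 h2 => ⟨(hp i j h1 h2).1, fun h3 => (hp i j h1 h2).2.trans (by omega)⟩) hm hpT
    ha'C hc (Conn.single d) (by rintro _ rfl; exact hdO) rfl rfl
    (by rintro l rfl; exact iff_of_true had rfl) (by rintro l rfl; exact iff_of_true hcd' rfl)
    (by
      intro i h1 h2 hiC ht
      have hdi := hdt i h1 h2 ht
      refine hww (((hXa _ (hFX (hpF i h1 h2))).1 ?_).symm.trans
        ((hXc _ (hFX (hpF i h1 h2))).1 ?_))
      · exact h.clique d hdO _ hiC _ ha'C hdi had.symm (hp 0 i h1 h2.le).1.symm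
      · exact h.clique d hdO _ hiC _ hc hdi hcd'.symm (hp i m h2 le_rfl).1)
    (by rintro rfl; exact h.mem_completeVerts_of_four hp hpT ha'C hc hk0 hkm hkC)
    (fun _ => ⟨⟨_, rfl⟩, by
      obtain ⟨l, hl, ha⟩ := hdF
      obtain ⟨i, h1, h2, rfl⟩ := hFp l hl
      exact ⟨i, h1, h2, Or.inr ⟨_, rfl, ha.symm⟩⟩, k, hk0, hkm, hkC⟩) with hev | ⟨-, hbad | hbad⟩
  · rw [Nat.odd_iff] at hmodd
    rw [Nat.even_iff] at hev
    omega
  · have hd1 := hdt 1 (by omega) (by omega) ((hbad 1 (by omega) (by omega)).2.2 rfl)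
    have e1 : p 1 = f := by
      rw [← hXa _ (hFX (hpF 1 (by omega) (by omega))), hp.adj_iff (by omega) (by omega) (by omega)]
      omega
    rw [e1] at hd1
    exact hw.2 ((hS.adj₁₄ _ hw.1 _ md).2.1 hd1.symm).1
  · have hd1 := hdt (m - 1) (by omega) (by omega) ((hbad (m - 1) (by omega) (by omega)).2.2 rfl)
    have e1 : p (m - 1) = f' := by
      rw [← hXc _ (hFX (hpF (m - 1) (by omega) (by omega))),
        hp.adj_iff (by omega) (by omega) (by omega)]
      omega
    rw [e1] at hd1
    rcases (hS.adj₃₄ _ hw'.1 _ md).2.1 hd1.symm with h5 | h5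
    · exact hw'.2 h5.1
    · exact hS.swap₃₄.c_ne h5.2

/-- Every vertex of the snake is on an induced path of length at least 3 from `a` to `b`, so `hend`
controls its `T`-complete vertices. The vertices `c` and `d` cover `T`, since a vertex of `T`
missing both would link `S₁` to `S₂`. As `b` misses both, one of them is `T`-complete. -/
theorem false_of_isSnake (h : G.IsFrame T z n) (ha : a ∈ G.sideVerts T z n)
    (hb : b ∈ G.sideVerts T (SimpleGraph.flip z n) n)
    (hend : ∀ p m, G.IndPath p m → p 0 = a → p m = b →
      p 1 ∉ G.sideVerts T z n ∧ p (m - 1) ∉ G.sideVerts T (SimpleGraph.flip z n) n)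
    (hS : G.IsSnake a b a' b' c c' d d' S₁ S₂ S₃ S₄ n₁ n₂ n₃ n₄) (h₁ : 1 ≤ n₁) : False := by
  have key : ∀ {S m}, G.IP S a b m → 3 ≤ m → ∀ s ∈ S, s ∉ T ∧
      (s ≠ a → s ≠ b → s ∈ G.completeVerts T → ¬ G.Touches s (inner z n)) := by
    rintro S m ⟨p, h0, hm, rfl, hp⟩ hm3 _ ⟨i, hi, rfl⟩
    obtain ⟨h1, h2⟩ := h.not_touches_of_indPath ha hb hend hp h0 hm hm3
    refine ⟨h1 i hi, fun h3 h4 => h2 i ?_ ?_⟩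
    · exact Nat.pos_of_ne_zero (by rintro rfl; exact h3 h0)
    · exact lt_of_le_of_ne hi (by rintro rfl; exact h4 hm)
  have l3 := hS.one_le₃
  have l4 := hS.one_le₄
  have hall : ∀ s ∈ S₁ ∪ S₂ ∪ S₃ ∪ S₄, s ∉ T ∧
      (s ≠ a → s ≠ b → s ∈ G.completeVerts T → ¬ G.Touches s (inner z n)) := by
    rintro s (((hs | hs) | hs) | hs)
    · exact key hS.ip (by omega) s (by simp [hs])
    · exact key hS.ip (by omega) s (by simp [hs])
    · exact key hS.ip (by omega) s (by simp [hs])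
    · exact key hS.swap₃₄.ip (by omega) s (by simp [hs])
  have mc := hS.ip₃.left_mem
  have md := hS.ip₄.left_mem
  have mb := hS.ip₂.left_mem
  have hcT : c ∉ T := (hall c (by simp [mc])).1
  have hdT : d ∉ T := (hall d (by simp [md])).1
  have hcd : ∀ t ∈ T, G.Adj c t ∨ G.Adj d t := by
    intro t ht
    by_contra hcon
    rw [not_or] at hcon
    refine hS.false_of_link h.inClassA (L := {t}) ?_ ?_
    · exact (hS.ip₁.conn.union (Conn.single t) hS.ip₁.left_mem (Or.inr ⟨t, rfl, ha.1.2 t ht⟩)).union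
        hS.ip₂.conn (Or.inr rfl) (Or.inr ⟨b, mb, (hb.1.2 t ht).symm⟩)
    · rintro _ rfl
      exact ⟨fun e => hcT (e ▸ ht), fun e => hdT (e ▸ ht), fun h => hcon.1 h.symm,
        fun h => hcon.2 h.symm⟩
  by_cases hc : c ∈ G.completeVerts T
  · exact h.false_of_isSnake_of_mem ha hb hS h₁ (fun s hs => (hall s hs).1)
      (fun s hs => (hall s hs).2) hcd hc
  by_cases hd : d ∈ G.completeVerts T
  · have hall' : ∀ s ∈ S₁ ∪ S₂ ∪ S₄ ∪ S₃, s ∈ S₁ ∪ S₂ ∪ S₃ ∪ S₄ := by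
      rw [Set.union_right_comm]; exact fun s hs => hs
    exact h.false_of_isSnake_of_mem ha hb hS.swap₃₄ h₁ (fun s hs => (hall s (hall' s hs)).1)
      (fun s hs => (hall s (hall' s hs)).2) (fun t ht => (hcd t ht).symm) hd
  obtain ⟨h1, h2⟩ := hS.not_adj_c b mb
  obtain ⟨h3, h4⟩ := hS.swap₃₄.not_adj_c b mb
  exact h.inClassA.false_of_cover h.conn hcT hdT hS.adj_cd hcd
    (exists_not_adj_of_mem_outerVerts ⟨hcT, hc⟩) (exists_not_adj_of_mem_outerVerts ⟨hdT, hd⟩)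
    hb.1 h1 h3 h2 h4

theorem exists_isSpecialPair [Finite V] (h : G.IsFrame T z n) : ∃ a ∈ G.completeVerts T,
    ∃ b ∈ G.completeVerts T, G.IsSpecialPair a b := by
  obtain ⟨a, ha, b, hb, hend⟩ := h.exists_ends
  refine ⟨a, ha.1, b, hb.1, h.side_ne ha hb, h.side_not_adj ha hb,
    fun _ _ hS => h.even_of_ip ha hb hend hS, ?_⟩
  intro a' b' c c' d d' S₁ S₂ S₃ S₄ n₁ n₂ n₃ n₄ hS
  constructor <;> by_contra h1
  · exact h.false_of_isSnake ha hb hend hS (by omega)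
  · refine h.flip.false_of_isSnake hb (by rwa [sideVerts_flip_flip]) ?_ hS.swap₁₂ (by omega)
    intro p m hp h0 hm
    have := hend _ m hp.flip (by simpa [SimpleGraph.flip] using hm)
      (by simpa [SimpleGraph.flip] using h0)
    rw [sideVerts_flip_flip]
    refine ⟨fun h1 => this.2 ?_, fun h1 => this.1 h1⟩
    simp only [SimpleGraph.flip]
    rcases Nat.eq_zero_or_pos m with rfl | hm0
    · exact absurd (hm.symm.trans h0) (h.side_ne ha hb)
    · rwa [show m - (m - 1) = 1 by omega]

end IsFrame

end SimpleGraph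

namespace SimpleGraph

universe u

variable {V W : Type*} {G : SimpleGraph V} {H : SimpleGraph W} {T C : Set V}

/-! ### Induced subgraphs -/

theorem Walk.IsChordless.map_embedding (f : H ↪g G) {x y : W} {p : H.Walk x y}
    (hp : p.IsChordless) : (p.map f.toHom).IsChordless := by
  rw [Walk.isChordless_iff_forall_mem_edges]
  intro u v hu hv ha
  rw [Walk.support_map, List.mem_map] at hu hv
  obtain ⟨u, hu, rfl⟩ := hu
  obtain ⟨v, hv, rfl⟩ := hv
  rw [Walk.edges_map]
  exact List.mem_map_of_mem (f := Sym2.map f.toHom) (hp.mem_edges hu hv (f.map_adj_iff.1 ha))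

theorem HasHole.map (f : H ↪g G) {n : ℕ} (h : H.HasHole n) : G.HasHole n := by
  obtain ⟨hn, v, p, hp, hc, rfl⟩ := h
  exact ⟨hn, _, p.map f.toHom, hp.map f.injective, hc.map_embedding f, Walk.length_map _ _⟩

theorem Prism.nonempty_map (f : H ↪g G) (P : H.Prism) : Nonempty G.Prism := by
  have hi : Function.Injective f.toHom := f.injective
  refine ⟨⟨fun i => f.toHom (P.a i), fun i => f.toHom (P.b i), fun i => (P.P i).map f.toHom,
    fun i => (P.isPath i).map hi, fun i => hi.ne (P.ne i), ?_, ?_⟩⟩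
  · intro i j hij x hx hy
    rw [Walk.support_map, List.mem_map] at hx hy
    obtain ⟨x, hx, rfl⟩ := hx
    obtain ⟨y, hy, e⟩ := hy
    obtain rfl := hi e
    exact P.disjoint i j hij hx hy
  · rintro x y ⟨i, hx⟩ ⟨j, hy⟩
    rw [Walk.support_map, List.mem_map] at hx hy
    obtain ⟨x, hx, rfl⟩ := hx
    obtain ⟨y, hy, rfl⟩ := hy
    have e : ∀ u v : W, s(f.toHom u, f.toHom v) = Sym2.map f.toHom s(u, v) := fun u v => rfl
    have h1 : G.Adj (f.toHom x) (f.toHom y) ↔ H.Adj x y := f.map_adj_iff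
    simp only [e, Walk.edges_map, List.mem_map_of_injective (Sym2.map.injective hi),
      (Sym2.map.injective hi).eq_iff, h1]
    exact P.adj_iff x y ⟨i, hx⟩ ⟨j, hy⟩

theorem InClassA.of_embedding (f : H ↪g G) (h : G.InClassA) : H.InClassA :=
  ⟨fun n hn hh => h.1 n hn (hh.map f),
    fun n hn hh => h.2.1 n hn (HasHole.map (Embedding.complEquiv f) hh),
    ⟨fun P => h.2.2.elim (P.nonempty_map f).some⟩⟩

theorem IP.induce {S : Set V} {x y : V} {n : ℕ} (h : G.IP S x y n) (hS : S ⊆ C) :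
    (G.induce C).IP (Subtype.val ⁻¹' S) ⟨x, hS h.left_mem⟩ ⟨y, hS h.right_mem⟩ n := by
  classical
  have hx := hS h.left_mem
  obtain ⟨p, rfl, rfl, rfl, hp⟩ := h
  have hC : ∀ i ≤ n, p i ∈ C := fun i hi => hS ⟨i, hi, rfl⟩
  have hv : ∀ i ≤ n, (if h : p i ∈ C then (⟨p i, h⟩ : C) else ⟨p 0, hx⟩).1 = p i :=
    fun i hi => by rw [dif_pos (hC i hi)]
  refine ⟨fun i => if h : p i ∈ C then ⟨p i, h⟩ else ⟨p 0, hx⟩, Subtype.ext (hv 0 (by omega)),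
    Subtype.ext (hv n le_rfl), ?_, ?_⟩
  · ext ⟨v, hvC⟩
    constructor
    · rintro ⟨i, hi, e⟩
      exact ⟨i, hi, Subtype.ext ((hv i hi).trans e)⟩
    · rintro ⟨i, hi, e⟩
      exact ⟨i, hi, (hv i hi).symm.trans (congrArg Subtype.val e)⟩
  · intro i j hij hj
    rw [comap_adj, ne_eq, Subtype.ext_iff]
    simp only [Function.Embedding.subtype_apply, hv i (by omega), hv j hj]
    exact hp i j hij hj

theorem IsSnake.induce {a b a' b' c c' d d' : V} {S₁ S₂ S₃ S₄ : Set V} {n₁ n₂ n₃ n₄ : ℕ}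
    (h : G.IsSnake a b a' b' c c' d d' S₁ S₂ S₃ S₄ n₁ n₂ n₃ n₄)
    (h₁ : S₁ ⊆ C) (h₂ : S₂ ⊆ C) (h₃ : S₃ ⊆ C) (h₄ : S₄ ⊆ C) :
    (G.induce C).IsSnake ⟨a, h₁ h.ip₁.left_mem⟩ ⟨b, h₂ h.ip₂.left_mem⟩ ⟨a', h₁ h.ip₁.right_mem⟩
      ⟨b', h₂ h.ip₂.right_mem⟩ ⟨c, h₃ h.ip₃.left_mem⟩ ⟨c', h₃ h.ip₃.right_mem⟩
      ⟨d, h₄ h.ip₄.left_mem⟩ ⟨d', h₄ h.ip₄.right_mem⟩ (Subtype.val ⁻¹' S₁) (Subtype.val ⁻¹' S₂)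
      (Subtype.val ⁻¹' S₃) (Subtype.val ⁻¹' S₄) n₁ n₂ n₃ n₄ := by
  refine ⟨h.ip₁.induce h₁, h.ip₂.induce h₂, h.ip₃.induce h₃, h.ip₄.induce h₄, h.one_le₃, h.one_le₄,
    ?_, ?_, ?_, ?_, ?_, ?_⟩
  all_goals
    rintro ⟨x, hxC⟩ hx ⟨y, hyC⟩ hy
    simp only [ne_eq, Subtype.mk.injEq, comap_adj, Function.Embedding.subtype_apply]
  · exact h.adj₁₂ x hx y hy
  · exact h.adj₁₃ x hx y hy
  · exact h.adj₁₄ x hx y hy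
  · exact h.adj₂₃ x hx y hy
  · exact h.adj₂₄ x hx y hy
  · exact h.adj₃₄ x hx y hy

theorem IP.reachable {S : Set V} {x y : V} {n : ℕ} (h : G.IP S x y n) : G.Reachable x y := by
  obtain ⟨w, -⟩ := h.exists_walk
  exact ⟨w⟩

/-! ### Disjoint unions of cliques -/

theorem IsDisjointUnionOfCliques.adj_of_reachable (h : G.IsDisjointUnionOfCliques) {x y : V}
    (hr : G.Reachable x y) (hne : x ≠ y) : G.Adj x y :=
  h (G.connectedComponentMk x) rfl (ConnectedComponent.eq.2 hr.symm) hne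

theorem IsDisjointUnionOfCliques.isSpecialPair (h : G.IsDisjointUnionOfCliques) {x y : V}
    (hne : x ≠ y) (hn : ¬ G.Adj x y) : G.IsSpecialPair x y := by
  have hr : ¬ G.Reachable x y := fun hr => hn (h.adj_of_reachable hr hne)
  exact ⟨hne, hn, fun S m hS => absurd hS.reachable hr,
    fun _ _ _ _ _ _ _ _ _ _ _ _ _ _ hS => absurd hS.ip.reachable hr⟩

/-- If the neighbours of each vertex were pairwise adjacent, being equal or adjacent would be
transitive and all components would be cliques. So some vertex has two non-adjacent neighbours. -/
theorem exists_isInteresting_singleton (h : ¬ G.IsDisjointUnionOfCliques) :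
    ∃ x, G.IsInteresting {x} := by
  by_contra hcon
  push Not at hcon
  have hclique : ∀ x u v, G.Adj u x → G.Adj v x → u ≠ v → G.Adj u v := by
    intro x u v hu hv hne
    by_contra hadj
    refine hcon x ⟨⟨x, rfl⟩, { preconnected := conn_iff_preconnected.1 (Conn.single x) }, ?_⟩
    intro hc
    refine hadj (hc ⟨hu.ne, ?_⟩ ⟨hv.ne, ?_⟩ hne)
    · rintro _ rfl; exact hu
    · rintro _ rfl; exact hv
  refine h fun K x hx y hy hne => ?_
  have hr : G.Reachable x y := ConnectedComponent.eq.1 (hx.trans hy.symm)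
  obtain ⟨w⟩ := hr
  have : ∀ {x y : V} (w : G.Walk x y), x = y ∨ G.Adj x y := by
    intro x y w
    induction w with
    | nil => exact Or.inl rfl
    | @cons a b c hab _ ih =>
      by_cases e : a = c
      · exact Or.inl e
      · rcases ih with rfl | hbc
        · exact Or.inr hab
        · exact Or.inr (hclique b a c hab hbc.symm e)
  exact (this w).resolve_left hne

/-! ### Existence of special even pairs -/

theorem completeVerts_anti {T T' : Set V} (h : T ⊆ T') :
    G.completeVerts T' ⊆ G.completeVerts T :=
  fun _ hv => ⟨fun ht => hv.1 (h ht), fun t ht => hv.2 t (h ht)⟩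

/-- Otherwise `T ∪ {o}` would be interesting: a non-neighbour of `o` in `T` keeps it co-connected,
and the non-adjacent `u` and `v` are complete to it. -/
theorem adj_of_maximal (hT : Maximal G.IsInteresting T) {o u v : V} (ho : o ∈ G.outerVerts T)
    (hu : u ∈ G.completeVerts T) (hv : v ∈ G.completeVerts T) (hou : G.Adj o u) (hov : G.Adj o v)
    (hne : u ≠ v) : G.Adj u v := by
  by_contra hadj
  obtain ⟨hTne, hTc, -⟩ := hT.prop
  obtain ⟨t, ht, hot⟩ := exists_not_adj_of_mem_outerVerts ho
  have hot' : Gᶜ.Adj t o := by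
    rw [compl_adj]
    exact ⟨fun e => ho.1 (e ▸ ht), fun ha => hot ha.symm⟩
  have hconn := (conn_iff_preconnected.2 hTc.preconnected).union (Conn.single o) ht
    (Or.inr ⟨o, rfl, hot'⟩)
  have hne' : (T ∪ {o}).Nonempty := hTne.mono Set.subset_union_left
  have hint : G.IsInteresting (T ∪ {o}) := by
    refine ⟨hne', ?_, fun hc => hadj (hc ?_ ?_ hne)⟩
    · have := hne'.to_subtype
      exact { preconnected := conn_iff_preconnected.1 hconn }
    · refine ⟨?_, ?_⟩
      · rintro (h | h)
        · exact hu.1 h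
        · exact ne_of_mem_completeVerts hu ho h
      · rintro s (hs | rfl)
        · exact hu.2 s hs
        · exact hou.symm
    · refine ⟨?_, ?_⟩
      · rintro (h | h)
        · exact hv.1 h
        · exact ne_of_mem_completeVerts hv ho h
      · rintro s (hs | rfl)
        · exact hv.2 s hs
        · exact hov.symm
  exact ho.1 (hT.le_of_ge hint Set.subset_union_left (Or.inr rfl))

/-- If no outer vertices form the interior of an induced path between `T`-complete vertices, then
every induced path of length other than `2` between two nonadjacent `T`-complete vertices has only
`T`-complete vertices. -/
theorem IP.subset_completeVerts
    (hno : ∀ S x y k, G.IP S x y k → 2 ≤ k → x ∈ G.completeVerts T → y ∈ G.completeVerts T →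
      ¬ ∀ s ∈ S, s ≠ x → s ≠ y → s ∈ G.outerVerts T) {S : Set V} {a b : V} {m : ℕ}
    (h : G.IP S a b m) (ha : a ∈ G.completeVerts T) (hb : b ∈ G.completeVerts T) (hm : m ≠ 2) :
    S ⊆ G.completeVerts T := by
  classical
  obtain ⟨p, rfl, rfl, rfl, hp⟩ := h
  -- A vertex of `T` on the path would be adjacent to both ends, forcing length 2.
  have hT : ∀ i ≤ m, p i ∉ T := by
    intro i hi ht
    have h1 := ha.2 _ ht
    have h2 := hb.2 _ ht
    rw [hp.adj_iff (by omega) (by omega)] at h1 h2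
    omega
  rintro _ ⟨k, hk, rfl⟩
  by_contra hkC
  simp only [Set.mem_Iic] at hk
  -- The nearest `T`-complete vertices on either side of an outer `p k` bound an outer path.
  have hi := Nat.findGreatest_spec (P := fun i => p i ∈ G.completeVerts T) (Nat.zero_le k) ha
  have hik := Nat.findGreatest_le (P := fun i => p i ∈ G.completeVerts T) k
  have hmax : ∀ l, Nat.findGreatest (fun i => p i ∈ G.completeVerts T) k < l → l ≤ k →
      p l ∉ G.completeVerts T := fun l h1 h2 => Nat.findGreatest_is_greatest h1 h2
  generalize Nat.findGreatest (fun i => p i ∈ G.completeVerts T) k = i at *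
  have hex : ∃ j, k ≤ j ∧ j ≤ m ∧ p j ∈ G.completeVerts T := ⟨m, hk, le_rfl, hb⟩
  obtain ⟨hkj, hjm, hj⟩ := Nat.find_spec hex
  have hmin : ∀ l, l < Nat.find hex → k ≤ l → l ≤ m → p l ∉ G.completeVerts T :=
    fun l hl h1 h2 h3 => Nat.find_min hex hl ⟨h1, h2, h3⟩
  generalize Nat.find hex = j at *
  have hki : i ≠ k := by rintro rfl; exact hkC hi
  have hkj' : j ≠ k := by rintro rfl; exact hkC hj
  refine hno _ _ _ _ (hp.seg (i := i) (j := j) (by omega) hjm) (by omega) hi hj ?_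
  rintro _ ⟨l, ⟨h1, h2⟩, rfl⟩ h3 h4
  have h5 : l ≠ i := by rintro rfl; exact h3 rfl
  have h6 : l ≠ j := by rintro rfl; exact h4 rfl
  refine ⟨hT l (by omega), ?_⟩
  rcases Nat.le_total l k with h7 | h7
  · exact hmax l (by omega) h7
  · exact hmin l (by omega) h7 (by omega)

/-- Paths of length 2 are even anyway. All others stay in `C(T)`, and so does a snake, being covered
by its two long paths. -/
theorem IsSpecialPair.of_induce
    (hno : ∀ S x y k, G.IP S x y k → 2 ≤ k → x ∈ G.completeVerts T → y ∈ G.completeVerts T →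
      ¬ ∀ s ∈ S, s ≠ x → s ≠ y → s ∈ G.outerVerts T) {a b : G.completeVerts T}
    (h : (G.induce (G.completeVerts T)).IsSpecialPair a b) : G.IsSpecialPair a.1 b.1 := by
  refine ⟨fun e => h.ne (Subtype.ext e), h.not_adj, fun S m hS => ?_, ?_⟩
  · by_cases hm : m = 2
    · rw [hm]; exact even_two
    · exact h.even _ _ (hS.induce (hS.subset_completeVerts hno a.2 b.2 hm))
  · intro a' b' c c' d d' S₁ S₂ S₃ S₄ n₁ n₂ n₃ n₄ hS
    have l3 := hS.one_le₃
    have l4 := hS.one_le₄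
    have h3 := hS.ip.subset_completeVerts hno a.2 b.2 (by omega)
    have h4 := hS.swap₃₄.ip.subset_completeVerts hno a.2 b.2 (by omega)
    exact h.length_eq_zero _ _ _ _ _ _ _ _ _ _ _ _ _ _
      (hS.induce (fun s hs => h3 (by simp [hs])) (fun s hs => h3 (by simp [hs]))
        (fun s hs => h3 (by simp [hs])) (fun s hs => h4 (by simp [hs])))

/-- The vertex type varies in the induction, since the inductive step passes to the subtype `C(T)`.
-/
theorem InClassA.exists_isSpecialPair (k : ℕ) : ∀ {V : Type u} [Finite V] {G : SimpleGraph V}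
    {T : Set V}, Nat.card V = k → G.InClassA → G.IsInteresting T →
      ∃ a ∈ G.completeVerts T, ∃ b ∈ G.completeVerts T, G.IsSpecialPair a b := by
  classical
  induction k using Nat.strong_induction_on with
  | _ k ih =>
  intro V _ G T₀ hk hG hT₀
  obtain ⟨T, hsub, hT⟩ := Finite.exists_le_maximal (p := G.IsInteresting) hT₀
  suffices ∃ a ∈ G.completeVerts T, ∃ b ∈ G.completeVerts T, G.IsSpecialPair a b by
    obtain ⟨a, ha, b, hb, hab⟩ := this
    exact ⟨a, completeVerts_anti hsub ha, b, completeVerts_anti hsub hb, hab⟩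
  obtain ⟨hTne, hTc, hTn⟩ := hT.prop
  have hconn : Gᶜ.Conn T := conn_iff_preconnected.2 hTc.preconnected
  by_cases hex : ∃ k, 2 ≤ k ∧ ∃ S x y, G.IP S x y k ∧ x ∈ G.completeVerts T ∧
      y ∈ G.completeVerts T ∧ ∀ s ∈ S, s ≠ x → s ≠ y → s ∈ G.outerVerts T
  · obtain ⟨h2, S, x, y, hS, hx, hy, hO⟩ := Nat.find_spec hex
    have hmin : ∀ l, 2 ≤ l → ∀ S x y, G.IP S x y l → x ∈ G.completeVerts T →
        y ∈ G.completeVerts T → (∀ s ∈ S, s ≠ x → s ≠ y → s ∈ G.outerVerts T) →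
        Nat.find hex ≤ l := fun l h2 S x y h3 h4 h5 h6 =>
      Nat.find_min' hex ⟨h2, S, x, y, h3, h4, h5, h6⟩
    generalize Nat.find hex = n at *
    obtain ⟨z, rfl, rfl, rfl, hz⟩ := hS
    exact IsFrame.exists_isSpecialPair (z := z) (n := n)
      ⟨hG, hconn, hTne, hG.evenOuter hconn,
        fun o ho u hu v hv hou hov hne => adj_of_maximal hT ho hu hv hou hov hne, hz, h2, hx, hy,
        fun i h1 h3 => hO _ ⟨i, h3.le, rfl⟩ (hz 0 i h1 h3.le).1.symm (hz i n h3 le_rfl).1,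
        fun S x y k h1 h2 h3 h4 h5 => hmin k h2 S x y h1 h3 h4 h5⟩
  · have hno : ∀ S x y k, G.IP S x y k → 2 ≤ k → x ∈ G.completeVerts T →
        y ∈ G.completeVerts T → ¬ ∀ s ∈ S, s ≠ x → s ≠ y → s ∈ G.outerVerts T :=
      fun S x y k h1 h2 h3 h4 h5 => hex ⟨k, h2, S, x, y, h1, h3, h4, h5⟩
    suffices ∃ a b, (G.induce (G.completeVerts T)).IsSpecialPair a b by
      obtain ⟨a, b, hab⟩ := this
      exact ⟨a, a.2, b, b.2, hab.of_induce hno⟩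
    by_cases hdu : (G.induce (G.completeVerts T)).IsDisjointUnionOfCliques
    · simp only [IsClique, Set.Pairwise, not_forall] at hTn
      obtain ⟨a, ha, b, hb, hne, hab⟩ := hTn
      exact ⟨⟨a, ha⟩, ⟨b, hb⟩, hdu.isSpecialPair (fun e => hne (congrArg Subtype.val e)) hab⟩
    · obtain ⟨x, hx⟩ := exists_isInteresting_singleton hdu
      -- The set `T` is non-empty and disjoint from `C(T)`, so the induced graph has fewer vertices.
      obtain ⟨t, ht⟩ := hTne
      obtain ⟨a, -, b, -, hab⟩ := ih _ (hk ▸ Finite.card_subtype_lt (x := t) fun h => h.1 ht) rfl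
        (hG.of_embedding (Embedding.induce _)) hx
      exact ⟨a, b, hab⟩

end SimpleGraph

theorem theorem1 {V : Type*} [Finite V] (G : SimpleGraph V) (hG : G.InClassA)
    (hnc : ¬ G.IsDisjointUnionOfCliques) (T : Set V) (hT : G.IsInteresting T) :
    ∃ a ∈ G.completeVerts T, ∃ b ∈ G.completeVerts T, G.IsSpecialEvenPair a b := by
  obtain ⟨a, ha, b, hb, hab⟩ := SimpleGraph.InClassA.exists_isSpecialPair _ rfl hG hT
  exact ⟨a, ha, b, hb, hab.isSpecialEvenPair⟩
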